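/- For $\beta,\mu>0$ let $f_{\rm FD}(x)=1/(1+e^{x})$, and for $a>0$ and $0<b\le\frac34\beta^{-1}$ let $\Gamma\subset\mathbb C$ be the contour which comes from $+\infty+ib$ parallel to the real axis to $-a+ib$, goes straight down to $-a-ib$, and returns parallel to the real axis to $+\infty-ib$. For a bounded operator $A$ on $L^2(\mathbb R^3)=L^2(\mathbb R^3;\mathbb C)$, its density $\operatorname{den}A$ (if it exists) is the locally integrable function with $\operatorname{Tr}(\chi A)=\int_{\mathbb R^3}\chi\operatorname{den}A$ for all $\chi\in C_c^\infty(\mathbb R^3)$, where $\chi$ also denotes the multiplication operator. The linearization at $\phi=0$ of the reduced Hartree–Fock equation $-\frac1{4\pi}\Delta\phi=\kappa-\operatorname{den}f_{\rm FD}(\beta(-\Delta-\phi-\mu))$ is the operator $$L=-\frac1{4\pi}\Delta+M,\qquad M\varphi=-\operatorname{den}\frac1{2\pi i}\int_\Gamma f_{\rm FD}(\beta(z-\mu))\,(z+\Delta)^{-1}\varphi\,(z+\Delta)^{-1}\,dz ,$$ on $L^2(\mathbb R^3)$ with domain $H^2(\mathbb R^3)$; here $\varphi\in L^2(\mathbb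 R^3)$ acts between the resolvents as a multiplication operator. **Theorem.** There is a universal constant $c_0>0$ such that for all $\beta,\mu>0$ and all contours $\Gamma$ as above, $M$ is a well-defined bounded linear operator on $L^2(\mathbb R^3)$, and $$L\ \ge\ c_0\,(-\Delta+m_*),\qquad m_*=\min(\mu,\sqrt\mu),$$ in the sense of quadratic forms: for all $u\in H^2(\mathbb R^3)$ the number $\langle u,Lu\rangle$ is real and $\langle u,Lu\rangle\ge c_0\,\langle u,(-\Delta+m_*)u\rangle$. -/

import Mathlib

open MeasureTheory TemperedDistribution
open scoped InnerProductSpace SchwartzMap Laplacian ContDiff ENNReal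

noncomputable section

namespace REHF

/-- Three-dimensional Euclidean space. -/
abbrev Space : Type := EuclideanSpace ℝ (Fin 3)

/-- The complex Hilbert space `L²(ℝ³)`. -/
abbrev LTwo : Type := Lp ℂ 2 (volume : Measure Space)

/-- An `L²` function is determined by the tempered distribution it defines. -/
theorem toTemperedDistribution_injective {u v : LTwo} (h : (u : 𝓢'(Space, ℂ)) = v) : u = v := by
  have hk := Lp.ker_toTemperedDistributionCLM_eq_bot
    (F := ℂ) (μ := (volume : Measure Space)) (p := 2)
  exact LinearMap.ker_eq_bot.mp hk h

/-- The Sobolev space `H²(ℝ³)`, as a subspace of `L²(ℝ³)`. -/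
def sobolevTwo : Submodule ℂ LTwo where
  carrier := {u | MemSobolev 2 2 (u : 𝓢'(Space, ℂ))}
  add_mem' {u v} hu hv := by
    have h := MemSobolev.add hu hv
    rw [← Lp.toTemperedDistributionCLM_apply, ← Lp.toTemperedDistributionCLM_apply,
      ← map_add] at h
    exact h
  zero_mem' := by
    have h := memSobolev_fun_zero Space ℂ 2 2
    rw [← map_zero (Lp.toTemperedDistributionCLM ℂ (volume : Measure Space) 2)] at h
    exact h
  smul_mem' c u hu := by
    have h := MemSobolev.smul c hu
    rw [← Lp.toTemperedDistributionCLM_apply, ← map_smul] at h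
    exact h

/-- The distributional Laplacian of an `H²` function is (represented by) an `L²` function. -/
theorem exists_negLaplacian (u : sobolevTwo) :
    ∃ v : LTwo, (v : 𝓢'(Space, ℂ)) = -Δ ((u : LTwo) : 𝓢'(Space, ℂ)) := by
  have h : MemSobolev 0 2 (-Δ ((u : LTwo) : 𝓢'(Space, ℂ))) := by
    have := (MemSobolev.laplacian (s := 2) u.2).neg
    simpa using this
  obtain ⟨v, hv⟩ := memSobolev_zero_iff.mp h
  exact ⟨v, hv.symm⟩

/-- The operator `-Δ` on `L²(ℝ³)` with domain `H²(ℝ³)`. -/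
def negLaplacian : LTwo →ₗ.[ℂ] LTwo where
  domain := sobolevTwo
  toFun :=
    { toFun := fun u => (exists_negLaplacian u).choose
      map_add' := fun u v => by
        apply toTemperedDistribution_injective
        rw [(exists_negLaplacian (u + v)).choose_spec]
        rw [← Lp.toTemperedDistributionCLM_apply (f := _ + _), map_add,
          Lp.toTemperedDistributionCLM_apply, Lp.toTemperedDistributionCLM_apply,
          (exists_negLaplacian u).choose_spec, (exists_negLaplacian v).choose_spec]
        rw [← Lp.toTemperedDistributionCLM_apply, ← Lp.toTemperedDistributionCLM_apply,
          ← Lp.toTemperedDistributionCLM_apply, Submodule.coe_add, map_add]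
        rw [← laplacianCLM_apply, ← laplacianCLM_apply, ← laplacianCLM_apply, map_add, neg_add]
      map_smul' := fun c u => by
        apply toTemperedDistribution_injective
        rw [(exists_negLaplacian (c • u)).choose_spec]
        rw [← Lp.toTemperedDistributionCLM_apply (f := (RingHom.id ℂ) c • _), map_smul,
          Lp.toTemperedDistributionCLM_apply, (exists_negLaplacian u).choose_spec]
        rw [← Lp.toTemperedDistributionCLM_apply, ← Lp.toTemperedDistributionCLM_apply,
          Submodule.coe_smul, map_smul]
        rw [← laplacianCLM_apply, ← laplacianCLM_apply, map_smul, smul_neg, RingHom.id_apply] }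

/-- The defining property of `-Δ`. -/
theorem negLaplacian_spec (u : sobolevTwo) :
    ((negLaplacian u : LTwo) : 𝓢'(Space, ℂ)) = -Δ ((u : LTwo) : 𝓢'(Space, ℂ)) :=
  (exists_negLaplacian u).choose_spec

open Classical in
/-- The resolvent `(z + Δ)⁻¹ = (z - (-Δ))⁻¹` applied to `g`: the solution `u ∈ H²(ℝ³)` of
`z u + Δ u = g` (unique when `z ∉ [0, ∞)`). -/
def resolventAt (z : ℂ) (g : LTwo) : LTwo :=
  if h : ∃ u : sobolevTwo, z • (u : LTwo) - negLaplacian u = g then (h.choose : LTwo) else 0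

open Classical in
/-- The operator of multiplication by a function `f`, on `{u ∈ L² : f u ∈ L²}` (extended by zero
to the other vectors). -/
def mulOp (f : Space → ℂ) (u : LTwo) : LTwo :=
  if h : MemLp (fun x => f x * u x) 2 (volume : Measure Space) then h.toLp _ else 0

/-- The Fermi-Dirac function `1 / (1 + e ^ w)`. -/
def fermiDirac (w : ℂ) : ℂ := 1 / (1 + Complex.exp w)

/-- `F` is integrable along the contour `Γ` that comes from `+∞ + i b`, runs parallel to the real
axis to `-a + i b`, then straight down to `-a - i b`, and back to `+∞ - i b`. -/
def ContourIntegrable (a b : ℝ) (F : ℂ → LTwo) : Prop :=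
  IntegrableOn (fun t : ℝ => F (t + b * Complex.I)) (Set.Ioi (-a)) ∧
  IntervalIntegrable (fun s : ℝ => F (-a + s * Complex.I)) volume (-b) b ∧
  IntegrableOn (fun t : ℝ => F (t - b * Complex.I)) (Set.Ioi (-a))

/-- The contour integral `∫_Γ F(z) dz` over the contour of `ContourIntegrable`. -/
def contourIntegral (a b : ℝ) (F : ℂ → LTwo) : LTwo :=
  -(∫ t in Set.Ioi (-a), F (t + b * Complex.I))
    - Complex.I • (∫ s in (-b)..b, F (-a + s * Complex.I))
    + ∫ t in Set.Ioi (-a), F (t - b * Complex.I)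

/-- The integrand `f_FD(β(z-μ)) (z+Δ)⁻¹ φ (z+Δ)⁻¹`, applied to `g`. -/
def responseIntegrand (β μ : ℝ) (φ g : LTwo) (z : ℂ) : LTwo :=
  fermiDirac (β * (z - μ)) • resolventAt z (mulOp φ (resolventAt z g))

/-- The operator `(2πi)⁻¹ ∫_Γ f_FD(β(z-μ)) (z+Δ)⁻¹ φ (z+Δ)⁻¹ dz` on `L²(ℝ³)`. -/
def responseContourOp (a b β μ : ℝ) (φ g : LTwo) : LTwo :=
  (1 / (2 * Real.pi * Complex.I) : ℂ) • contourIntegral a b (responseIntegrand β μ φ g)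

/-- The operator `T` on `L²(ℝ³)` is of trace class with trace `t`: in every orthonormal basis, the
sum of its diagonal elements converges absolutely, with value `t`. -/
def HasTrace (T : LTwo → LTwo) (t : ℂ) : Prop :=
  ∀ (ι : Type) (e : HilbertBasis ι ℂ LTwo), HasSum (fun i => ⟪e i, T (e i)⟫_ℂ) t

/-- `ρ` is the density `den T` of the operator `T`: `Tr (χ T) = ∫ χ ρ` for every
`χ ∈ C_c^∞(ℝ³)`. -/
def IsDensity (T : LTwo → LTwo) (ρ : Space → ℂ) : Prop :=
  LocallyIntegrable ρ ∧
  ∀ χ : Space → ℂ, ContDiff ℝ ∞ χ → HasCompactSupport χ →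
    HasTrace (fun g => mulOp χ (T g)) (∫ x, χ x * ρ x)

/-- The bounded operator `M` on `L²(ℝ³)` is given by
`M φ = -den (2πi)⁻¹ ∫_Γ f_FD(β(z-μ)) (z+Δ)⁻¹ φ (z+Δ)⁻¹ dz`, where the integral converges strongly
and the density exists. -/
def IsDensityResponse (a b β μ : ℝ) (M : LTwo →L[ℂ] LTwo) : Prop :=
  ∀ φ : LTwo, (∀ g, ContourIntegrable a b (responseIntegrand β μ φ g)) ∧
    IsDensity (responseContourOp a b β μ φ) (fun x => -(M φ x))

/-- The density of an operator is unique up to a null set. -/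
theorem IsDensity.ae_eq {T : LTwo → LTwo} {ρ ρ' : Space → ℂ} (h : IsDensity T ρ)
    (h' : IsDensity T ρ') : ρ =ᵐ[volume] ρ' := by
  obtain ⟨w, e, -⟩ := exists_hilbertBasis ℂ LTwo
  refine ae_eq_of_integral_contDiff_smul_eq h.1 h'.1 fun g hg hc => ?_
  have hg' : ContDiff ℝ ∞ (fun x => (g x : ℂ)) := Complex.ofRealCLM.contDiff.comp hg
  have hc' : HasCompactSupport (fun x => (g x : ℂ)) :=
    hc.comp_left (g := fun r : ℝ => (r : ℂ)) Complex.ofReal_zero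
  have := (h.2 _ hg' hc' w e).unique (h'.2 _ hg' hc' w e)
  simpa [Complex.real_smul] using this

/-- There is at most one `M` as in `IsDensityResponse`. -/
theorem IsDensityResponse.unique {a b β μ : ℝ} {M M' : LTwo →L[ℂ] LTwo}
    (h : IsDensityResponse a b β μ M) (h' : IsDensityResponse a b β μ M') : M = M' := by
  ext1 φ
  refine Lp.ext ?_
  filter_upwards [(h φ).2.ae_eq (h' φ).2] with x hx
  exact neg_injective hx

open Classical in
/-- The operator `M` on `L²(ℝ³)`, `M φ = -den (2πi)⁻¹ ∫_Γ f_FD(β(z-μ)) (z+Δ)⁻¹ φ (z+Δ)⁻¹ dz`. -/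
def densityResponse (a b β μ : ℝ) : LTwo →L[ℂ] LTwo :=
  if h : ∃ M, IsDensityResponse a b β μ M then h.choose else 0

/-- The linearized operator `L = -(4π)⁻¹ Δ + M` on `L²(ℝ³)`, with domain `H²(ℝ³)`. -/
def linearizedOp (a b β μ : ℝ) : LTwo →ₗ.[ℂ] LTwo where
  domain := negLaplacian.domain
  toFun := (1 / (4 * Real.pi) : ℂ) • negLaplacian.toFun
    + (densityResponse a b β μ).toLinearMap ∘ₗ negLaplacian.domain.subtype

end REHF

end

/-! The operator M is a Fourier multiplier whose symbol can be written as an integral of a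
nonnegative function; the theorem is then a pointwise inequality between symbols.

On the Fourier side (z + Δ)⁻¹ is multiplication by r_z(ξ) = (z - 4π²|ξ|²)⁻¹, which is square
integrable in dimension three. Hence the resolvent has a kernel that is L² in one variable,
uniformly in the other (`ResolventBound.coeFn_resolvent`), and (z + Δ)⁻¹ φ (z + Δ)⁻¹ is a
superposition over y, with weight φ(y), of rank-one operators. Multiplied by a test function, it has
a trace in every orthonormal basis (`hasSum_integral_inner`), and its density is φ acted on by the
multiplier ∫ r_z(ξ) r_z(ξ + k) dξ (`ResolventBound.inner_green_mulLp_green`, `hasSum_trace_path`).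
The contour integral is carried along under a Fubini argument: resolvent bounds grow at most
linearly along Γ, while f_FD decays exponentially.

The sign of the symbol comes from Feynman's formula: the product of the two resolvent symbols is the
integral over θ in (0, 1] of the squared resolvent at the interpolated energy. After a translation
of ξ this energy is E = 4π²|ξ|² + 4π²θ(1-θ)|k|² (`ResolventBound.symbolCorr_eq`). Cauchy's formula
for the derivative (`integral_contourWeight_mul_inv_sq`) converts the contour integral of (z - E)⁻²
into the derivative of s ↦ f_FD(β(s - μ)) at E, which is negative. So M has the nonnegative symbol
`responseSymbol`, the integral of minus this derivative over θ and ξ, independent of a and b.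

If 4π²|k|² ≤ μ, the surface E = μ is a sphere in ξ of radius comparable to √μ. Integrating radially
outside it gives a multiple of √μ, uniformly in β, because f_FD is exactly 1/2 there
(`le_integral_fdSlope_energy`). If 4π²|k|² ≥ m_*, half of the kinetic term already dominates m_*.
These two cases give `symbol_lower_bound`, and Plancherel transfers it to the quadratic forms. -/

noncomputable section

namespace REHF

open FourierTransform Filter Topology

/-! ### Multiplication operators and Fourier multipliers on `L²(ℝ³)` -/

open Classical in
/-- Multiplication by an essentially bounded function, as a bounded operator on `L²(ℝ³)`. -/
def mulLp (m : Space → ℂ) : LTwo →L[ℂ] LTwo :=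
  if h : MemLp m ∞ (volume : Measure Space) then
    (ContinuousLinearMap.mul ℂ ℂ).holderL volume ∞ 2 2 (h.toLp m) else 0

theorem coeFn_mulLp {m : Space → ℂ} (h : MemLp m ∞ (volume : Measure Space)) (u : LTwo) :
    mulLp m u =ᵐ[volume] fun x => m x * u x := by
  rw [mulLp, dif_pos h, ContinuousLinearMap.holderL_apply_apply]
  filter_upwards [(ContinuousLinearMap.mul ℂ ℂ).coeFn_holder (r := 2) (h.toLp m) u,
    h.coeFn_toLp] with x h1 h2
  rw [h1, h2, ContinuousLinearMap.mul_apply']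

theorem memLp_top_of_continuous {m : Space → ℂ} (hm : Continuous m) {C : ℝ}
    (hC : ∀ x, ‖m x‖ ≤ C) : MemLp m ∞ (volume : Measure Space) :=
  memLp_top_of_bound hm.aestronglyMeasurable C (.of_forall hC)

/-- The Fourier multiplier `𝓕⁻¹ m 𝓕` on `L²(ℝ³)`. -/
def fourierMul (m : Space → ℂ) : LTwo →L[ℂ] LTwo :=
  (fourierInvCLM ℂ LTwo) ∘L mulLp m ∘L (fourierCLM ℂ LTwo)

theorem fourierMul_apply (m : Space → ℂ) (u : LTwo) :
    fourierMul m u = 𝓕⁻ (mulLp m (𝓕 u : LTwo)) := rfl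

theorem fourier_fourierMul (m : Space → ℂ) (u : LTwo) :
    (𝓕 (fourierMul m u) : LTwo) = mulLp m (𝓕 u : LTwo) := by
  rw [fourierMul_apply, fourier_fourierInv_eq]

theorem inner_eq_integral (u v : LTwo) : ⟪u, v⟫_ℂ = ∫ x, starRingEnd ℂ (u x) * v x := by
  rw [L2.inner_def]
  refine integral_congr_ae (.of_forall fun x => ?_)
  simp [RCLike.inner_apply, mul_comm]

theorem inner_mulLp {m : Space → ℂ} (h : MemLp m ∞ (volume : Measure Space)) (u v : LTwo) :
    ⟪u, mulLp m v⟫_ℂ = ⟪mulLp (fun x => starRingEnd ℂ (m x)) u, v⟫_ℂ := by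
  have h' : MemLp (fun x => starRingEnd ℂ (m x)) ∞ (volume : Measure Space) := h.star
  rw [inner_eq_integral, inner_eq_integral]
  refine integral_congr_ae ?_
  filter_upwards [coeFn_mulLp h v, coeFn_mulLp h' u] with x h1 h2
  rw [h1, h2]
  simp only [map_mul, Complex.conj_conj]
  ring

theorem inner_fourierInv (u v : LTwo) : ⟪u, (𝓕⁻ v : LTwo)⟫_ℂ = ⟪(𝓕 u : LTwo), v⟫_ℂ := by
  rw [← Lp.inner_fourier_eq, fourier_fourierInv_eq]

theorem inner_fourierMul {m : Space → ℂ} (h : MemLp m ∞ (volume : Measure Space)) (u v : LTwo) :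
    ⟪u, fourierMul m v⟫_ℂ = ⟪fourierMul (fun x => starRingEnd ℂ (m x)) u, v⟫_ℂ := by
  rw [fourierMul_apply, inner_fourierInv, inner_mulLp h, ← fourier_fourierMul, Lp.inner_fourier_eq]

/-! ### The Fourier transform and multiplication by functions of temperate growth -/

theorem smulLeftCLM_toTemperedDistribution {g : Space → ℂ} (hg : g.HasTemperateGrowth)
    {v w : LTwo} (h : w =ᵐ[volume] fun x => g x * v x) :
    smulLeftCLM ℂ g (v : 𝓢'(Space, ℂ)) = (w : 𝓢'(Space, ℂ)) := by
  ext φ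
  rw [smulLeftCLM_apply_apply, Lp.toTemperedDistribution_apply, Lp.toTemperedDistribution_apply]
  refine integral_congr_ae ?_
  filter_upwards [h] with x hx
  rw [SchwartzMap.smulLeftCLM_apply_apply hg, hx]
  simp only [smul_eq_mul]
  ring

theorem norm_inv_one_add_sq_le (x : Space) : ‖(((1 + ‖x‖ ^ 2 : ℝ) : ℂ))⁻¹‖ ≤ 1 := by
  rw [norm_inv, Complex.norm_real, Real.norm_of_nonneg (by positivity)]
  exact inv_le_one_of_one_le₀ (by nlinarith [sq_nonneg ‖x‖])

theorem hasTemperateGrowth_inv_one_add_sq :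
    (fun x : Space => ((1 + ‖x‖ ^ 2 : ℝ) : ℂ)⁻¹).HasTemperateGrowth := by
  have : (fun x : Space => ((1 + ‖x‖ ^ 2 : ℝ) : ℂ)⁻¹) =
      fun x : Space => (((1 + ‖x‖ ^ 2) ^ (-1 : ℝ) : ℝ) : ℂ) := by
    ext x
    rw [Real.rpow_neg_one, Complex.ofReal_inv]
  rw [this]
  fun_prop

theorem memLp_inv_one_add_sq :
    MemLp (fun x : Space => ((1 + ‖x‖ ^ 2 : ℝ) : ℂ)⁻¹) ∞ (volume : Measure Space) :=
  memLp_top_of_continuous (hasTemperateGrowth_inv_one_add_sq.1.continuous) norm_inv_one_add_sq_le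

/-- Multiplying both sides by J = (1 + |x|²)⁻¹ makes every factor bounded, so the identity becomes
one between L² functions, where distributions separate points; J never vanishes and can be
cancelled. The weight J suffices because only 1 + |x|² and multiples of |x|² occur as symbols. -/
theorem ae_eq_of_smulLeftCLM_eq {g : Space → ℂ} (hg : g.HasTemperateGrowth) {C : ℝ}
    (hC : ∀ x, ‖g x‖ ≤ C * (1 + ‖x‖ ^ 2)) {v w : LTwo}
    (h : smulLeftCLM ℂ g (v : 𝓢'(Space, ℂ)) = (w : 𝓢'(Space, ℂ))) :
    w =ᵐ[volume] fun x => g x * v x := by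
  set J : Space → ℂ := fun x : Space => ((1 + ‖x‖ ^ 2 : ℝ) : ℂ)⁻¹ with hJ
  have hJt : J.HasTemperateGrowth := hasTemperateGrowth_inv_one_add_sq
  have hJm := memLp_inv_one_add_sq
  have hJg : MemLp (g * J) ∞ (volume : Measure Space) := by
    refine memLp_top_of_continuous (hg.1.continuous.mul hJt.1.continuous) (C := C) fun x => ?_
    rw [Pi.mul_apply, norm_mul, hJ, norm_inv, Complex.norm_real,
      Real.norm_of_nonneg (by positivity)]
    rw [mul_inv_le_iff₀ (by positivity)]
    exact hC x
  have h1 := congrArg (smulLeftCLM ℂ J) h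
  rw [smulLeftCLM_smulLeftCLM_apply hg hJt,
    smulLeftCLM_toTemperedDistribution hJt (coeFn_mulLp hJm w),
    smulLeftCLM_toTemperedDistribution (hg.mul hJt) (coeFn_mulLp hJg v)] at h1
  have h2 := toTemperedDistribution_injective h1
  filter_upwards [coeFn_mulLp hJm w, coeFn_mulLp hJg v] with x hx1 hx2
  have hne : J x ≠ 0 := by
    simp only [hJ, ne_eq, inv_eq_zero, Complex.ofReal_eq_zero]
    positivity
  rw [h2] at hx2
  have := hx1.symm.trans hx2
  refine mul_left_cancel₀ hne ?_
  rw [this, Pi.mul_apply]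
  ring

theorem hasTemperateGrowth_one_add_sq :
    (fun x : Space => ((1 + ‖x‖ ^ 2 : ℝ) : ℂ)).HasTemperateGrowth := by
  fun_prop

/-- `H²(ℝ³)` is the space of `u ∈ L²` with `(1 + |ξ|²) û ∈ L²`. -/
theorem mem_sobolevTwo_iff (u : LTwo) : u ∈ sobolevTwo ↔
    MemLp (fun ξ => ((1 + ‖ξ‖ ^ 2 : ℝ) : ℂ) * (𝓕 u : LTwo) ξ) 2 (volume : Measure Space) := by
  change MemSobolev 2 2 (u : 𝓢'(Space, ℂ)) ↔ _
  rw [memSobolev_iff_exists_smulLeftCLM_fourier, Lp.fourier_toTemperedDistribution_eq]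
  have hg : (fun x : Space => (((1 + ‖x‖ ^ 2) ^ ((2 : ℝ) / 2) : ℝ) : ℂ)) =
      fun x : Space => ((1 + ‖x‖ ^ 2 : ℝ) : ℂ) := by
    ext x; norm_num
  rw [hg]
  constructor
  · rintro ⟨w, hw⟩
    have := ae_eq_of_smulLeftCLM_eq hasTemperateGrowth_one_add_sq (C := 1) (fun x => ?_) hw
    · exact (memLp_congr_ae this).1 (Lp.memLp w)
    · rw [Complex.norm_real, Real.norm_of_nonneg (by positivity), one_mul]
  · intro h
    exact ⟨h.toLp _, smulLeftCLM_toTemperedDistribution hasTemperateGrowth_one_add_sq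
      h.coeFn_toLp⟩

theorem fourier_neg_laplacian_eq (T : 𝓢'(Space, ℂ)) :
    𝓕 (-Δ T) = smulLeftCLM ℂ (fun x : Space => ((4 * Real.pi ^ 2 * ‖x‖ ^ 2 : ℝ) : ℂ)) (𝓕 T) := by
  have hg : (fun x : Space => ((‖x‖ ^ 2 : ℝ) : ℂ)).HasTemperateGrowth := by fun_prop
  have e : (fun x : Space => ((4 * Real.pi ^ 2 * ‖x‖ ^ 2 : ℝ) : ℂ)) =
      ((4 * Real.pi ^ 2 : ℝ) : ℂ) • fun x : Space => ((‖x‖ ^ 2 : ℝ) : ℂ) := by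
    ext x; simp
  have hf : fourierCLM ℂ 𝓢'(Space, ℂ) (-Δ T) = 𝓕 (-Δ T) := rfl
  rw [e, smulLeftCLM_smul hg, ← hf, laplacian_eq_fourierMultiplierCLM, map_neg,
    ContinuousLinearMap.map_smul_of_tower, fourierCLM_apply, fourierMultiplierCLM_apply, fourier_fourierInv_eq]
  ext φ
  simp
  left
  ring

/-- `-Δ` acts on Fourier transforms as multiplication by `4π²|ξ|²`. -/
theorem fourier_negLaplacian (u : sobolevTwo) :
    (𝓕 (negLaplacian u) : LTwo) =ᵐ[volume]
      fun ξ => ((4 * Real.pi ^ 2 * ‖ξ‖ ^ 2 : ℝ) : ℂ) * (𝓕 (u : LTwo) : LTwo) ξ := by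
  have h := negLaplacian_spec u
  generalize (negLaplacian u : LTwo) = w at h ⊢
  have h4 : (fun x : Space => ((4 * Real.pi ^ 2 * ‖x‖ ^ 2 : ℝ) : ℂ)).HasTemperateGrowth := by
    fun_prop
  refine ae_eq_of_smulLeftCLM_eq h4 (C := 4 * Real.pi ^ 2) (fun x => ?_) ?_
  · rw [Complex.norm_real, Real.norm_of_nonneg (by positivity)]
    nlinarith [Real.pi_pos, sq_nonneg Real.pi]
  · rw [← Lp.fourier_toTemperedDistribution_eq, ← Lp.fourier_toTemperedDistribution_eq, h,
      fourier_neg_laplacian_eq]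

/-! ### The Fourier transform on `L¹ ∩ L²` -/

/-- The inverse transform is the Fourier integral for the pairing -⟨·,·⟩. This pairing is symmetric,
so the general Fubini identity returns the same transform on the other side. -/
theorem integral_fourierInv_mul {f g : Space → ℂ} (hf : Integrable f) (hg : Integrable g) :
    ∫ x, 𝓕⁻ f x * g x = ∫ x, f x * 𝓕⁻ g x := by
  have hc : Continuous fun p : Space × Space => (-(innerₗ Space)) p.1 p.2 := by
    exact (continuous_inner (𝕜 := ℝ) (E := Space)).neg
  have h := VectorFourier.integral_fourierIntegral_smul_eq_flip (e := Real.fourierChar)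
    (L := -(innerₗ Space)) (μ := (volume : Measure Space)) (ν := (volume : Measure Space))
    Real.continuous_fourierChar hc hf hg
  have e : (-(innerₗ Space)).flip = -(innerₗ Space) := by
    ext; simp [real_inner_comm]
  rw [e] at h
  exact h

theorem integral_fourier_mul {f g : Space → ℂ} (hf : Integrable f) (hg : Integrable g) :
    ∫ x, 𝓕 f x * g x = ∫ x, f x * 𝓕 g x := by
  have h := VectorFourier.integral_fourierIntegral_smul_eq_flip (e := Real.fourierChar)
    (L := (innerₗ Space)) (μ := (volume : Measure Space)) (ν := (volume : Measure Space))
    Real.continuous_fourierChar (continuous_inner (𝕜 := ℝ) (E := Space)) hf hg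
  rw [flip_innerₗ] at h
  exact h

theorem continuous_fourier_of_integrable {f : Space → ℂ} (hf : Integrable f) :
    Continuous (𝓕 f) :=
  VectorFourier.fourierIntegral_continuous Real.continuous_fourierChar
    (continuous_inner (𝕜 := ℝ) (E := Space)) hf

theorem continuous_fourierInv_of_integrable {f : Space → ℂ} (hf : Integrable f) :
    Continuous (𝓕⁻ f) := by
  have : 𝓕⁻ f = fun x => 𝓕 f (-x) := funext fun x => Real.fourierInv_eq_fourier_neg f x
  rw [this]
  exact (continuous_fourier_of_integrable hf).comp continuous_neg

/-- Square integrable functions are determined by their integrals against Schwartz functions. -/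
theorem ae_eq_of_integral_schwartz_eq {v w : Space → ℂ} (hv : LocallyIntegrable v)
    (hw : LocallyIntegrable w) (h : ∀ φ : 𝓢(Space, ℂ), ∫ x, φ x * v x = ∫ x, φ x * w x) :
    v =ᵐ[volume] w := by
  refine ae_eq_of_integral_contDiff_smul_eq hv hw fun g hg hc => ?_
  have hg' : ContDiff ℝ ∞ (fun x => (g x : ℂ)) := Complex.ofRealCLM.contDiff.comp hg
  have hc' : HasCompactSupport (fun x => (g x : ℂ)) :=
    hc.comp_left (g := fun r : ℝ => (r : ℂ)) Complex.ofReal_zero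
  simpa [Complex.real_smul] using h (hc'.toSchwartzMap hg')

theorem locallyIntegrable_coeFn (v : LTwo) : LocallyIntegrable v :=
  (Lp.memLp v).locallyIntegrable (by norm_num)

theorem integral_mul_fourier (v : LTwo) (φ : 𝓢(Space, ℂ)) :
    ∫ x, φ x * (𝓕 v : LTwo) x = ∫ x, 𝓕 φ x * v x := by
  have := congrArg (fun T : 𝓢'(Space, ℂ) => T φ) (Lp.fourier_toTemperedDistribution_eq v)
  simp only [TemperedDistribution.fourier_apply, Lp.toTemperedDistribution_apply,
    smul_eq_mul] at this
  exact this.symm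

theorem integral_mul_fourierInv (v : LTwo) (φ : 𝓢(Space, ℂ)) :
    ∫ x, φ x * (𝓕⁻ v : LTwo) x = ∫ x, 𝓕⁻ φ x * v x := by
  have := congrArg (fun T : 𝓢'(Space, ℂ) => T φ) (Lp.fourierInv_toTemperedDistribution_eq v)
  simp only [TemperedDistribution.fourierInv_apply, Lp.toTemperedDistribution_apply,
    smul_eq_mul] at this
  exact this.symm

/-- The abstract L² transform and the integral formula have the same integrals against all Schwartz
functions. This allows pointwise formulas on L¹ ∩ L². -/
theorem coeFn_fourier_of_integrable (v : LTwo) (hv : Integrable v) :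
    (𝓕 v : LTwo) =ᵐ[volume] 𝓕 (v : Space → ℂ) := by
  refine ae_eq_of_integral_schwartz_eq (locallyIntegrable_coeFn _)
    (continuous_fourier_of_integrable hv).locallyIntegrable fun φ => ?_
  rw [integral_mul_fourier, ← integral_fourier_mul φ.integrable hv, SchwartzMap.fourier_coe]

theorem coeFn_fourierInv_of_integrable (v : LTwo) (hv : Integrable v) :
    (𝓕⁻ v : LTwo) =ᵐ[volume] 𝓕⁻ (v : Space → ℂ) := by
  refine ae_eq_of_integral_schwartz_eq (locallyIntegrable_coeFn _)
    (continuous_fourierInv_of_integrable hv).locallyIntegrable fun φ => ?_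
  rw [integral_mul_fourierInv, ← integral_fourierInv_mul φ.integrable hv,
    SchwartzMap.fourierInv_coe]

/-- The Fourier transform on `L²` is symmetric for the bilinear pairing. -/
theorem integral_mul_fourier_comm (u v : LTwo) :
    ∫ x, u x * (𝓕 v : LTwo) x = ∫ x, (𝓕 u : LTwo) x * v x := by
  -- Conjugating `u` turns the bilinear pairing into an inner product, continuous in `v`, so it is
  -- enough to treat Schwartz functions, which are dense.
  have hs : ∀ u v : LTwo, ∫ x, u x * v x = ⟪star u, v⟫_ℂ := fun u v => by
    rw [inner_eq_integral]
    refine integral_congr_ae ?_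
    filter_upwards [Lp.coeFn_star u] with x hx
    rw [hx]
    simp
  rw [hs, hs]
  refine DenseRange.induction_on (p := fun v : LTwo => ⟪star u, 𝓕 v⟫_ℂ = ⟪star (𝓕 u : LTwo), v⟫_ℂ)
    (SchwartzMap.denseRange_toLpCLM (F := ℂ) (p := 2) ENNReal.ofNat_ne_top) v ?_ ?_
  · refine isClosed_eq ?_ ?_
    · exact continuous_const.inner (fourierCLM ℂ LTwo).continuous
    · exact continuous_const.inner continuous_id
  · intro φ
    rw [SchwartzMap.toLpCLM_apply, ← hs, ← hs, SchwartzMap.toLp_fourier_eq]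
    have h1 : ∫ x, (𝓕 u : LTwo) x * (φ.toLp 2 : LTwo) x = ∫ x, φ x * (𝓕 u : LTwo) x := by
      refine integral_congr_ae ?_
      filter_upwards [φ.coeFn_toLp 2 (volume : Measure Space)] with x hx
      rw [hx, mul_comm]
    have h2 : ∫ x, u x * ((𝓕 φ).toLp 2 : LTwo) x = ∫ x, 𝓕 φ x * u x := by
      refine integral_congr_ae ?_
      filter_upwards [(𝓕 φ).coeFn_toLp 2 (volume : Measure Space)] with x hx
      rw [hx, mul_comm]
    rw [h1, h2, integral_mul_fourier]

/-- The plane wave `x ↦ e^{2πi⟨x, k⟩}`. -/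
def planeWave (k x : Space) : ℂ := (Real.fourierChar ⟪x, k⟫_ℝ : Circle)

@[simp]
theorem norm_planeWave (k x : Space) : ‖planeWave k x‖ = 1 := Circle.norm_coe _

theorem continuous_planeWave : Continuous fun p : Space × Space => planeWave p.1 p.2 :=
  continuous_subtype_val.comp (Real.continuous_fourierChar.comp (by fun_prop))

theorem memLp_planeWave (k : Space) : MemLp (planeWave k) ∞ (volume : Measure Space) :=
  memLp_top_of_continuous (C := 1) (continuous_planeWave.comp (by fun_prop : Continuous fun x => (k, x)))
    fun x => (norm_planeWave k x).le

theorem fourierInv_eq_integral_planeWave (f : Space → ℂ) (x : Space) :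
    𝓕⁻ f x = ∫ ξ, planeWave x ξ * f ξ := by
  rw [Real.fourierInv_eq]
  rfl

theorem fourier_eq_integral_planeWave (f : Space → ℂ) (x : Space) :
    𝓕 f x = ∫ ξ, planeWave (-x) ξ * f ξ := by
  rw [Real.fourier_eq]
  refine integral_congr_ae (.of_forall fun ξ => ?_)
  simp only [planeWave, inner_neg_right]
  rfl

/-- The Fourier transform intertwines modulations and translations. -/
theorem coeFn_fourier_mulLp_fourierChar (k : Space) (v : LTwo) :
    (𝓕 (mulLp (planeWave k) v) : LTwo) =ᵐ[volume]
      fun ξ => (𝓕 v : LTwo) (ξ - k) := by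
  have hm := memLp_planeWave k
  set T : LTwo →+ LTwo := Lp.compMeasurePreserving (fun ξ : Space => ξ - k)
    (measurePreserving_sub_right volume k) with hT
  have key : (𝓕 (mulLp (planeWave k) v) : LTwo) = T (𝓕 v) := by
    refine DenseRange.induction_on (p := fun v : LTwo =>
      (𝓕 (mulLp (planeWave k) v) : LTwo) = T (𝓕 v))
      (SchwartzMap.denseRange_toLpCLM (F := ℂ) (p := 2) ENNReal.ofNat_ne_top) v ?_ ?_
    · refine isClosed_eq ?_ ?_
      · exact (fourierCLM ℂ LTwo ∘L mulLp _).continuous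
      · exact (Lp.isometry_compMeasurePreserving _).continuous.comp (fourierCLM ℂ LTwo).continuous
    · intro φ
      rw [SchwartzMap.toLpCLM_apply]
      have hφ := φ.coeFn_toLp 2 (volume : Measure Space)
      have hφi : Integrable (φ.toLp 2 : LTwo) := φ.integrable.congr hφ.symm
      have hme := coeFn_mulLp hm (φ.toLp 2 : LTwo)
      have hmi : Integrable (mulLp (planeWave k) (φ.toLp 2 : LTwo)) := by
        refine Integrable.congr ?_ hme.symm
        refine hφi.bdd_mul hm.1 (c := 1) (.of_forall fun x => (norm_planeWave k x).le)
      refine Lp.ext ?_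
      have h1 := (measurePreserving_sub_right (volume : Measure Space) k).quasiMeasurePreserving.ae
        (coeFn_fourier_of_integrable _ hφi)
      filter_upwards [coeFn_fourier_of_integrable _ hmi, h1,
        Lp.coeFn_compMeasurePreserving (𝓕 (φ.toLp 2 : LTwo) : LTwo)
          (measurePreserving_sub_right (volume : Measure Space) k)] with ξ h2 h3 h4
      rw [h2, hT, h4, Function.comp_apply, h3, Real.fourier_congr_ae hme, Real.fourier_eq,
        Real.fourier_eq]
      refine integral_congr_ae (.of_forall fun x => ?_)
      simp only [planeWave, Circle.smul_def, smul_eq_mul, ← mul_assoc, ← Circle.coe_mul, ← AddChar.map_add_eq_mul]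
      rw [inner_sub_right]
      ring_nf
  rw [key]
  exact Lp.coeFn_compMeasurePreserving _ _


/-! ### Representatives in `L²(ℝ³)` -/

open Classical in
/-- The element of `L²(ℝ³)` represented by a square integrable function. -/
def toLTwo (f : Space → ℂ) : LTwo :=
  if h : MemLp f 2 (volume : Measure Space) then h.toLp f else 0

theorem coeFn_toLTwo {f : Space → ℂ} (h : MemLp f 2 (volume : Measure Space)) :
    toLTwo f =ᵐ[volume] f := by
  rw [toLTwo, dif_pos h]
  exact h.coeFn_toLp

theorem norm_sq_eq_integral (u : LTwo) : ‖u‖ ^ 2 = ∫ x, ‖u x‖ ^ 2 := by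
  have h := inner_self_eq_norm_sq_to_K (𝕜 := ℂ) u
  rw [inner_eq_integral] at h
  have e : ∫ x, starRingEnd ℂ (u x) * u x = ((∫ x, ‖u x‖ ^ 2 : ℝ) : ℂ) := by
    rw [← integral_complex_ofReal]
    refine integral_congr_ae (.of_forall fun x => ?_)
    simp only [Complex.ofReal_pow]
    rw [mul_comm, Complex.mul_conj, Complex.normSq_eq_norm_sq]
    push_cast; rfl
  rw [e] at h
  exact Complex.ofReal_injective (h.trans (by norm_cast)).symm

/-- Dominated convergence applied to the square of the difference, which is at most 4g². It provides
the joint continuity of the resolvent kernel in z and y. -/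
theorem tendsto_toLTwo {X : Type*} {l : Filter X} [l.IsCountablyGenerated] {f : X → Space → ℂ}
    {f₀ : Space → ℂ} {g : Space → ℝ} (hg : MemLp g 2 (volume : Measure Space))
    (hm : ∀ᶠ x in l, AEStronglyMeasurable (f x) (volume : Measure Space))
    (hm₀ : AEStronglyMeasurable f₀ (volume : Measure Space))
    (hb : ∀ᶠ x in l, ∀ ξ, ‖f x ξ‖ ≤ g ξ) (hb₀ : ∀ ξ, ‖f₀ ξ‖ ≤ g ξ)
    (hl : ∀ ξ, Tendsto (fun x => f x ξ) l (𝓝 (f₀ ξ))) :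
    Tendsto (fun x => toLTwo (f x)) l (𝓝 (toLTwo f₀)) := by
  have h0 : MemLp f₀ 2 (volume : Measure Space) := hg.mono' hm₀ (.of_forall hb₀)
  rw [tendsto_iff_norm_sub_tendsto_zero]
  have key : Tendsto (fun x => ∫ ξ, ‖f x ξ - f₀ ξ‖ ^ 2) l (𝓝 (∫ _ : Space, (0 : ℝ))) := by
    refine tendsto_integral_filter_of_dominated_convergence (fun ξ => 4 * g ξ ^ 2) ?_ ?_ ?_ ?_
    · filter_upwards [hm] with x hx
      exact ((hx.sub hm₀).norm.pow 2)
    · filter_upwards [hb] with x hx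
      refine .of_forall fun ξ => ?_
      rw [norm_pow, norm_norm]
      have h1 : ‖f x ξ - f₀ ξ‖ ≤ 2 * g ξ := (norm_sub_le _ _).trans (by linarith [hx ξ, hb₀ ξ])
      calc ‖f x ξ - f₀ ξ‖ ^ 2 ≤ (2 * g ξ) ^ 2 := by gcongr
        _ = 4 * g ξ ^ 2 := by ring
    · exact hg.integrable_sq.const_mul 4
    · refine .of_forall fun ξ => ?_
      have := ((hl ξ).sub_const (f₀ ξ)).norm.pow 2
      simpa using this
  rw [integral_zero] at key
  have h2 : Tendsto (fun x => ‖toLTwo (f x) - toLTwo f₀‖ ^ 2) l (𝓝 0) := by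
    refine key.congr' ?_
    filter_upwards [hm, hb] with x hmx hbx
    have hx : MemLp (f x) 2 (volume : Measure Space) := hg.mono' hmx (.of_forall hbx)
    rw [norm_sq_eq_integral]
    refine integral_congr_ae ?_
    filter_upwards [coeFn_toLTwo hx, coeFn_toLTwo h0, Lp.coeFn_sub (toLTwo (f x)) (toLTwo f₀)]
      with ξ h1 h2 h3
    rw [h3, Pi.sub_apply, h1, h2]
  have h3 := h2.sqrt
  simpa [Real.sqrt_sq] using h3

/-! ### The symbol of the resolvent -/

/-- The symbol `(z - 4π²|ξ|²)⁻¹` of `(z + Δ)⁻¹`. -/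
def resSymbol (z : ℂ) (ξ : Space) : ℂ := (z - (4 * Real.pi ^ 2 * ‖ξ‖ ^ 2 : ℝ))⁻¹

/-- A quantitative form of `z ∉ [0, ∞)`. -/
def ResolventBound (C : ℝ) (z : ℂ) : Prop := 0 < C ∧ ∀ s : ℝ, 0 ≤ s → 1 + s ≤ C * ‖z - s‖

/-- The function `(1 + 4π²|ξ|²)⁻¹`. -/
def decay (ξ : Space) : ℝ := (1 + 4 * Real.pi ^ 2 * ‖ξ‖ ^ 2)⁻¹

theorem decay_pos (ξ : Space) : 0 < decay ξ := by
  unfold decay; positivity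

theorem decay_le_one (ξ : Space) : decay ξ ≤ 1 :=
  inv_le_one_of_one_le₀ (le_add_of_nonneg_right (by positivity))

theorem continuous_decay : Continuous decay := by
  unfold decay
  refine Continuous.inv₀ (by fun_prop) fun ξ => ?_
  positivity

theorem decay_le (ξ : Space) : decay ξ ≤ (1 + ‖ξ‖ ^ 2)⁻¹ := by
  unfold decay
  gcongr
  have : (1 : ℝ) ≤ 4 * Real.pi ^ 2 := by nlinarith [Real.pi_gt_three]
  nlinarith [sq_nonneg ‖ξ‖]

/-- The square decays like |ξ|⁻⁴, which is integrable because the dimension is three. The kernel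
bounds below all rest on this. -/
theorem integrable_decay_sq : Integrable fun ξ => decay ξ ^ 2 := by
  have h : Integrable (fun ξ : Space => (1 + ‖ξ‖ ^ 2) ^ (-(4 : ℝ) / 2)) :=
    integrable_rpow_neg_one_add_norm_sq (by simp; norm_num)
  refine h.mono' (continuous_decay.pow 2).aestronglyMeasurable (.of_forall fun ξ => ?_)
  rw [Real.norm_of_nonneg (by positivity)]
  have e : (1 + ‖ξ‖ ^ 2) ^ (-(4 : ℝ) / 2) = ((1 + ‖ξ‖ ^ 2)⁻¹) ^ 2 := by
    rw [show (-(4 : ℝ) / 2) = -(2 : ℕ) by norm_num, Real.rpow_neg (by positivity),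
      Real.rpow_natCast, inv_pow]
  rw [e]
  have := decay_le ξ
  have := decay_pos ξ
  gcongr

theorem memLp_decay : MemLp decay 2 (volume : Measure Space) :=
  (memLp_two_iff_integrable_sq continuous_decay.aestronglyMeasurable).2 integrable_decay_sq

/-- The `L²` norm of `decay`. -/
def decayNorm : ℝ := ‖toLTwo fun ξ => (decay ξ : ℂ)‖

theorem decayNorm_nonneg : 0 ≤ decayNorm := norm_nonneg _

theorem norm_toLTwo_le {f : Space → ℂ} (hf : AEStronglyMeasurable f (volume : Measure Space)) {C : ℝ}
    (h : ∀ ξ, ‖f ξ‖ ≤ C * decay ξ) :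
    ‖toLTwo f‖ ≤ C * decayNorm := by
  have h1 : MemLp f 2 (volume : Measure Space) := (memLp_decay.const_mul C).mono' hf (.of_forall h)
  refine Lp.norm_le_mul_norm_of_ae_le_mul ?_
  filter_upwards [coeFn_toLTwo h1, coeFn_toLTwo memLp_decay.ofReal] with ξ h2 h3
  rw [h2]
  refine (h ξ).trans_eq ?_
  have h3' : (toLTwo fun ξ => (decay ξ : ℂ)) ξ = (decay ξ : ℂ) := h3
  rw [h3', Complex.norm_real, Real.norm_of_nonneg (decay_pos ξ).le]

theorem ResolventBound.ne {C : ℝ} {z : ℂ} (h : ResolventBound C z) {s : ℝ} (hs : 0 ≤ s) :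
    z - s ≠ 0 := by
  intro h0
  have := h.2 s hs
  rw [h0, norm_zero, mul_zero] at this
  linarith

theorem ResolventBound.norm_inv_le {C : ℝ} {z : ℂ} (h : ResolventBound C z) {s : ℝ} (hs : 0 ≤ s) :
    ‖(z - s)⁻¹‖ ≤ C * (1 + s)⁻¹ := by
  have h1 : 0 < ‖z - s‖ := norm_pos_iff.2 (h.ne hs)
  rw [norm_inv, ← div_eq_mul_inv, inv_le_comm₀ h1 (div_pos h.1 (by linarith)), inv_div,
    div_le_iff₀ h.1]
  linarith [h.2 s hs]

theorem ResolventBound.norm_resSymbol_le {C : ℝ} {z : ℂ} (h : ResolventBound C z) (ξ : Space) :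
    ‖resSymbol z ξ‖ ≤ C * decay ξ :=
  h.norm_inv_le (by positivity)

theorem ResolventBound.norm_resSymbol_le' {C : ℝ} {z : ℂ} (h : ResolventBound C z) (ξ : Space) :
    ‖resSymbol z ξ‖ ≤ C :=
  (h.norm_resSymbol_le ξ).trans (mul_le_of_le_one_right h.1.le (decay_le_one ξ))

theorem ResolventBound.conj {C : ℝ} {z : ℂ} (h : ResolventBound C z) :
    ResolventBound C (starRingEnd ℂ z) := by
  refine ⟨h.1, fun s hs => ?_⟩
  have : starRingEnd ℂ z - s = starRingEnd ℂ (z - s) := by simp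
  rw [this, RCLike.norm_conj]
  exact h.2 s hs

theorem conj_resSymbol (z : ℂ) (ξ : Space) :
    starRingEnd ℂ (resSymbol z ξ) = resSymbol (starRingEnd ℂ z) ξ := by
  unfold resSymbol
  rw [map_inv₀, map_sub, Complex.conj_ofReal]

/-- A displacement of z by less than 1/(2C) costs at most 1/2 in C|z - s|, and 1/2 + s still
controls (1 + s)/2. Having one constant near z is what dominated convergence in z requires. -/
theorem ResolventBound.eventually {C : ℝ} {z : ℂ} (h : ResolventBound C z) :
    ∀ᶠ w in 𝓝 z, ResolventBound (2 * C) w := by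
  have hC := h.1
  filter_upwards [Metric.ball_mem_nhds z (ε := 1 / (2 * C)) (by positivity)] with w hw
  refine ⟨by linarith, fun s hs => ?_⟩
  have h1 := h.2 s hs
  have h2 : ‖z - s‖ ≤ ‖w - s‖ + 1 / (2 * C) := by
    have : z - s = (w - s) - (w - z) := by ring
    rw [this]
    refine (norm_sub_le _ _).trans ?_
    have : ‖w - z‖ < 1 / (2 * C) := by rwa [← dist_eq_norm]
    linarith
  have h3 : C * (‖w - s‖ + 1 / (2 * C)) = C * ‖w - s‖ + 1 / 2 := by field_simp
  nlinarith [mul_le_mul_of_nonneg_left h2 hC.le]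

theorem ResolventBound.continuous_resSymbol {C : ℝ} {z : ℂ} (h : ResolventBound C z) :
    Continuous (resSymbol z) := by
  unfold resSymbol
  refine Continuous.inv₀ (by fun_prop) fun ξ => h.ne (by positivity)

theorem ResolventBound.continuousAt_resSymbol {C : ℝ} {z : ℂ} (h : ResolventBound C z) (ξ : Space) :
    ContinuousAt (fun w => resSymbol w ξ) z := by
  unfold resSymbol
  exact ContinuousAt.inv₀ (by fun_prop) (h.ne (by positivity))

theorem ResolventBound.memLp_resSymbol {C : ℝ} {z : ℂ} (h : ResolventBound C z) :
    MemLp (resSymbol z) ∞ (volume : Measure Space) :=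
  memLp_top_of_continuous h.continuous_resSymbol h.norm_resSymbol_le'

theorem ResolventBound.memLp_two_resSymbol {C : ℝ} {z : ℂ} (h : ResolventBound C z) :
    MemLp (resSymbol z) 2 (volume : Measure Space) :=
  (memLp_decay.const_mul C).mono' h.continuous_resSymbol.aestronglyMeasurable
    (.of_forall h.norm_resSymbol_le)

/-! ### The resolvent -/

theorem norm_mulLp_apply_le {m : Space → ℂ} (hm : MemLp m ∞ (volume : Measure Space)) {C : ℝ}
    (hC : ∀ x, ‖m x‖ ≤ C) (u : LTwo) : ‖mulLp m u‖ ≤ C * ‖u‖ := by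
  refine Lp.norm_le_mul_norm_of_ae_le_mul ?_
  filter_upwards [coeFn_mulLp hm u] with x hx
  rw [hx, norm_mul]
  gcongr
  exact hC x

theorem norm_fourierMul_apply_le {m : Space → ℂ} (hm : MemLp m ∞ (volume : Measure Space)) {C : ℝ}
    (hC : ∀ x, ‖m x‖ ≤ C) (u : LTwo) : ‖fourierMul m u‖ ≤ C * ‖u‖ := by
  rw [← Lp.norm_fourier_eq, fourier_fourierMul, ← Lp.norm_fourier_eq u]
  exact norm_mulLp_apply_le hm hC _

theorem fourier_injective {u v : LTwo} (h : (𝓕 u : LTwo) = 𝓕 v) : u = v := by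
  exact (Lp.fourierTransformₗᵢ Space ℂ).injective h

theorem coeFn_fourier_resolvent_equation (z : ℂ) (u : sobolevTwo) :
    (𝓕 (z • (u : LTwo) - negLaplacian u) : LTwo) =ᵐ[volume]
      fun ξ => (z - (4 * Real.pi ^ 2 * ‖ξ‖ ^ 2 : ℝ)) * (𝓕 (u : LTwo) : LTwo) ξ := by
  have h := fourier_negLaplacian u
  have e : (𝓕 (z • (u : LTwo) - negLaplacian u) : LTwo) =
      z • (𝓕 (u : LTwo) : LTwo) - 𝓕 (negLaplacian u) := by
    rw [← fourierCLM_apply (R := ℂ), map_sub, map_smul]; rfl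
  rw [e]
  filter_upwards [h, Lp.coeFn_sub (z • (𝓕 (u : LTwo) : LTwo)) (𝓕 (negLaplacian u)),
    Lp.coeFn_smul z (𝓕 (u : LTwo) : LTwo)] with ξ h1 h2 h3
  rw [h2, Pi.sub_apply, h1, h3, Pi.smul_apply, smul_eq_mul, sub_mul]

theorem ResolventBound.fourierMul_mem {C : ℝ} {z : ℂ} (h : ResolventBound C z) (g : LTwo) :
    fourierMul (resSymbol z) g ∈ sobolevTwo := by
  rw [mem_sobolevTwo_iff, fourier_fourierMul]
  have hb := memLp_top_of_continuous (m := fun ξ => ((1 + ‖ξ‖ ^ 2 : ℝ) : ℂ) * resSymbol z ξ) (C := C)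
    (Continuous.mul (by fun_prop) h.continuous_resSymbol) fun ξ => by
      rw [norm_mul, Complex.norm_real, Real.norm_of_nonneg (by positivity)]
      calc (1 + ‖ξ‖ ^ 2) * ‖resSymbol z ξ‖ ≤ (1 + ‖ξ‖ ^ 2) * (C * (1 + ‖ξ‖ ^ 2)⁻¹) := by
            gcongr
            exact (h.norm_resSymbol_le ξ).trans (mul_le_mul_of_nonneg_left (decay_le ξ) h.1.le)
        _ = C := by field_simp
  refine (memLp_congr_ae ?_).1 (Lp.memLp
    (mulLp (fun ξ => ((1 + ‖ξ‖ ^ 2 : ℝ) : ℂ) * resSymbol z ξ) (𝓕 g : LTwo)))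
  filter_upwards [coeFn_mulLp hb (𝓕 g : LTwo), coeFn_mulLp h.memLp_resSymbol (𝓕 g : LTwo)]
    with ξ h1 h2
  rw [h1, h2, mul_assoc]

/-- Off the half line `[0, ∞)` the resolvent is the Fourier multiplier `(z - 4π²|ξ|²)⁻¹`. -/
theorem ResolventBound.resolventAt_eq {C : ℝ} {z : ℂ} (h : ResolventBound C z) (g : LTwo) :
    resolventAt z g = fourierMul (resSymbol z) g := by
  have hex : ∃ u : sobolevTwo, z • (u : LTwo) - negLaplacian u = g := by
    refine ⟨⟨_, h.fourierMul_mem g⟩, fourier_injective (Lp.ext ?_)⟩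
    refine (coeFn_fourier_resolvent_equation z _).trans ?_
    simp only [fourier_fourierMul]
    filter_upwards [coeFn_mulLp h.memLp_resSymbol (𝓕 g : LTwo)] with ξ h1
    rw [h1, ← mul_assoc, resSymbol, mul_inv_cancel₀ (h.ne (by positivity)), one_mul]
  rw [resolventAt, dif_pos hex]
  -- Uniqueness: dividing the resolvent equation by its nonvanishing symbol determines the transform
  -- of any solution, in particular of the chosen one.
  refine fourier_injective (Lp.ext ?_)
  rw [fourier_fourierMul]
  have h2 := coeFn_fourier_resolvent_equation z hex.choose
  rw [hex.choose_spec] at h2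
  filter_upwards [h2, coeFn_mulLp h.memLp_resSymbol (𝓕 g : LTwo)] with ξ h3 h4
  rw [h4, h3, ← mul_assoc, resSymbol, inv_mul_cancel₀ (h.ne (by positivity)), one_mul]

theorem ResolventBound.inner_resolvent {C : ℝ} {z : ℂ} (h : ResolventBound C z) (u v : LTwo) :
    ⟪u, fourierMul (resSymbol z) v⟫_ℂ = ⟪fourierMul (resSymbol (starRingEnd ℂ z)) u, v⟫_ℂ := by
  rw [inner_fourierMul h.memLp_resSymbol]
  simp only [conj_resSymbol]

/-- The first resolvent identity. -/
theorem ResolventBound.resolvent_identity {C C' : ℝ} {z z' : ℂ} (h : ResolventBound C z)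
    (h' : ResolventBound C' z') (g : LTwo) :
    fourierMul (resSymbol z) g - fourierMul (resSymbol z') g =
      (z' - z) • fourierMul (resSymbol z) (fourierMul (resSymbol z') g) := by
  refine fourier_injective ?_
  rw [← fourierCLM_apply (R := ℂ), ← fourierCLM_apply (R := ℂ), map_sub, map_smul,
    fourierCLM_apply, fourierCLM_apply, fourierCLM_apply, fourier_fourierMul, fourier_fourierMul,
    fourier_fourierMul, fourier_fourierMul]
  refine Lp.ext ?_
  set v : LTwo := 𝓕 g
  filter_upwards [Lp.coeFn_sub (mulLp (resSymbol z) v) (mulLp (resSymbol z') v),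
    Lp.coeFn_smul (z' - z) (mulLp (resSymbol z) (mulLp (resSymbol z') v)),
    coeFn_mulLp h.memLp_resSymbol v, coeFn_mulLp h'.memLp_resSymbol v,
    coeFn_mulLp h.memLp_resSymbol (mulLp (resSymbol z') v)] with ξ h1 h2 h3 h4 h5
  rw [h1, h2, Pi.sub_apply, Pi.smul_apply, h3, h4, h5, h4, resSymbol, resSymbol, smul_eq_mul]
  have n1 := h.ne (s := 4 * Real.pi ^ 2 * ‖ξ‖ ^ 2) (by positivity)
  have n2 := h'.ne (s := 4 * Real.pi ^ 2 * ‖ξ‖ ^ 2) (by positivity)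
  field_simp
  ring

/-! ### The integral kernel of the resolvent -/

/-- The function representing `g ↦ ((z + Δ)⁻¹ g)(y)` in `L²(ℝ³)`. -/
def green (z : ℂ) (y : Space) : LTwo :=
  𝓕⁻ (toLTwo fun ξ => starRingEnd ℂ (planeWave y ξ * resSymbol z ξ))

theorem continuous_planeWave_right (k : Space) : Continuous (planeWave k) :=
  continuous_planeWave.comp (by fun_prop : Continuous fun x => (k, x))

theorem norm_greenSymbol (z : ℂ) (y ξ : Space) :
    ‖starRingEnd ℂ (planeWave y ξ * resSymbol z ξ)‖ = ‖resSymbol z ξ‖ := by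
  rw [RCLike.norm_conj, norm_mul, norm_planeWave, one_mul]

theorem ResolventBound.continuous_greenSymbol {C : ℝ} {z : ℂ} (h : ResolventBound C z) (y : Space) :
    Continuous fun ξ => starRingEnd ℂ (planeWave y ξ * resSymbol z ξ) :=
  Complex.continuous_conj.comp ((continuous_planeWave_right y).mul h.continuous_resSymbol)

theorem ResolventBound.memLp_greenSymbol {C : ℝ} {z : ℂ} (h : ResolventBound C z) (y : Space) :
    MemLp (fun ξ => starRingEnd ℂ (planeWave y ξ * resSymbol z ξ)) 2 (volume : Measure Space) :=
  h.memLp_two_resSymbol.mono (h.continuous_greenSymbol y).aestronglyMeasurable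
    (.of_forall fun ξ => (norm_greenSymbol z y ξ).le)

theorem ResolventBound.norm_green_le {C : ℝ} {z : ℂ} (h : ResolventBound C z) (y : Space) :
    ‖green z y‖ ≤ C * decayNorm := by
  have e : ‖green z y‖ = ‖toLTwo fun ξ => starRingEnd ℂ (planeWave y ξ * resSymbol z ξ)‖ := by
    rw [green, ← Lp.norm_fourier_eq, fourier_fourierInv_eq]
  rw [e]
  exact norm_toLTwo_le (h.continuous_greenSymbol y).aestronglyMeasurable
    fun ξ => (norm_greenSymbol z y ξ).le.trans (h.norm_resSymbol_le ξ)

theorem coeFn_fourier_green {C : ℝ} {z : ℂ} (h : ResolventBound C z) (y : Space) :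
    (𝓕 (green z y) : LTwo) =ᵐ[volume] fun ξ => starRingEnd ℂ (planeWave y ξ * resSymbol z ξ) := by
  rw [green, fourier_fourierInv_eq]
  exact coeFn_toLTwo (h.memLp_greenSymbol y)

/-- The symbol and the transform of g are both square integrable, so their product is integrable and
its inverse transform is an honest integral. Parseval's identity rewrites that integral as a pairing
with the kernel. -/
theorem ResolventBound.coeFn_resolvent {C : ℝ} {z : ℂ} (h : ResolventBound C z) (g : LTwo) :
    fourierMul (resSymbol z) g =ᵐ[volume] fun y => ⟪green z y, g⟫_ℂ := by
  set v : LTwo := mulLp (resSymbol z) (𝓕 g : LTwo) with hv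
  have hve := coeFn_mulLp h.memLp_resSymbol (𝓕 g : LTwo)
  have hvi : Integrable v :=
    (h.memLp_two_resSymbol.integrable_mul (Lp.memLp (𝓕 g : LTwo))).congr hve.symm
  rw [fourierMul_apply]
  filter_upwards [coeFn_fourierInv_of_integrable v hvi] with y hy
  rw [hy, fourierInv_eq_integral_planeWave, ← Lp.inner_fourier_eq, inner_eq_integral]
  refine integral_congr_ae ?_
  filter_upwards [hve, coeFn_fourier_green h y] with ξ h1 h2
  rw [h1, h2, Complex.conj_conj, mul_assoc]

theorem ResolventBound.continuousAt_green {C : ℝ} {z : ℂ} (h : ResolventBound C z) (y : Space) :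
    ContinuousAt (fun p : ℂ × Space => green p.1 p.2) (z, y) := by
  have h2 : ∀ᶠ p : ℂ × Space in 𝓝 (z, y), ResolventBound (2 * C) p.1 :=
    continuous_fst.continuousAt.eventually h.eventually
  refine (fourierInvCLM ℂ LTwo).continuous.continuousAt.comp' ?_
  refine tendsto_toLTwo (g := fun ξ => 2 * C * decay ξ) (memLp_decay.const_mul _) ?_ ?_ ?_ ?_ ?_
  · filter_upwards [h2] with p hp
    exact (hp.continuous_greenSymbol p.2).aestronglyMeasurable
  · exact (h.continuous_greenSymbol y).aestronglyMeasurable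
  · filter_upwards [h2] with p hp
    exact fun ξ => (norm_greenSymbol _ _ ξ).le.trans (hp.norm_resSymbol_le ξ)
  · exact fun ξ => (norm_greenSymbol _ _ ξ).le.trans (h.eventually.self_of_nhds.norm_resSymbol_le ξ)
  · intro ξ
    refine (Complex.continuous_conj.tendsto _).comp (Tendsto.mul ?_ ?_)
    · exact (continuous_planeWave.comp (by fun_prop : Continuous fun p : ℂ × Space => (p.2, ξ))).tendsto (z, y)
    · exact (h.continuousAt_resSymbol ξ).tendsto.comp (continuous_fst.tendsto (z, y))


/-! ### Traces as integrals over families of vectors -/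

/-- Distinct orthonormal vectors are at distance √2, so balls of radius 1/2 about them are disjoint
open sets in a separable space. Countability is needed because `HasTrace` allows any index type and
the sums are exchanged with integrals. -/
theorem countable_of_hilbertBasis {ι : Type} (e : HilbertBasis ι ℂ LTwo) : Countable ι := by
  have : Fact ((2 : ℝ≥0∞) ≠ ⊤) := ⟨by norm_num⟩
  have hd : Pairwise (Function.onFun Disjoint fun i => Metric.ball (e i) (1 / 2)) := by
    intro i j hij
    refine Metric.ball_disjoint_ball ?_
    have h1 : ‖e i - e j‖ ^ 2 = 2 := by
      rw [@norm_sub_sq ℂ, e.orthonormal.2 hij, e.orthonormal.1, e.orthonormal.1]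
      norm_num
    rw [dist_eq_norm]
    nlinarith [norm_nonneg (e i - e j)]
  exact hd.countable_of_isOpen_disjoint (fun _ => Metric.isOpen_ball)
    fun i => ⟨e i, Metric.mem_ball_self (by norm_num)⟩

theorem hasSum_norm_inner_sq {ι : Type} (e : HilbertBasis ι ℂ LTwo) (u : LTwo) :
    HasSum (fun i => ‖⟪e i, u⟫_ℂ‖ ^ 2) (‖u‖ ^ 2) := by
  have h := e.hasSum_inner_mul_inner u u
  have h1 : ⟪u, u⟫_ℂ = ((‖u‖ ^ 2 : ℝ) : ℂ) := by
    rw [inner_self_eq_norm_sq_to_K]; push_cast; rfl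
  rw [h1] at h
  have h2 : (fun i => ⟪u, e i⟫_ℂ * ⟪e i, u⟫_ℂ) = fun i => ((‖⟪e i, u⟫_ℂ‖ ^ 2 : ℝ) : ℂ) := by
    ext i
    rw [← inner_conj_symm, mul_comm, Complex.mul_conj, Complex.normSq_eq_norm_sq]
  rw [h2] at h
  exact_mod_cast h

theorem tsum_enorm_inner_sq {ι : Type} (e : HilbertBasis ι ℂ LTwo) (u : LTwo) :
    ∑' i, ‖⟪e i, u⟫_ℂ‖ₑ ^ 2 = ‖u‖ₑ ^ 2 := by
  have h := hasSum_norm_inner_sq e u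
  have h1 := ENNReal.ofReal_tsum_of_nonneg (fun i => by positivity) h.summable
  rw [h.tsum_eq] at h1
  simp_rw [ENNReal.ofReal_pow (norm_nonneg _), ofReal_norm] at h1
  exact h1.symm

theorem sum_norm_inner_mul_le {ι : Type} (e : HilbertBasis ι ℂ LTwo) (u v : LTwo) (s : Finset ι) :
    ∑ i ∈ s, ‖⟪e i, u⟫_ℂ‖ * ‖⟪v, e i⟫_ℂ‖ ≤ ‖u‖ * ‖v‖ := by
  have hu := sum_le_hasSum s (fun i _ => by positivity) (hasSum_norm_inner_sq e u)
  have hv := sum_le_hasSum s (fun i _ => by positivity) (hasSum_norm_inner_sq e v)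
  have h := Finset.sum_mul_sq_le_sq_mul_sq s (fun i => ‖⟪e i, u⟫_ℂ‖) (fun i => ‖⟪v, e i⟫_ℂ‖)
  have e1 : ∀ i, ‖⟪v, e i⟫_ℂ‖ = ‖⟪e i, v⟫_ℂ‖ := fun i => norm_inner_symm _ _
  refine le_of_sq_le_sq (h.trans ?_) (by positivity)
  rw [mul_pow]
  simp_rw [e1]
  gcongr

/-- This is the trace of a superposition of rank-one operators v ↦ κ ⟨B, v⟩ A. In any basis,
Cauchy-Schwarz and Parseval bound the sum of the diagonal terms by |κ| ‖A‖ ‖B‖ pointwise, so sum and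
integral may be exchanged. -/
theorem hasSum_integral_inner {ι : Type} (e : HilbertBasis ι ℂ LTwo) {α : Type*}
    [MeasurableSpace α] {μ : Measure α} {A B : α → LTwo} {κ : α → ℂ}
    (hA : AEStronglyMeasurable A μ) (hB : AEStronglyMeasurable B μ) (hκ : AEStronglyMeasurable κ μ)
    (hi : Integrable (fun s => ‖κ s‖ * (‖A s‖ * ‖B s‖)) μ) :
    HasSum (fun i => ∫ s, κ s * (⟪e i, A s⟫_ℂ * ⟪B s, e i⟫_ℂ) ∂μ)
      (∫ s, κ s * ⟪B s, A s⟫_ℂ ∂μ) := by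
  have := countable_of_hilbertBasis e
  have hm : ∀ i, AEStronglyMeasurable (fun s => κ s * (⟪e i, A s⟫_ℂ * ⟪B s, e i⟫_ℂ)) μ := fun i =>
    hκ.mul ((aestronglyMeasurable_const.inner hA).mul (hB.inner aestronglyMeasurable_const))
  have hn : ∀ i s, ‖κ s * (⟪e i, A s⟫_ℂ * ⟪B s, e i⟫_ℂ)‖ =
      ‖κ s‖ * (‖⟪e i, A s⟫_ℂ‖ * ‖⟪B s, e i⟫_ℂ‖) := fun i s => by rw [norm_mul, norm_mul]
  have hint : ∀ i, Integrable (fun s => κ s * (⟪e i, A s⟫_ℂ * ⟪B s, e i⟫_ℂ)) μ := fun i => by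
    refine hi.mono' (hm i) (.of_forall fun s => ?_)
    rw [hn]
    have := sum_norm_inner_mul_le e (A s) (B s) {i}
    rw [Finset.sum_singleton] at this
    gcongr
  have hs : Summable fun i => ∫ s, ‖κ s * (⟪e i, A s⟫_ℂ * ⟪B s, e i⟫_ℂ)‖ ∂μ := by
    refine summable_of_sum_le (c := ∫ s, ‖κ s‖ * (‖A s‖ * ‖B s‖) ∂μ)
      (fun i => integral_nonneg fun s => norm_nonneg _) fun t => ?_
    rw [← integral_finsetSum _ fun i _ => (hint i).norm]
    refine integral_mono (integrable_finsetSum _ fun i _ => (hint i).norm) hi fun s => ?_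
    simp only [hn, ← Finset.mul_sum]
    gcongr
    exact sum_norm_inner_mul_le e _ _ t
  have h := hasSum_integral_of_summable_integral_norm hint hs
  refine (?_ : ∫ s, κ s * ⟪B s, A s⟫_ℂ ∂μ = _) ▸ h
  refine integral_congr_ae (.of_forall fun s => ?_)
  simp only
  rw [tsum_mul_left]
  congr 1
  rw [← e.tsum_inner_mul_inner]
  exact tsum_congr fun i => mul_comm _ _

/-! ### Hilbert-Schmidt bounds -/

theorem enorm_sq_eq_lintegral (u : LTwo) : ‖u‖ₑ ^ 2 = ∫⁻ x, ‖u x‖ₑ ^ 2 := by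
  have h := eLpNorm_nnreal_pow_eq_lintegral (μ := (volume : Measure Space)) (f := u) (p := 2)
    (by norm_num)
  rw [Lp.enorm_def]
  simpa using h

theorem ResolventBound.continuous_green {C : ℝ} {z : ℂ} (h : ResolventBound C z) :
    Continuous (green z) :=
  continuous_iff_continuousAt.2 fun y =>
    (h.continuousAt_green y).comp (f := fun y => (z, y)) (by fun_prop)

/-- The operator `χ (z + Δ)⁻¹` is Hilbert-Schmidt for square integrable `χ`. -/
theorem ResolventBound.lintegral_mulLp_green_le {C : ℝ} {z : ℂ} (h : ResolventBound C z)
    {χ : Space → ℂ} (hχ : MemLp χ ∞ (volume : Measure Space)) :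
    ∫⁻ y, ‖mulLp χ (green (starRingEnd ℂ z) y)‖ₑ ^ 2 ≤
      ENNReal.ofReal (C * decayNorm) ^ 2 * ∫⁻ x, ‖χ x‖ₑ ^ 2 := by
  obtain ⟨w, e, -⟩ := exists_hilbertBasis ℂ LTwo
  have := countable_of_hilbertBasis e
  set χ' : Space → ℂ := fun x => starRingEnd ℂ (χ x) with hχ'
  have hχm : MemLp χ' ∞ (volume : Measure Space) := hχ.star
  have h1 : ∀ j y, ‖⟪e j, mulLp χ (green (starRingEnd ℂ z) y)⟫_ℂ‖ₑ =
      ‖⟪green (starRingEnd ℂ z) y, mulLp χ' (e j)⟫_ℂ‖ₑ := fun j y => by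
    rw [inner_mulLp hχ, ← inner_conj_symm, RCLike.enorm_conj]
  have h2 : ∀ j, ∫⁻ y, ‖⟪e j, mulLp χ (green (starRingEnd ℂ z) y)⟫_ℂ‖ₑ ^ 2 =
      ∑' k, ‖⟪e j, mulLp χ (fourierMul (resSymbol z) (e k))⟫_ℂ‖ₑ ^ 2 := fun j => by
    have h3 : ∫⁻ y, ‖⟪e j, mulLp χ (green (starRingEnd ℂ z) y)⟫_ℂ‖ₑ ^ 2 =
        ‖fourierMul (resSymbol (starRingEnd ℂ z)) (mulLp χ' (e j))‖ₑ ^ 2 := by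
      rw [enorm_sq_eq_lintegral]
      refine lintegral_congr_ae ?_
      filter_upwards [h.conj.coeFn_resolvent (mulLp χ' (e j))] with y hy
      rw [h1, hy]
    rw [h3, ← tsum_enorm_inner_sq e]
    refine tsum_congr fun k => ?_
    rw [h.conj.inner_resolvent, Complex.conj_conj, ← inner_conj_symm, RCLike.enorm_conj,
      inner_mulLp hχ]
  have hc := h.conj.continuous_green
  have hc' : Continuous fun y => mulLp χ (green (starRingEnd ℂ z) y) := (mulLp χ).continuous.comp hc
  -- An operator and its adjoint have the same Hilbert-Schmidt norm. Expanding in the basis twice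
  -- and exchanging the two sums moves the integration to the variable in which χ is evaluated;
  -- there the kernel norm is uniformly bounded and only ∫ |χ|² remains.
  calc ∫⁻ y, ‖mulLp χ (green (starRingEnd ℂ z) y)‖ₑ ^ 2
      = ∫⁻ y, ∑' j, ‖⟪e j, mulLp χ (green (starRingEnd ℂ z) y)⟫_ℂ‖ₑ ^ 2 := by
        simp_rw [tsum_enorm_inner_sq e]
    _ = ∑' j, ∑' k, ‖⟪e j, mulLp χ (fourierMul (resSymbol z) (e k))⟫_ℂ‖ₑ ^ 2 := by
        rw [lintegral_tsum]
        · exact tsum_congr h2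
        · exact fun j => (((continuous_const.inner hc').enorm.measurable).pow_const 2).aemeasurable
    _ = ∑' k, ‖mulLp χ (fourierMul (resSymbol z) (e k))‖ₑ ^ 2 := by
        rw [ENNReal.tsum_comm]
        exact tsum_congr fun k => tsum_enorm_inner_sq e _
    _ = ∑' k, ∫⁻ x, ‖χ x‖ₑ ^ 2 * ‖⟪e k, green z x⟫_ℂ‖ₑ ^ 2 := by
        refine tsum_congr fun k => ?_
        rw [enorm_sq_eq_lintegral]
        refine lintegral_congr_ae ?_
        filter_upwards [coeFn_mulLp hχ (fourierMul (resSymbol z) (e k)), h.coeFn_resolvent (e k)]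
          with x hx1 hx2
        rw [hx1, hx2, enorm_mul, mul_pow, ← inner_conj_symm, RCLike.enorm_conj]
    _ = ∫⁻ x, ‖χ x‖ₑ ^ 2 * ‖green z x‖ₑ ^ 2 := by
        rw [← lintegral_tsum]
        · refine lintegral_congr fun x => ?_
          rw [ENNReal.tsum_mul_left, tsum_enorm_inner_sq]
        · exact fun k => (hχ.1.enorm.pow_const 2).mul
            (((continuous_const.inner h.continuous_green).enorm.measurable).pow_const 2).aemeasurable
    _ ≤ ∫⁻ x, ‖χ x‖ₑ ^ 2 * ENNReal.ofReal (C * decayNorm) ^ 2 := by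
        refine lintegral_mono fun x => ?_
        gcongr
        rw [← ofReal_norm]
        exact ENNReal.ofReal_le_ofReal (h.norm_green_le x)
    _ = ENNReal.ofReal (C * decayNorm) ^ 2 * ∫⁻ x, ‖χ x‖ₑ ^ 2 := by
        rw [lintegral_mul_const'' _ (hχ.1.enorm.pow_const 2), mul_comm]

theorem enorm_toLTwo_norm_sq {G : Space → LTwo}
    (hf : MemLp G 2 (volume : Measure Space)) :
    ‖toLTwo fun y => (‖G y‖ : ℂ)‖ₑ ^ 2 = ∫⁻ y, ‖G y‖ₑ ^ 2 := by
  rw [enorm_sq_eq_lintegral]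
  refine lintegral_congr_ae ?_
  filter_upwards [coeFn_toLTwo hf.norm.ofReal] with y hy
  have hy' : (toLTwo fun y => (‖G y‖ : ℂ)) y = (‖G y‖ : ℂ) := hy
  rw [hy', ← ofReal_norm, Complex.norm_real, norm_norm, ofReal_norm]

/-- The factor containing χ is square integrable in y by the Hilbert-Schmidt bound and is paired
with φ by Cauchy-Schwarz; the other factor is uniformly bounded. Keeping the explicit dependence C²
makes the bound integrable along the contour. -/
theorem ResolventBound.integral_norm_mul_green_le {C : ℝ} {z : ℂ} (h : ResolventBound C z)
    {χ : Space → ℂ} (hχ : MemLp χ ∞ (volume : Measure Space))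
    (hχ2 : MemLp χ 2 (volume : Measure Space)) (φ : LTwo) :
    Integrable (fun y => ‖φ y‖ * (‖mulLp χ (green (starRingEnd ℂ z) y)‖ * ‖green z y‖)) ∧
    ∫ y, ‖φ y‖ * (‖mulLp χ (green (starRingEnd ℂ z) y)‖ * ‖green z y‖) ≤
      (C * decayNorm) ^ 2 * (‖φ‖ * ‖toLTwo χ‖) := by
  set G : Space → LTwo := fun y => mulLp χ (green (starRingEnd ℂ z) y)
  have hC : 0 ≤ C * decayNorm := mul_nonneg h.1.le decayNorm_nonneg
  have hGc : Continuous G := (mulLp χ).continuous.comp h.conj.continuous_green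
  have hle := h.lintegral_mulLp_green_le hχ
  have hχn : ∫⁻ x, ‖χ x‖ₑ ^ 2 = ‖toLTwo χ‖ₑ ^ 2 := by
    rw [enorm_sq_eq_lintegral]
    refine lintegral_congr_ae ?_
    filter_upwards [coeFn_toLTwo hχ2] with x hx
    rw [hx]
  rw [hχn, ← mul_pow, ← ofReal_norm (toLTwo χ), ← ENNReal.ofReal_mul hC] at hle
  have hG2 : MemLp G 2 (volume : Measure Space) := by
    refine ⟨hGc.aestronglyMeasurable, ?_⟩
    have e := eLpNorm_nnreal_pow_eq_lintegral (μ := (volume : Measure Space)) (f := G) (p := 2)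
      (by norm_num)
    have e2 : eLpNorm G 2 volume ^ 2 = ∫⁻ y, ‖G y‖ₑ ^ 2 := by simpa using e
    have : eLpNorm G 2 (volume : Measure Space) ^ 2 < ⊤ := by
      rw [e2]
      exact hle.trans_lt (by finiteness)
    exact (ENNReal.pow_lt_top_iff.1 this).resolve_right (by norm_num)
  have hgn : ‖toLTwo fun y => (‖G y‖ : ℂ)‖ ≤ C * decayNorm * ‖toLTwo χ‖ := by
    rw [← enorm_toLTwo_norm_sq hG2, ← ofReal_norm, ENNReal.pow_le_pow_left_iff (by norm_num),
      ENNReal.ofReal_le_ofReal_iff (by positivity)] at hle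
    exact hle
  have hφG : Integrable fun y => ‖φ y‖ * ‖G y‖ := (Lp.memLp φ).norm.integrable_mul hG2.norm
  have hφG_le : ∫ y, ‖φ y‖ * ‖G y‖ ≤ ‖φ‖ * (C * decayNorm * ‖toLTwo χ‖) := by
    have hφn : MemLp (fun y => (‖φ y‖ : ℂ)) 2 (volume : Measure Space) := (Lp.memLp φ).norm.ofReal
    have h1 : ⟪toLTwo fun y => (‖φ y‖ : ℂ), toLTwo fun y => (‖G y‖ : ℂ)⟫_ℂ =
        ((∫ y, ‖φ y‖ * ‖G y‖ : ℝ) : ℂ) := by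
      rw [inner_eq_integral, ← integral_complex_ofReal]
      refine integral_congr_ae ?_
      filter_upwards [coeFn_toLTwo hφn, coeFn_toLTwo hG2.norm.ofReal] with y h1 h2
      have h2' : (toLTwo fun y => (‖G y‖ : ℂ)) y = (‖G y‖ : ℂ) := h2
      rw [h1, h2', Complex.conj_ofReal, Complex.ofReal_mul]
    have h2 : ‖toLTwo fun y => (‖φ y‖ : ℂ)‖ ≤ 1 * ‖φ‖ := by
      refine Lp.norm_le_mul_norm_of_ae_le_mul ?_
      filter_upwards [coeFn_toLTwo hφn] with y hy
      rw [hy]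
      simp
    have h3 := norm_inner_le_norm (𝕜 := ℂ) (toLTwo fun y => (‖φ y‖ : ℂ))
      (toLTwo fun y => (‖G y‖ : ℂ))
    rw [h1, Complex.norm_real, Real.norm_of_nonneg (by positivity)] at h3
    rw [one_mul] at h2
    exact h3.trans (mul_le_mul h2 hgn (norm_nonneg _) (norm_nonneg _))
  have hb : ∀ y, ‖φ y‖ * (‖G y‖ * ‖green z y‖) ≤ C * decayNorm * (‖φ y‖ * ‖G y‖) := fun y => by
    have := h.norm_green_le y
    calc ‖φ y‖ * (‖G y‖ * ‖green z y‖) ≤ ‖φ y‖ * (‖G y‖ * (C * decayNorm)) := by gcongr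
      _ = _ := by ring
  have hint : Integrable (fun y => ‖φ y‖ * (‖G y‖ * ‖green z y‖)) := by
    refine (hφG.const_mul (C * decayNorm)).mono' ?_ (.of_forall fun y => ?_)
    · exact (Lp.aestronglyMeasurable φ).norm.mul
        (hGc.norm.mul h.continuous_green.norm).aestronglyMeasurable
    · rw [Real.norm_of_nonneg (by positivity)]
      exact hb y
  refine ⟨hint, ?_⟩
  calc ∫ y, ‖φ y‖ * (‖G y‖ * ‖green z y‖) ≤ ∫ y, C * decayNorm * (‖φ y‖ * ‖G y‖) :=
        integral_mono hint (hφG.const_mul _) hb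
    _ = C * decayNorm * ∫ y, ‖φ y‖ * ‖G y‖ := integral_const_mul _ _
    _ ≤ C * decayNorm * (‖φ‖ * (C * decayNorm * ‖toLTwo χ‖)) := by gcongr
    _ = _ := by ring


/-! ### The operators `(z + Δ)⁻¹ φ (z + Δ)⁻¹` -/

theorem mulOp_eq_mulLp {χ : Space → ℂ} (hχ : MemLp χ ∞ (volume : Measure Space)) (u : LTwo) :
    mulOp χ u = mulLp χ u := by
  have h := coeFn_mulLp hχ u
  have hm : MemLp (fun x => χ x * u x) 2 (volume : Measure Space) :=
    (memLp_congr_ae h).1 (Lp.memLp _)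
  rw [mulOp, dif_pos hm]
  exact Lp.ext (hm.coeFn_toLp.trans h.symm)

/-- The function `φ (z + Δ)⁻¹ g`. -/
def potRes (φ : LTwo) (z : ℂ) (g : LTwo) : LTwo := mulOp φ (fourierMul (resSymbol z) g)

/-- The resolvent maps L² into bounded functions, so its product with the possibly unbounded φ is
again square integrable. Hence the default value zero in `mulOp` is never taken here. -/
theorem ResolventBound.coeFn_potRes {C : ℝ} {z : ℂ} (h : ResolventBound C z) (φ g : LTwo) :
    potRes φ z g =ᵐ[volume] fun y => φ y * ⟪green z y, g⟫_ℂ := by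
  have hr := h.coeFn_resolvent g
  have hm : MemLp (fun y => φ y * fourierMul (resSymbol z) g y) 2 (volume : Measure Space) := by
    refine ((Lp.memLp φ).norm.const_mul (C * decayNorm * ‖g‖)).mono'
      ((Lp.aestronglyMeasurable φ).mul (Lp.aestronglyMeasurable _)) ?_
    filter_upwards [hr] with y hy
    rw [hy, norm_mul, mul_comm]
    gcongr
    refine (norm_inner_le_norm _ _).trans ?_
    gcongr
    exact h.norm_green_le y
  rw [potRes, mulOp, dif_pos hm]
  filter_upwards [hm.coeFn_toLp, hr] with y h1 h2
  rw [h1, h2]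

theorem ResolventBound.norm_potRes_le {C : ℝ} {z : ℂ} (h : ResolventBound C z) (φ g : LTwo) :
    ‖potRes φ z g‖ ≤ C * decayNorm * ‖g‖ * ‖φ‖ := by
  refine Lp.norm_le_mul_norm_of_ae_le_mul ?_
  filter_upwards [h.coeFn_potRes φ g] with y hy
  rw [hy, norm_mul, mul_comm]
  gcongr
  refine (norm_inner_le_norm _ _).trans ?_
  gcongr
  exact h.norm_green_le y

theorem ResolventBound.potRes_sub {C C' : ℝ} {z z' : ℂ} (h : ResolventBound C z)
    (h' : ResolventBound C' z') (φ g : LTwo) :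
    potRes φ z g - potRes φ z' g = (z' - z) • potRes φ z (fourierMul (resSymbol z') g) := by
  have hid := h.resolvent_identity h' g
  refine Lp.ext ?_
  set w := fourierMul (resSymbol z') g
  filter_upwards [Lp.coeFn_sub (potRes φ z g) (potRes φ z' g),
    Lp.coeFn_smul (z' - z) (potRes φ z w), h.coeFn_potRes φ g, h'.coeFn_potRes φ g,
    h.coeFn_potRes φ w, h.coeFn_resolvent g, h'.coeFn_resolvent g, h.coeFn_resolvent w,
    Lp.coeFn_sub (fourierMul (resSymbol z) g) w, Lp.coeFn_smul (z' - z) (fourierMul (resSymbol z) w),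
    (by rw [hid] : (fourierMul (resSymbol z) g - w : LTwo) =ᵐ[volume]
      ((z' - z) • fourierMul (resSymbol z) w : LTwo))]
    with y h1 h2 h3 h4 h5 h6 h7 h8 h9 h10 h11
  rw [h1, h2, Pi.sub_apply, Pi.smul_apply, h3, h4, h5, ← h6, ← h7, ← h8, smul_eq_mul]
  rw [h9, h10, Pi.sub_apply, Pi.smul_apply, smul_eq_mul] at h11
  rw [← mul_sub, h11]
  ring

/-- The operator `(z + Δ)⁻¹ φ (z + Δ)⁻¹`, applied to `g`. -/
def sandwich (φ g : LTwo) (z : ℂ) : LTwo := fourierMul (resSymbol z) (potRes φ z g)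

theorem ResolventBound.responseIntegrand_eq {C : ℝ} {z : ℂ} (h : ResolventBound C z) (β μ : ℝ)
    (φ g : LTwo) :
    responseIntegrand β μ φ g z = fermiDirac (β * (z - μ)) • sandwich φ g z := by
  rw [responseIntegrand, h.resolventAt_eq, h.resolventAt_eq]
  rfl

theorem ResolventBound.norm_resolvent_le {C : ℝ} {z : ℂ} (h : ResolventBound C z) (g : LTwo) :
    ‖fourierMul (resSymbol z) g‖ ≤ C * ‖g‖ :=
  norm_fourierMul_apply_le h.memLp_resSymbol h.norm_resSymbol_le' g

theorem ResolventBound.norm_sandwich_le {C : ℝ} {z : ℂ} (h : ResolventBound C z) (φ g : LTwo) :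
    ‖sandwich φ g z‖ ≤ C ^ 2 * (decayNorm * ‖g‖ * ‖φ‖) := by
  refine (h.norm_resolvent_le _).trans ?_
  calc C * ‖potRes φ z g‖ ≤ C * (C * decayNorm * ‖g‖ * ‖φ‖) :=
        mul_le_mul_of_nonneg_left (h.norm_potRes_le φ g) h.1.le
    _ = _ := by ring

theorem ResolventBound.continuousAt_sandwich {C : ℝ} {z : ℂ} (h : ResolventBound C z)
    (φ g : LTwo) : ContinuousAt (sandwich φ g) z := by
  rw [ContinuousAt, tendsto_iff_norm_sub_tendsto_zero]
  set w := fourierMul (resSymbol z) g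
  set K := 2 * C * ‖sandwich φ g z‖ + (2 * C) ^ 2 * (decayNorm * ‖w‖ * ‖φ‖)
  have hb : ∀ᶠ x in 𝓝 z, ‖sandwich φ g x - sandwich φ g z‖ ≤ ‖x - z‖ * K := by
    filter_upwards [h.eventually] with x hx
    -- The resolvent identity is used once for each of the two resolvents. The factor z - x comes
    -- out, and what remains is bounded for x near z.
    have e : sandwich φ g x - sandwich φ g z =
        (z - x) • (fourierMul (resSymbol x) (sandwich φ g z) + sandwich φ w x) := by
      have h1 := hx.resolvent_identity h (potRes φ z g)
      have h2 := hx.potRes_sub h φ g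
      have h3 := congrArg (fourierMul (resSymbol x)) h2
      rw [map_sub, map_smul] at h3
      rw [smul_add, sandwich, sandwich, sandwich, ← h1, ← h3]
      abel
    rw [e, norm_smul, norm_sub_rev]
    refine mul_le_mul_of_nonneg_left ((norm_add_le _ _).trans ?_) (norm_nonneg _)
    exact add_le_add (hx.norm_resolvent_le _) (hx.norm_sandwich_le φ w)
  refine squeeze_zero' (.of_forall fun x => norm_nonneg _) hb ?_
  have : Tendsto (fun x : ℂ => ‖x - z‖ * K) (𝓝 z) (𝓝 (‖z - z‖ * K)) :=
    Continuous.tendsto (by fun_prop) z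
  simpa using this

/-- Moving χ and the left resolvent onto the other vector lets the kernel represent both resolvents.
This exhibits the diagonal elements of a superposition of rank-one operators, as in
`hasSum_integral_inner`. -/
theorem ResolventBound.inner_mulLp_sandwich {C : ℝ} {z : ℂ} (h : ResolventBound C z)
    {χ : Space → ℂ} (hχ : MemLp χ ∞ (volume : Measure Space)) (φ e : LTwo) :
    ⟪e, mulLp χ (sandwich φ e z)⟫_ℂ =
      ∫ y, φ y * (⟪e, mulLp χ (green (starRingEnd ℂ z) y)⟫_ℂ * ⟪green z y, e⟫_ℂ) := by
  rw [inner_mulLp hχ, sandwich, h.inner_resolvent, inner_eq_integral]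
  refine integral_congr_ae ?_
  filter_upwards [h.conj.coeFn_resolvent (mulLp (fun x => starRingEnd ℂ (χ x)) e),
    h.coeFn_potRes φ e] with y h1 h2
  rw [h1, h2, inner_conj_symm, inner_mulLp hχ]
  ring

/-! ### The density of `(z + Δ)⁻¹ φ (z + Δ)⁻¹` in Fourier space -/

/-- The correlation function `∫ r(ξ) r(ξ + k) dξ` of the resolvent symbol. -/
def symbolCorr (z : ℂ) (k : Space) : ℂ := ∫ ξ, resSymbol z ξ * resSymbol z (ξ + k)

theorem ResolventBound.norm_symbolCorr_le {C : ℝ} {z : ℂ} (h : ResolventBound C z) (k : Space) :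
    ‖symbolCorr z k‖ ≤ C ^ 2 * ∫ ξ, decay ξ ^ 2 := by
  have hi : Integrable fun ξ => decay (ξ + k) ^ 2 := integrable_decay_sq.comp_add_right k
  have e : ∫ ξ, decay (ξ + k) ^ 2 = ∫ ξ, decay ξ ^ 2 :=
    integral_add_right_eq_self (fun ξ => decay ξ ^ 2) k
  calc ‖symbolCorr z k‖ ≤ ∫ ξ, C ^ 2 * (2⁻¹ * (decay ξ ^ 2 + decay (ξ + k) ^ 2)) := by
        refine norm_integral_le_of_norm_le (((integrable_decay_sq.add hi).const_mul _).const_mul _)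
          (.of_forall fun ξ => ?_)
        rw [norm_mul]
        calc ‖resSymbol z ξ‖ * ‖resSymbol z (ξ + k)‖
            ≤ (C * decay ξ) * (C * decay (ξ + k)) :=
              mul_le_mul (h.norm_resSymbol_le ξ) (h.norm_resSymbol_le _) (norm_nonneg _)
                (mul_nonneg h.1.le (decay_pos ξ).le)
          _ = C ^ 2 * (decay ξ * decay (ξ + k)) := by ring
          _ ≤ _ := by
              refine mul_le_mul_of_nonneg_left ?_ (sq_nonneg C)
              nlinarith [sq_nonneg (decay ξ - decay (ξ + k))]
    _ = C ^ 2 * ∫ ξ, decay ξ ^ 2 := by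
        rw [integral_const_mul, integral_const_mul, integral_add integrable_decay_sq hi, e]
        ring

/-- Symmetry of the Fourier transform moves it from ψ onto the product of the two kernels. At
frequency k this is a pairing with a modulated kernel, and Parseval turns the modulation into a
translation by k. The phases combine to a plane wave independent of ξ, leaving the correlation of
the symbols; the conjugate of z in the second kernel ensures that both symbols are taken at z. -/
theorem ResolventBound.inner_green_mulLp_green {C : ℝ} {z : ℂ} (h : ResolventBound C z)
    (ψ : 𝓢(Space, ℂ)) (y : Space) :
    ⟪green z y, mulLp (𝓕 ψ : 𝓢(Space, ℂ)) (green (starRingEnd ℂ z) y)⟫_ℂ =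
      ∫ k, planeWave (-y) k * (ψ k * symbolCorr z k) := by
  set G := green z y
  set G' := green (starRingEnd ℂ z) y
  have hχ : MemLp (𝓕 ψ : 𝓢(Space, ℂ)) ∞ (volume : Measure Space) := (𝓕 ψ).memLp ∞
  set p : Space → ℂ := fun x => starRingEnd ℂ (G x) * G' x with hp
  have hpi : Integrable p := (Lp.memLp G).star.integrable_mul (Lp.memLp G')
  have h1 : ⟪G, mulLp (𝓕 ψ : 𝓢(Space, ℂ)) G'⟫_ℂ = ∫ x, 𝓕 (ψ : Space → ℂ) x * p x := by
    rw [inner_eq_integral, ← SchwartzMap.fourier_coe]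
    refine integral_congr_ae ?_
    filter_upwards [coeFn_mulLp hχ G'] with x hx
    rw [hx, hp]
    ring
  rw [h1, integral_fourier_mul ψ.integrable hpi]
  refine integral_congr_ae (.of_forall fun k => ?_)
  have h2 : 𝓕 p k = ⟪G, mulLp (planeWave (-k)) G'⟫_ℂ := by
    rw [fourier_eq_integral_planeWave, inner_eq_integral]
    refine integral_congr_ae ?_
    filter_upwards [coeFn_mulLp (memLp_planeWave (-k)) G'] with x hx
    rw [hx, hp]
    ring
  have h3 : ⟪G, mulLp (planeWave (-k)) G'⟫_ℂ = planeWave (-y) k * symbolCorr z k := by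
    rw [← Lp.inner_fourier_eq, inner_eq_integral, symbolCorr, ← integral_const_mul]
    refine integral_congr_ae ?_
    have hq := (measurePreserving_sub_right (volume : Measure Space)
      (-k)).quasiMeasurePreserving.ae (coeFn_fourier_green h.conj y)
    filter_upwards [coeFn_fourier_green h y, coeFn_fourier_mulLp_fourierChar (-k) G', hq]
      with ξ h4 h5 h6
    rw [h4, h5, h6, Complex.conj_conj, map_mul, conj_resSymbol, Complex.conj_conj, sub_neg_eq_add]
    have h7 : planeWave y ξ * starRingEnd ℂ (planeWave y (ξ + k)) = planeWave (-y) k := by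
      simp only [planeWave, ← Circle.coe_inv_eq_conj, ← AddChar.map_neg_eq_inv, ← Circle.coe_mul,
        ← AddChar.map_add_eq_mul]
      congr 2
      rw [inner_add_left, inner_neg_right]
      ring
    rw [← h7]
    ring
  simp only
  rw [h2, h3]
  ring


/-! ### Traces of averages of `(z + Δ)⁻¹ φ (z + Δ)⁻¹` along a path -/

theorem continuous_sandwich_path {γ : ℝ → ℂ} (hγ : Continuous γ) {C : ℝ → ℝ}
    (hC : ∀ t, ResolventBound (C t) (γ t)) (φ g : LTwo) : Continuous fun t => sandwich φ g (γ t) :=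
  continuous_iff_continuousAt.2 fun t =>
    ((hC t).continuousAt_sandwich φ g).comp (f := γ) hγ.continuousAt

theorem integrable_smul_sandwich {γ : ℝ → ℂ} (hγ : Continuous γ) {c : ℝ → ℂ}
    (hc : AEStronglyMeasurable c) {C : ℝ → ℝ} (hC : ∀ t, ResolventBound (C t) (γ t))
    (hi : Integrable fun t => ‖c t‖ * C t ^ 2) (φ g : LTwo) :
    Integrable fun t => c t • sandwich φ g (γ t) := by
  refine (hi.mul_const (decayNorm * ‖g‖ * ‖φ‖)).mono'
    (hc.smul (continuous_sandwich_path hγ hC φ g).aestronglyMeasurable) (.of_forall fun t => ?_)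
  rw [norm_smul, mul_assoc]
  gcongr
  exact (hC t).norm_sandwich_le φ g

theorem continuous_green_path {γ : ℝ → ℂ} (hγ : Continuous γ) {C : ℝ → ℝ}
    (hC : ∀ t, ResolventBound (C t) (γ t)) : Continuous fun p : ℝ × Space => green (γ p.1) p.2 :=
  continuous_iff_continuousAt.2 fun p =>
    ((hC p.1).continuousAt_green p.2).comp (f := fun p : ℝ × Space => (γ p.1, p.2)) (by fun_prop)

/-- The spatial integral at fixed t costs a multiple of C(t)², so the weighted integrability of c is
exactly what Fubini's theorem on path times space needs. -/
theorem integrable_traceKernel {γ : ℝ → ℂ} (hγ : Continuous γ) {c : ℝ → ℂ}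
    (hc : AEStronglyMeasurable c) {C : ℝ → ℝ} (hC : ∀ t, ResolventBound (C t) (γ t))
    (hi : Integrable fun t => ‖c t‖ * C t ^ 2) {χ : Space → ℂ}
    (hχ : MemLp χ ∞ (volume : Measure Space)) (hχ2 : MemLp χ 2 (volume : Measure Space))
    (φ : LTwo) :
    Integrable (fun s : ℝ × Space => ‖c s.1 * φ s.2‖ *
      (‖mulLp χ (green (starRingEnd ℂ (γ s.1)) s.2)‖ * ‖green (γ s.1) s.2‖))
      (volume.prod volume) := by
  have hA : Continuous fun s : ℝ × Space => mulLp χ (green (starRingEnd ℂ (γ s.1)) s.2) :=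
    (mulLp χ).continuous.comp (continuous_green_path
      (γ := fun t => starRingEnd ℂ (γ t)) (Complex.continuous_conj.comp hγ) fun t => (hC t).conj)
  have hB := continuous_green_path hγ hC
  have hm : AEStronglyMeasurable (fun s : ℝ × Space => ‖c s.1 * φ s.2‖ *
      (‖mulLp χ (green (starRingEnd ℂ (γ s.1)) s.2)‖ * ‖green (γ s.1) s.2‖))
      (volume.prod volume) :=
    (hc.comp_fst.mul (Lp.aestronglyMeasurable φ).comp_snd).norm.mul
      (hA.norm.mul hB.norm).aestronglyMeasurable
  have e : ∀ t y, ‖c t * φ y‖ * (‖mulLp χ (green (starRingEnd ℂ (γ t)) y)‖ * ‖green (γ t) y‖) =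
      ‖c t‖ * (‖φ y‖ * (‖mulLp χ (green (starRingEnd ℂ (γ t)) y)‖ * ‖green (γ t) y‖)) :=
    fun t y => by rw [norm_mul, mul_assoc]
  rw [integrable_prod_iff hm]
  constructor
  · refine .of_forall fun t => ?_
    simp only [e]
    exact ((hC t).integral_norm_mul_green_le hχ hχ2 φ).1.const_mul _
  · refine ((hi.mul_const (decayNorm ^ 2 * (‖φ‖ * ‖toLTwo χ‖)))).mono'
      hm.norm.integral_prod_right' (.of_forall fun t => ?_)
    simp only [norm_mul, norm_norm]
    rw [Real.norm_of_nonneg (by positivity)]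
    simp only [mul_assoc]
    rw [integral_const_mul]
    refine mul_le_mul_of_nonneg_left ?_ (norm_nonneg _)
    refine ((hC t).integral_norm_mul_green_le hχ hχ2 φ).2.trans_eq ?_
    ring

/-- The rank-one superposition is taken over the path parameter and y together, so a single
application of `hasSum_integral_inner` gives the trace of the whole contour integral. -/
theorem hasSum_inner_mulLp_integral_sandwich {γ : ℝ → ℂ} (hγ : Continuous γ) {c : ℝ → ℂ}
    (hc : AEStronglyMeasurable c) {C : ℝ → ℝ} (hC : ∀ t, ResolventBound (C t) (γ t))
    (hi : Integrable fun t => ‖c t‖ * C t ^ 2) {χ : Space → ℂ}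
    (hχ : MemLp χ ∞ (volume : Measure Space)) (hχ2 : MemLp χ 2 (volume : Measure Space))
    (φ : LTwo) {ι : Type} (e : HilbertBasis ι ℂ LTwo) :
    HasSum (fun i => ⟪e i, mulLp χ (∫ t, c t • sandwich φ (e i) (γ t))⟫_ℂ)
      (∫ s : ℝ × Space, (c s.1 * φ s.2) *
        ⟪green (γ s.1) s.2, mulLp χ (green (starRingEnd ℂ (γ s.1)) s.2)⟫_ℂ) := by
  have hA : Continuous fun s : ℝ × Space => mulLp χ (green (starRingEnd ℂ (γ s.1)) s.2) :=
    (mulLp χ).continuous.comp (continuous_green_path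
      (γ := fun t => starRingEnd ℂ (γ t)) (Complex.continuous_conj.comp hγ) fun t => (hC t).conj)
  have hB := continuous_green_path hγ hC
  have hκ : AEStronglyMeasurable (fun s : ℝ × Space => c s.1 * φ s.2) (volume.prod volume) :=
    hc.comp_fst.mul (Lp.aestronglyMeasurable φ).comp_snd
  have hint := integrable_traceKernel hγ hc hC hi hχ hχ2 φ
  have h := hasSum_integral_inner e hA.aestronglyMeasurable hB.aestronglyMeasurable hκ hint
  refine (congrArg (fun F : ι → ℂ => HasSum F _) (funext fun i => ?_)).mpr h
  have hs := integrable_smul_sandwich hγ hc hC hi φ (e i)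
  rw [← ContinuousLinearMap.integral_comp_comm _ hs, ← integral_inner (((mulLp χ).integrable_comp hs))]
  rw [integral_prod]
  · refine integral_congr_ae (.of_forall fun t => ?_)
    simp only [map_smul, inner_smul_right]
    rw [(hC t).inner_mulLp_sandwich hχ, ← integral_const_mul]
    refine integral_congr_ae (.of_forall fun y => ?_)
    simp only
    ring
  · refine hint.mono' (hκ.mul ((aestronglyMeasurable_const.inner hA.aestronglyMeasurable).mul
      (hB.aestronglyMeasurable.inner aestronglyMeasurable_const))) (.of_forall fun s => ?_)
    rw [norm_mul, norm_mul ⟪_, _⟫_ℂ]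
    have := sum_norm_inner_mul_le e (mulLp χ (green (starRingEnd ℂ (γ s.1)) s.2)) (green (γ s.1) s.2) {i}
    rw [Finset.sum_singleton] at this
    gcongr

theorem aestronglyMeasurable_symbolCorr_path {γ : ℝ → ℂ} (hγ : Continuous γ) {C : ℝ → ℝ}
    (hC : ∀ t, ResolventBound (C t) (γ t)) :
    AEStronglyMeasurable (fun p : ℝ × Space => symbolCorr (γ p.1) p.2) (volume.prod volume) := by
  have hr : Continuous fun q : (ℝ × Space) × Space => resSymbol (γ q.1.1) q.2 *
      resSymbol (γ q.1.1) (q.2 + q.1.2) := by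
    unfold resSymbol
    refine Continuous.mul ?_ ?_
    · exact Continuous.inv₀ (by fun_prop) fun q => (hC _).ne (by positivity)
    · exact Continuous.inv₀ (by fun_prop) fun q => (hC _).ne (by positivity)
  exact (hr.stronglyMeasurable.integral_prod_right' (ν := (volume : Measure Space))).aestronglyMeasurable

theorem integral_inner_green_path {γ : ℝ → ℂ} (hγ : Continuous γ) {c : ℝ → ℂ}
    (hc : AEStronglyMeasurable c) {C : ℝ → ℝ} (hC : ∀ t, ResolventBound (C t) (γ t))
    (hi : Integrable fun t => ‖c t‖ * C t ^ 2) (ψ : 𝓢(Space, ℂ)) (y : Space) :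
    ∫ t, c t * ⟪green (γ t) y, mulLp (𝓕 ψ : 𝓢(Space, ℂ)) (green (starRingEnd ℂ (γ t)) y)⟫_ℂ =
      ∫ k, planeWave (-y) k * (ψ k * ∫ t, c t * symbolCorr (γ t) k) := by
  have h1 : ∀ t, c t * ⟪green (γ t) y, mulLp (𝓕 ψ : 𝓢(Space, ℂ)) (green (starRingEnd ℂ (γ t)) y)⟫_ℂ =
      ∫ k, c t * (planeWave (-y) k * (ψ k * symbolCorr (γ t) k)) := fun t => by
    rw [(hC t).inner_green_mulLp_green, integral_const_mul]
  simp_rw [h1]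
  rw [integral_integral_swap]
  · refine integral_congr_ae (.of_forall fun k => ?_)
    simp only
    rw [← integral_const_mul, ← integral_const_mul]
    refine integral_congr_ae (.of_forall fun t => ?_)
    simp only
    ring
  · set S := ∫ ξ, decay ξ ^ 2
    have hS : Integrable (fun p : ℝ × Space => (‖c p.1‖ * C p.1 ^ 2) * (S * ‖ψ p.2‖))
        (volume.prod volume) := hi.mul_prod (ψ.integrable.norm.const_mul S)
    refine hS.mono' ?_ (.of_forall fun p => ?_)
    · refine hc.comp_fst.mul ((Continuous.aestronglyMeasurable ?_).mul
        ((Continuous.aestronglyMeasurable ?_).mul (aestronglyMeasurable_symbolCorr_path hγ hC)))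
      · exact (continuous_planeWave_right (-y)).comp continuous_snd
      · exact ψ.continuous.comp continuous_snd
    · simp only [Function.uncurry, norm_mul, norm_planeWave, one_mul]
      have := (hC p.1).norm_symbolCorr_le p.2
      calc ‖c p.1‖ * (‖ψ p.2‖ * ‖symbolCorr (γ p.1) p.2‖)
          ≤ ‖c p.1‖ * (‖ψ p.2‖ * (C p.1 ^ 2 * S)) := by gcongr
        _ = _ := by ring

/-- The trace of `χ` times an average of `(z + Δ)⁻¹ φ (z + Δ)⁻¹` is given by a Fourier multiplier. -/
theorem hasSum_trace_path {γ : ℝ → ℂ} (hγ : Continuous γ) {c : ℝ → ℂ}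
    (hc : AEStronglyMeasurable c) {C : ℝ → ℝ} (hC : ∀ t, ResolventBound (C t) (γ t))
    (hi : Integrable fun t => ‖c t‖ * C t ^ 2) {m : Space → ℂ}
    (hm : MemLp m ∞ (volume : Measure Space)) (hcm : ∀ k, ∫ t, c t * symbolCorr (γ t) k = -m k)
    (ψ : 𝓢(Space, ℂ)) (φ : LTwo) {ι : Type} (e : HilbertBasis ι ℂ LTwo) :
    HasSum (fun i => ⟪e i, mulLp (𝓕 ψ : 𝓢(Space, ℂ)) (∫ t, c t • sandwich φ (e i) (γ t))⟫_ℂ)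
      (∫ x, 𝓕 ψ x * -(fourierMul m φ x)) := by
  have hχ : MemLp (𝓕 ψ : 𝓢(Space, ℂ)) ∞ (volume : Measure Space) := (𝓕 ψ).memLp ∞
  have hχ2 : MemLp (𝓕 ψ : 𝓢(Space, ℂ)) 2 (volume : Measure Space) := (𝓕 ψ).memLp 2
  have h := hasSum_inner_mulLp_integral_sandwich hγ hc hC hi hχ hχ2 φ e
  convert h using 1
  symm
  have hA : Continuous fun s : ℝ × Space =>
      mulLp (𝓕 ψ : 𝓢(Space, ℂ)) (green (starRingEnd ℂ (γ s.1)) s.2) :=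
    (mulLp _).continuous.comp (continuous_green_path
      (γ := fun t => starRingEnd ℂ (γ t)) (Complex.continuous_conj.comp hγ) fun t => (hC t).conj)
  have hB := continuous_green_path hγ hC
  have hint : Integrable (fun s : ℝ × Space => (c s.1 * φ s.2) *
      ⟪green (γ s.1) s.2, mulLp (𝓕 ψ : 𝓢(Space, ℂ)) (green (starRingEnd ℂ (γ s.1)) s.2)⟫_ℂ)
      (volume.prod volume) := by
    refine (integrable_traceKernel hγ hc hC hi hχ hχ2 φ).mono'
      ((hc.comp_fst.mul (Lp.aestronglyMeasurable φ).comp_snd).mul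
        (hB.aestronglyMeasurable.inner hA.aestronglyMeasurable)) (.of_forall fun s => ?_)
    rw [norm_mul, mul_comm ‖mulLp _ _‖]
    gcongr
    exact norm_inner_le_norm _ _
  -- After integration over t the kernel is the transform of m ψ up to sign. Two uses of the
  -- symmetry of the Fourier transform then carry m from ψ to φ; the pairing is bilinear, so m is
  -- neither conjugated nor reflected.
  set H : LTwo := mulLp m (ψ.toLp 2)
  have hHe : H =ᵐ[volume] fun k => m k * ψ k := by
    filter_upwards [coeFn_mulLp hm (ψ.toLp 2 : LTwo), ψ.coeFn_toLp 2 (volume : Measure Space)]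
      with k h1 h2
    rw [h1, h2]
  have hHi : Integrable H :=
    (ψ.integrable.mul_of_top_right hm).congr hHe.symm
  calc ∫ s : ℝ × Space, (c s.1 * φ s.2) *
        ⟪green (γ s.1) s.2, mulLp (𝓕 ψ : 𝓢(Space, ℂ)) (green (starRingEnd ℂ (γ s.1)) s.2)⟫_ℂ
      = ∫ y, ∫ t, (c t * φ y) *
        ⟪green (γ t) y, mulLp (𝓕 ψ : 𝓢(Space, ℂ)) (green (starRingEnd ℂ (γ t)) y)⟫_ℂ :=
        integral_prod_symm _ hint
    _ = ∫ y, φ y * -(𝓕 (H : Space → ℂ) y) := by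
        refine integral_congr_ae (.of_forall fun y => ?_)
        simp only
        have e1 : ∀ t, (c t * φ y) *
            ⟪green (γ t) y, mulLp (𝓕 ψ : 𝓢(Space, ℂ)) (green (starRingEnd ℂ (γ t)) y)⟫_ℂ =
            φ y * (c t *
            ⟪green (γ t) y, mulLp (𝓕 ψ : 𝓢(Space, ℂ)) (green (starRingEnd ℂ (γ t)) y)⟫_ℂ) :=
          fun t => by ring
        simp_rw [e1]
        rw [integral_const_mul, integral_inner_green_path hγ hc hC hi,
          fourier_eq_integral_planeWave, ← integral_neg]
        congr 1
        refine integral_congr_ae ?_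
        filter_upwards [hHe] with k hk
        rw [hk, hcm]
        ring
    _ = -∫ y, φ y * (𝓕 H : LTwo) y := by
        rw [← integral_neg]
        refine integral_congr_ae ?_
        filter_upwards [coeFn_fourier_of_integrable H hHi] with y hy
        rw [hy, mul_neg]
    _ = -∫ k, ψ k * (𝓕 (fourierMul m φ) : LTwo) k := by
        rw [integral_mul_fourier_comm, fourier_fourierMul]
        congr 1
        refine integral_congr_ae ?_
        filter_upwards [hHe, coeFn_mulLp hm (𝓕 φ : LTwo)] with k h1 h2
        rw [h1, h2]
        ring
    _ = ∫ x, 𝓕 ψ x * -(fourierMul m φ x) := by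
        rw [integral_mul_fourier, ← integral_neg]
        refine integral_congr_ae (.of_forall fun x => ?_)
        simp only
        ring


open Set

/-! ### The contour as a single path -/

/-- The contour of `ContourIntegrable`, parametrized by arc length. -/
def contourPath (a b t : ℝ) : ℂ :=
  ((-a + max (|t| - b) 0 : ℝ) : ℂ) - ((max (-b) (min t b) : ℝ) : ℂ) * Complex.I

/-- The velocity of `contourPath`. -/
def contourSpeed (b t : ℝ) : ℂ := if t < -b then -1 else if t ≤ b then -Complex.I else 1

theorem continuous_contourPath (a b : ℝ) : Continuous (contourPath a b) := by
  unfold contourPath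
  fun_prop

theorem measurable_contourSpeed (b : ℝ) : Measurable (contourSpeed b) :=
  Measurable.ite measurableSet_Iio measurable_const
    (Measurable.ite measurableSet_Iic measurable_const measurable_const)

theorem norm_contourSpeed (b t : ℝ) : ‖contourSpeed b t‖ = 1 := by
  unfold contourSpeed
  split_ifs <;> simp

theorem contourPath_of_lt {a b t : ℝ} (hb : 0 < b) (h : t < -b) :
    contourPath a b t = ((-a - b - t : ℝ) : ℂ) + b * Complex.I := by
  rw [contourPath, abs_of_neg (by linarith), max_eq_left (by linarith), min_eq_left (by linarith),
    max_eq_left (by linarith)]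
  push_cast
  ring

theorem contourPath_of_mem {a b t : ℝ} (h : t ∈ Ioc (-b) b) :
    contourPath a b t = -a + ((-t : ℝ) : ℂ) * Complex.I := by
  rw [contourPath, max_eq_right (sub_nonpos.2 (abs_le.2 ⟨h.1.le, h.2⟩)), min_eq_left h.2,
    max_eq_right h.1.le]
  push_cast
  ring

theorem contourPath_of_gt {a b t : ℝ} (hb : 0 < b) (h : b < t) :
    contourPath a b t = ((t - (a + b) : ℝ) : ℂ) - b * Complex.I := by
  rw [contourPath, abs_of_pos (by linarith), max_eq_left (by linarith), min_eq_right (by linarith),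
    max_eq_right (by linarith)]
  push_cast
  ring

section Path

variable {E : Type*} [NormedAddCommGroup E] {a b : ℝ} {F : ℂ → E}

theorem integrableOn_upper_iff (hb : 0 < b) :
    IntegrableOn (fun t : ℝ => F (t + b * Complex.I)) (Ioi (-a)) ↔
      IntegrableOn (fun t => F (contourPath a b t)) (Iio (-b)) := by
  have hmp := Measure.measurePreserving_sub_left (volume : Measure ℝ) (-a - b)
  have h := hmp.integrableOn_comp_preimage (f := fun t : ℝ => F (t + b * Complex.I)) (s := Ioi (-a))
    (Homeomorph.subLeft (-a - b)).measurableEmbedding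
  have e : (fun x : ℝ => -a - b - x) ⁻¹' Ioi (-a) = Iio (-b) := by
    ext x; simp only [mem_preimage, mem_Ioi, mem_Iio]; constructor <;> intro h <;> linarith
  rw [← h, e]
  refine integrableOn_congr_fun (fun t ht => ?_) measurableSet_Iio
  simp only [Function.comp_apply]
  rw [contourPath_of_lt hb ht]

theorem integral_upper [NormedSpace ℂ E] (hb : 0 < b) :
    ∫ t in Ioi (-a), F (t + b * Complex.I) = ∫ t in Iio (-b), F (contourPath a b t) := by
  have hmp := Measure.measurePreserving_sub_left (volume : Measure ℝ) (-a - b)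
  have h := hmp.setIntegral_preimage_emb (Homeomorph.subLeft (-a - b)).measurableEmbedding
    (fun t : ℝ => F (t + b * Complex.I)) (Ioi (-a))
  have e : (fun x : ℝ => -a - b - x) ⁻¹' Ioi (-a) = Iio (-b) := by
    ext x; simp only [mem_preimage, mem_Ioi, mem_Iio]; constructor <;> intro h <;> linarith
  rw [← h, e]
  refine setIntegral_congr_fun measurableSet_Iio fun t ht => ?_
  rw [contourPath_of_lt hb ht]

theorem integrableOn_lower_iff (hb : 0 < b) :
    IntegrableOn (fun t : ℝ => F (t - b * Complex.I)) (Ioi (-a)) ↔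
      IntegrableOn (fun t => F (contourPath a b t)) (Ioi b) := by
  have hmp := measurePreserving_sub_right (volume : Measure ℝ) (a + b)
  have h := hmp.integrableOn_comp_preimage (f := fun t : ℝ => F (t - b * Complex.I)) (s := Ioi (-a))
    (Homeomorph.subRight (a + b)).measurableEmbedding
  have e : (fun x : ℝ => x - (a + b)) ⁻¹' Ioi (-a) = Ioi b := by
    ext x; simp only [mem_preimage, mem_Ioi]; constructor <;> intro h <;> linarith
  rw [← h, e]
  refine integrableOn_congr_fun (fun t ht => ?_) measurableSet_Ioi
  simp only [Function.comp_apply]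
  rw [contourPath_of_gt hb ht]

theorem integral_lower [NormedSpace ℂ E] (hb : 0 < b) :
    ∫ t in Ioi (-a), F (t - b * Complex.I) = ∫ t in Ioi b, F (contourPath a b t) := by
  have hmp := measurePreserving_sub_right (volume : Measure ℝ) (a + b)
  have h := hmp.setIntegral_preimage_emb (Homeomorph.subRight (a + b)).measurableEmbedding
    (fun t : ℝ => F (t - b * Complex.I)) (Ioi (-a))
  have e : (fun x : ℝ => x - (a + b)) ⁻¹' Ioi (-a) = Ioi b := by
    ext x; simp only [mem_preimage, mem_Ioi]; constructor <;> intro h <;> linarith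
  rw [← h, e]
  refine setIntegral_congr_fun measurableSet_Ioi fun t ht => ?_
  rw [contourPath_of_gt hb ht]

theorem integral_left [NormedSpace ℂ E] (hb : 0 < b) :
    ∫ s in (-b)..b, F (-a + s * Complex.I) = ∫ t in Ioc (-b) b, F (contourPath a b t) := by
  have h := intervalIntegral.integral_comp_neg (a := -b) (b := b)
    (fun s : ℝ => F (-a + s * Complex.I))
  rw [neg_neg] at h
  rw [← h, intervalIntegral.integral_of_le (by linarith)]
  refine setIntegral_congr_fun measurableSet_Ioc fun t ht => ?_
  rw [contourPath_of_mem ht]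

theorem intervalIntegrable_left (hb : 0 < b)
    (h : IntegrableOn (fun t => F (contourPath a b t)) (Ioc (-b) b)) :
    IntervalIntegrable (fun s : ℝ => F (-a + s * Complex.I)) volume (-b) b := by
  have h1 : IntervalIntegrable (fun t => F (contourPath a b t)) volume (-b) b :=
    (intervalIntegrable_iff_integrableOn_Ioc_of_le (by linarith)).2 h
  have h2 : IntervalIntegrable (fun t : ℝ => F (-a + ((-t : ℝ) : ℂ) * Complex.I)) volume (-b) b := by
    refine h1.congr fun t ht => ?_
    rw [uIoc_of_le (by linarith)] at ht
    rw [contourPath_of_mem ht]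
  have h3 := h2.comp_sub_left 0
  simp only [zero_sub, neg_neg] at h3
  exact h3.symm

/-- The contour integral as an integral over a single path. -/
theorem integral_contour_eq [NormedSpace ℂ E] (hb : 0 < b) (h : Integrable fun t => F (contourPath a b t)) :
    -(∫ t in Ioi (-a), F (t + b * Complex.I)) - Complex.I • (∫ s in (-b)..b, F (-a + s * Complex.I))
      + ∫ t in Ioi (-a), F (t - b * Complex.I) = ∫ t, contourSpeed b t • F (contourPath a b t) := by
  have hi : Integrable fun t => contourSpeed b t • F (contourPath a b t) :=
    h.bdd_smul 1 (measurable_contourSpeed b).aestronglyMeasurable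
      (.of_forall fun t => (norm_contourSpeed b t).le)
  rw [integral_upper hb, integral_lower hb, integral_left hb,
    ← intervalIntegral.integral_Iic_add_Ioi hi.integrableOn hi.integrableOn (b := b)]
  have hu : Iic b = Iic (-b) ∪ Ioc (-b) b := (Iic_union_Ioc_eq_Iic (by linarith)).symm
  rw [hu, setIntegral_union (by
      rw [Set.disjoint_left]; intro x hx hx'; exact absurd hx'.1 (not_lt.2 hx)) measurableSet_Ioc
    hi.integrableOn hi.integrableOn, integral_Iic_eq_integral_Iio]
  have e1 : ∫ t in Iio (-b), contourSpeed b t • F (contourPath a b t) =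
      -∫ t in Iio (-b), F (contourPath a b t) := by
    rw [← integral_neg]
    refine setIntegral_congr_fun measurableSet_Iio fun t ht => ?_
    simp only [contourSpeed]
    rw [if_pos (show t < -b from ht), neg_one_smul]
  have e2 : ∫ t in Ioc (-b) b, contourSpeed b t • F (contourPath a b t) =
      -(Complex.I • ∫ t in Ioc (-b) b, F (contourPath a b t)) := by
    rw [← neg_smul, ← integral_smul]
    refine setIntegral_congr_fun measurableSet_Ioc fun t ht => ?_
    simp only [contourSpeed]
    rw [if_neg (not_lt.2 ht.1.le), if_pos ht.2]
  have e3 : ∫ t in Ioi b, contourSpeed b t • F (contourPath a b t) =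
      ∫ t in Ioi b, F (contourPath a b t) := by
    refine setIntegral_congr_fun measurableSet_Ioi fun t ht => ?_
    have ht' : b < t := ht
    simp only [contourSpeed]
    rw [if_neg (by linarith), if_neg (by linarith), one_smul]
  rw [e1, e2, e3]
  abel

end Path

theorem contourIntegrable_of_integrable {a b : ℝ} {F : ℂ → LTwo} (hb : 0 < b)
    (h : Integrable fun t => F (contourPath a b t)) : ContourIntegrable a b F :=
  ⟨(integrableOn_upper_iff hb).2 h.integrableOn, intervalIntegrable_left hb h.integrableOn,
    (integrableOn_lower_iff hb).2 h.integrableOn⟩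

theorem norm_contourPath_le {a b : ℝ} (ha : 0 < a) (hb : 0 < b) (t : ℝ) :
    ‖contourPath a b t‖ ≤ a + b + |t| := by
  have h1 : |(-a + max (|t| - b) 0)| ≤ a + |t| := by
    have := le_max_right (|t| - b) 0
    have : max (|t| - b) 0 ≤ |t| := max_le (by linarith) (abs_nonneg t)
    rw [abs_le]; constructor <;> linarith
  have h2 : |max (-b) (min t b)| ≤ b := by
    rw [abs_le]
    exact ⟨le_max_left _ _, max_le (by linarith) (min_le_right _ _)⟩
  refine (norm_sub_le _ _).trans ?_
  rw [norm_mul, Complex.norm_I, mul_one, Complex.norm_real, Complex.norm_real, Real.norm_eq_abs,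
    Real.norm_eq_abs]
  linarith

/-- On the vertical piece the real part stays at distance at least a from [0, ∞); on the two rays
the imaginary part has modulus b. -/
theorem le_norm_contourPath_sub {a b : ℝ} (ha : 0 < a) (hb : 0 < b) (t : ℝ) {s : ℝ} (hs : 0 ≤ s) :
    min a b ≤ ‖contourPath a b t - s‖ := by
  have hre : (contourPath a b t - s).re = -a + max (|t| - b) 0 - s := by
    simp [contourPath]
  have him : (contourPath a b t - s).im = -max (-b) (min t b) := by
    simp [contourPath]
  rcases le_total |t| b with h | h
  · refine (min_le_left a b).trans (le_trans ?_ (Complex.abs_re_le_norm _))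
    rw [hre, max_eq_right (by linarith), abs_of_neg (by linarith)]
    linarith
  · refine (min_le_right a b).trans (le_trans ?_ (Complex.abs_im_le_norm _))
    rw [him, abs_neg]
    rcases le_abs'.1 h with h | h
    · rw [min_eq_left (by linarith), max_eq_left h, abs_neg, abs_of_pos hb]
    · rw [min_eq_right h, max_eq_right (by linarith), abs_of_pos hb]

/-- The constant in the resolvent bounds along the contour. -/
def contourConst (a b : ℝ) : ℝ := 1 + (1 + a + b) / min a b

/-- Since s ≤ |z - s| + |z| and |z| grows at most linearly in t, the lower bound on |z - s| absorbs
the remaining terms. Linear growth of the constant is harmless against the exponential decay of the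
weight. -/
theorem resolventBound_contourPath {a b : ℝ} (ha : 0 < a) (hb : 0 < b) (t : ℝ) :
    ResolventBound (contourConst a b * (1 + |t|)) (contourPath a b t) := by
  have hδ : 0 < min a b := lt_min ha hb
  have hK : 0 < contourConst a b := by unfold contourConst; positivity
  refine ⟨by positivity, fun s hs => ?_⟩
  have h1 := le_norm_contourPath_sub ha hb t hs
  have h2 := norm_contourPath_le ha hb t
  set N := ‖contourPath a b t - s‖
  have h3 : s ≤ N + ‖contourPath a b t‖ := by
    have : (s : ℂ) = contourPath a b t - (contourPath a b t - s) := by ring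
    have h := norm_sub_le (contourPath a b t) (contourPath a b t - s)
    rw [← this, Complex.norm_real, Real.norm_of_nonneg hs] at h
    linarith
  have h4 : 1 ≤ N / min a b := (one_le_div hδ).2 h1
  have hN : 0 ≤ N := norm_nonneg _
  calc 1 + s ≤ N + (1 + a + b + |t|) * 1 := by linarith
    _ ≤ N + (1 + a + b + |t|) * (N / min a b) := by gcongr
    _ ≤ (N + (1 + a + b) * (N / min a b)) * (1 + |t|) := by
      have : 0 ≤ N / min a b := by positivity
      nlinarith [abs_nonneg t, mul_nonneg (abs_nonneg t) this, mul_nonneg (abs_nonneg t) hN,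
        mul_nonneg (mul_nonneg (abs_nonneg t) this) (add_pos ha hb).le]
    _ = contourConst a b * (1 + |t|) * N := by
      unfold contourConst
      field_simp

/-! ### Decay of the Fermi-Dirac function along the contour -/

/-- For |Im w| ≤ 3/4 the cosine is at least 1 - 9/32 > 1/2, so the real part of 1 + exp w is at
least 1 + exp(Re w)/2. This is the role of b ≤ (3/4)β⁻¹: no pole of the Fermi-Dirac function lies in
the strip. -/
theorem one_add_exp_bounds {w : ℂ} (hw : |w.im| ≤ 3 / 4) :
    1 ≤ ‖1 + Complex.exp w‖ ∧ Real.exp w.re / 2 ≤ ‖1 + Complex.exp w‖ := by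
  have hc : 1 / 2 ≤ Real.cos w.im := by
    refine le_trans ?_ Real.one_sub_sq_div_two_le_cos
    have : w.im ^ 2 ≤ (3 / 4) ^ 2 := sq_le_sq' (by linarith [abs_le.1 hw]) (abs_le.1 hw).2
    linarith
  have h1 : (1 + Complex.exp w).re = 1 + Real.exp w.re * Real.cos w.im := by
    simp [Complex.exp_re]
  have h2 := (le_abs_self _).trans (Complex.abs_re_le_norm (1 + Complex.exp w))
  rw [h1] at h2
  have h3 := mul_le_mul_of_nonneg_left hc (Real.exp_pos w.re).le
  have h4 := Real.exp_pos w.re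
  constructor <;> linarith

theorem norm_fermiDirac_le {w : ℂ} (hw : |w.im| ≤ 3 / 4) :
    ‖fermiDirac w‖ ≤ 2 * Real.exp (-w.re) := by
  obtain ⟨h1, h2⟩ := one_add_exp_bounds hw
  rw [fermiDirac, norm_div, norm_one, Real.exp_neg, div_le_iff₀ (by linarith)]
  have h4 := Real.exp_pos w.re
  calc (1 : ℝ) = 2 * (Real.exp w.re)⁻¹ * (Real.exp w.re / 2) := by field_simp
    _ ≤ _ := by gcongr

theorem continuous_fermiDirac_comp {X : Type*} [TopologicalSpace X] {w : X → ℂ} (hw : Continuous w)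
    (h : ∀ x, |(w x).im| ≤ 3 / 4) : Continuous fun x => fermiDirac (w x) := by
  unfold fermiDirac
  refine continuous_const.div (by fun_prop) fun x => ?_
  have := (one_add_exp_bounds (h x)).1
  exact norm_pos_iff.1 (by linarith)

theorem im_contourPath_le {β a b : ℝ} (hβ : 0 < β) (hb : 0 < b) (hbβ : b ≤ 3 / 4 * β⁻¹) (μ t : ℝ) :
    |(β * (contourPath a b t - μ) : ℂ).im| ≤ 3 / 4 := by
  have h2 : |max (-b) (min t b)| ≤ b := by
    rw [abs_le]
    exact ⟨le_max_left _ _, max_le (by linarith) (min_le_right _ _)⟩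
  have e : (β * (contourPath a b t - μ) : ℂ).im = β * -max (-b) (min t b) := by
    simp [contourPath]
  rw [e, abs_mul, abs_neg, abs_of_pos hβ]
  calc β * |max (-b) (min t b)| ≤ β * (3 / 4 * β⁻¹) := by gcongr; linarith
    _ = 3 / 4 := by field_simp

theorem re_contourPath_ge {β a b : ℝ} (hβ : 0 < β) (μ t : ℝ) :
    β * |t| - β * (a + b + μ) ≤ (β * (contourPath a b t - μ) : ℂ).re := by
  have e : (β * (contourPath a b t - μ) : ℂ).re = β * (-a + max (|t| - b) 0 - μ) := by
    simp [contourPath]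
  rw [e, ← mul_sub]
  have := le_max_left (|t| - b) 0
  exact mul_le_mul_of_nonneg_left (by linarith) hβ.le

theorem norm_fermiDirac_contourPath_le {β a b : ℝ} (hβ : 0 < β) (hb : 0 < b)
    (hbβ : b ≤ 3 / 4 * β⁻¹) (μ t : ℝ) :
    ‖fermiDirac (β * (contourPath a b t - μ))‖ ≤
      2 * Real.exp (β * (a + b + μ)) * Real.exp (-β * |t|) := by
  refine (norm_fermiDirac_le (im_contourPath_le hβ hb hbβ μ t)).trans ?_
  rw [mul_assoc, ← Real.exp_add]
  gcongr
  linarith [re_contourPath_ge (a := a) (b := b) hβ μ t]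

theorem integrable_exp_neg_mul_abs {β : ℝ} (hβ : 0 < β) :
    Integrable fun t : ℝ => Real.exp (-β * |t|) * (1 + |t|) ^ 2 := by
  refine (integrable_inv_one_add_sq.const_mul (24 * Real.exp β / β ^ 4)).mono'
    (by fun_prop : Continuous fun t : ℝ => _).aestronglyMeasurable (.of_forall fun t => ?_)
  rw [Real.norm_of_nonneg (by positivity), ← div_eq_mul_inv, le_div_iff₀ (by positivity)]
  -- The fourth-order term of the exponential series, with 4! = 24, yields four powers of 1 + |t|:
  -- two cancel the weight and two produce the integrable function 1/(1 + t²).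
  have h1 := Real.pow_div_factorial_le_exp (β * (1 + |t|)) (by positivity) 4
  have h2 : Real.exp (β * (1 + |t|)) = Real.exp β * Real.exp (β * |t|) := by
    rw [← Real.exp_add]; ring_nf
  have h3 : 1 + t ^ 2 ≤ (1 + |t|) ^ 2 := by nlinarith [abs_nonneg t, sq_abs t]
  calc Real.exp (-β * |t|) * (1 + |t|) ^ 2 * (1 + t ^ 2)
      ≤ Real.exp (-β * |t|) * (1 + |t|) ^ 2 * (1 + |t|) ^ 2 := by gcongr
    _ = 24 / β ^ 4 * Real.exp (-β * |t|) * ((β * (1 + |t|)) ^ 4 / (Nat.factorial 4 : ℕ)) := by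
      simp only [Nat.factorial]
      push_cast
      field_simp
    _ ≤ 24 / β ^ 4 * Real.exp (-β * |t|) * (Real.exp β * Real.exp (β * |t|)) := by
      rw [← h2]; gcongr
    _ = 24 * Real.exp β / β ^ 4 * (Real.exp (-β * |t|) * Real.exp (β * |t|)) := by ring
    _ = 24 * Real.exp β / β ^ 4 := by
      rw [← Real.exp_add]; simp

/-- The weight `(2πi)⁻¹ f_FD(β(z - μ)) dz` along the contour. -/
def contourWeight (a b β μ t : ℝ) : ℂ :=
  (1 / (2 * Real.pi * Complex.I) : ℂ) * (contourSpeed b t * fermiDirac (β * (contourPath a b t - μ)))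

theorem measurable_contourWeight {β a b : ℝ} (hβ : 0 < β) (hb : 0 < b)
    (hbβ : b ≤ 3 / 4 * β⁻¹) (μ : ℝ) : Measurable (contourWeight a b β μ) := by
  refine measurable_const.mul ((measurable_contourSpeed b).mul (Continuous.measurable ?_))
  refine continuous_fermiDirac_comp ?_ (im_contourPath_le hβ hb hbβ μ)
  have := continuous_contourPath a b
  fun_prop

theorem integrable_contourWeight {β a b : ℝ} (hβ : 0 < β) (hb : 0 < b)
    (hbβ : b ≤ 3 / 4 * β⁻¹) (μ K : ℝ) :
    Integrable fun t => ‖contourWeight a b β μ t‖ * (K * (1 + |t|)) ^ 2 := by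
  refine ((integrable_exp_neg_mul_abs hβ).const_mul
    (‖(1 / (2 * Real.pi * Complex.I) : ℂ)‖ * (2 * Real.exp (β * (a + b + μ))) * K ^ 2)).mono' ?_
    (.of_forall fun t => ?_)
  · exact (measurable_contourWeight hβ hb hbβ μ).norm.aestronglyMeasurable.mul
      (by fun_prop : Continuous fun t : ℝ => (K * (1 + |t|)) ^ 2).aestronglyMeasurable
  · rw [Real.norm_of_nonneg (by positivity), contourWeight, norm_mul, norm_mul, norm_contourSpeed,
      one_mul]
    have := norm_fermiDirac_contourPath_le (a := a) hβ hb hbβ μ t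
    calc _ ≤ ‖(1 / (2 * Real.pi * Complex.I) : ℂ)‖ *
          (2 * Real.exp (β * (a + b + μ)) * Real.exp (-β * |t|)) * (K * (1 + |t|)) ^ 2 := by gcongr
      _ = _ := by ring


/-! ### Cauchy's formula for the derivative along the contour -/

/-- The integral over the boundary of the rectangle `[-a, R] × [-b, b]`. -/
def rectIntegral (a b R : ℝ) (F : ℂ → ℂ) : ℂ :=
  (∫ x in (-a)..R, F (x - b * Complex.I)) - (∫ x in (-a)..R, F (x + b * Complex.I))
    + Complex.I * (∫ y in (-b)..b, F (R + y * Complex.I))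
    - Complex.I * (∫ y in (-b)..b, F (-a + y * Complex.I))

theorem log_neg_of_im_pos {w : ℂ} (hw : 0 < w.im) :
    Complex.log (-w) = Complex.log w - Real.pi * Complex.I := by
  rw [Complex.log, Complex.log, norm_neg, Complex.arg_neg_eq_arg_sub_pi_of_im_pos hw]
  push_cast
  ring

theorem log_neg_of_im_neg {w : ℂ} (hw : w.im < 0) :
    Complex.log (-w) = Complex.log w + Real.pi * Complex.I := by
  rw [Complex.log, Complex.log, norm_neg, Complex.arg_neg_eq_arg_add_pi_of_im_neg hw]
  push_cast
  ring

theorem integral_horizontal {P p : ℂ → ℂ} {c x₀ x₁ : ℝ}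
    (h : ∀ x : ℝ, HasDerivAt P (p (x + c * Complex.I)) (x + c * Complex.I))
    (hp : Continuous fun x : ℝ => p (x + c * Complex.I)) :
    ∫ x in x₀..x₁, p (x + c * Complex.I) =
      P (x₁ + c * Complex.I) - P (x₀ + c * Complex.I) := by
  refine intervalIntegral.integral_eq_sub_of_hasDerivAt
    (f := fun x : ℝ => P (x + c * Complex.I)) (fun x _ => ?_) (hp.intervalIntegrable _ _)
  exact ((h x).comp_add_const (x : ℂ) (c * Complex.I)).comp_ofReal

theorem integral_vertical {P p : ℂ → ℂ} {c y₀ y₁ : ℝ}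
    (h : ∀ y : ℝ, HasDerivAt P (p (c + y * Complex.I)) (c + y * Complex.I))
    (hp : Continuous fun y : ℝ => p (c + y * Complex.I)) :
    Complex.I * ∫ y in y₀..y₁, p (c + y * Complex.I) =
      P (c + y₁ * Complex.I) - P (c + y₀ * Complex.I) := by
  rw [← intervalIntegral.integral_const_mul]
  refine intervalIntegral.integral_eq_sub_of_hasDerivAt
    (f := fun y : ℝ => P (c + y * Complex.I)) (fun y _ => ?_)
    ((continuous_const.mul hp).intervalIntegrable _ _)
  have h0 : HasDerivAt (fun y : ℂ => (c : ℂ) + y * Complex.I) (1 * Complex.I) (y : ℂ) :=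
    ((hasDerivAt_id (y : ℂ)).mul_const Complex.I).const_add _
  have h1 := (h y).comp (y : ℂ) h0
  rw [one_mul, mul_comm] at h1
  exact HasDerivAt.comp_ofReal h1

theorem hasDerivAt_log_sub_inv {A B l z : ℂ} (hz : z - l ∈ Complex.slitPlane) :
    HasDerivAt (fun z => A * Complex.log (z - l) - B * (z - l)⁻¹)
      (A * (z - l)⁻¹ + B * (z - l)⁻¹ ^ 2) z := by
  have h0 : z - l ≠ 0 := Complex.slitPlane_ne_zero hz
  have h1 := (((hasDerivAt_id z).sub_const l).clog hz).const_mul A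
  have h2 := (((hasDerivAt_id z).sub_const l).inv h0).const_mul B
  convert! h1.sub h2 using 1
  simp only [id]
  field_simp
  ring

/-- The left side of the rectangle crosses the cut of log(z - l); there log(l - z) is an analytic
primitive of the same function. -/
theorem hasDerivAt_log_sub_inv' {A B l z : ℂ} (hz : l - z ∈ Complex.slitPlane) :
    HasDerivAt (fun z => A * Complex.log (l - z) - B * (z - l)⁻¹)
      (A * (z - l)⁻¹ + B * (z - l)⁻¹ ^ 2) z := by
  have h0 : l - z ≠ 0 := Complex.slitPlane_ne_zero hz
  have h0' : z - l ≠ 0 := by rwa [← neg_sub, neg_ne_zero]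
  have h1 := (((hasDerivAt_id z).const_sub l).clog hz).const_mul A
  have h2 := (((hasDerivAt_id z).sub_const l).inv h0').const_mul B
  convert! h1.sub h2 using 1
  simp only [id]
  rw [← neg_sub z l]
  field_simp
  ring

/-- On three sides the primitive uses log(z - l), on the left side log(l - z). The two branches
differ by πi at the upper left corner and by -πi at the lower one, and these jumps add up to 2πi A.
The double pole has a single-valued primitive and contributes nothing. -/
theorem rectIntegral_principal_part {a b R l : ℝ} (hb : 0 < b) (hl : -a < l) (hR : l < R) (A B : ℂ) :
    rectIntegral a b R (fun z => A * (z - l)⁻¹ + B * (z - l)⁻¹ ^ 2) =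
      2 * Real.pi * Complex.I * A := by
  set p : ℂ → ℂ := fun z => A * (z - l)⁻¹ + B * (z - l)⁻¹ ^ 2 with hp
  have hc : ∀ {X : Type} [TopologicalSpace X] {w : X → ℂ}, Continuous w → (∀ x, w x - l ≠ 0) →
      Continuous fun x => p (w x) := by
    intro X _ w hw hne
    have : Continuous fun x => (w x - l)⁻¹ := (hw.sub continuous_const).inv₀ hne
    simp only [hp]
    fun_prop
  have hhor : ∀ c : ℝ, c ≠ 0 → ∫ x in (-a)..R, p (x + c * Complex.I) =
      (A * Complex.log (R + c * Complex.I - l) - B * (R + c * Complex.I - l)⁻¹) -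
      (A * Complex.log ((-a : ℝ) + c * Complex.I - l) - B * ((-a : ℝ) + c * Complex.I - l)⁻¹) := by
    intro c hcne
    have hs : ∀ x : ℝ, (x + c * Complex.I - l : ℂ) ∈ Complex.slitPlane := fun x => by
      right; simpa using hcne
    exact integral_horizontal (P := fun z => A * Complex.log (z - l) - B * (z - l)⁻¹)
      (fun x => hasDerivAt_log_sub_inv (hs x))
      (hc (by fun_prop) fun x => Complex.slitPlane_ne_zero (hs x))
  have hright : Complex.I * ∫ y in (-b)..b, p (R + y * Complex.I) =
      (A * Complex.log (R + b * Complex.I - l) - B * (R + b * Complex.I - l)⁻¹) -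
      (A * Complex.log (R + (-b : ℝ) * Complex.I - l) - B * (R + (-b : ℝ) * Complex.I - l)⁻¹) := by
    have hs : ∀ y : ℝ, (R + y * Complex.I - l : ℂ) ∈ Complex.slitPlane := fun y => by
      left; simpa using hR
    exact integral_vertical (P := fun z => A * Complex.log (z - l) - B * (z - l)⁻¹)
      (fun x => hasDerivAt_log_sub_inv (hs x))
      (hc (by fun_prop) fun x => Complex.slitPlane_ne_zero (hs x))
  have hleft : Complex.I * ∫ y in (-b)..b, p ((-a : ℝ) + y * Complex.I) =
      (A * Complex.log (l - ((-a : ℝ) + b * Complex.I)) - B * ((-a : ℝ) + b * Complex.I - l)⁻¹) -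
      (A * Complex.log (l - ((-a : ℝ) + (-b : ℝ) * Complex.I)) -
        B * ((-a : ℝ) + (-b : ℝ) * Complex.I - l)⁻¹) := by
    have hs : ∀ y : ℝ, (l - ((-a : ℝ) + y * Complex.I) : ℂ) ∈ Complex.slitPlane := fun y => by
      left; simp; linarith
    refine integral_vertical (P := fun z => A * Complex.log (l - z) - B * (z - l)⁻¹)
      (fun x => hasDerivAt_log_sub_inv' (hs x)) (hc (by fun_prop) fun x => ?_)
    rw [← neg_sub, neg_ne_zero]
    exact Complex.slitPlane_ne_zero (hs x)
  have hlow := hhor (-b) (by linarith)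
  have hupp := hhor b hb.ne'
  have e1 : Complex.log ((-a : ℝ) + b * Complex.I - l) =
      Complex.log (l - ((-a : ℝ) + b * Complex.I)) + Real.pi * Complex.I := by
    rw [← log_neg_of_im_neg (by simpa using hb), neg_sub]
  have e2 : Complex.log ((-a : ℝ) + (-b : ℝ) * Complex.I - l) =
      Complex.log (l - ((-a : ℝ) + (-b : ℝ) * Complex.I)) - Real.pi * Complex.I := by
    rw [← log_neg_of_im_pos (by simpa using hb), neg_sub]
  have hn : ∀ x : ℝ, (x : ℂ) - b * Complex.I = x + (-b : ℝ) * Complex.I := fun x => by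
    push_cast; ring
  have hn' : (-a : ℂ) = ((-a : ℝ) : ℂ) := by push_cast; rfl
  simp only [rectIntegral, hn]
  rw [hn', hlow, hupp, hright, hleft, e1, e2]
  ring

theorem rectIntegral_eq_zero {a b R : ℝ} (hb : 0 < b) {U : Set ℂ}
    (hU : ∀ z : ℂ, |z.im| ≤ b → z ∈ U) {h : ℂ → ℂ} (hd : DifferentiableOn ℂ h U) :
    rectIntegral a b R h = 0 := by
  have key := Complex.integral_boundary_rect_eq_zero_of_differentiableOn h (-a - b * Complex.I)
    (R + b * Complex.I) (hd.mono fun z hz => hU z ?_)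
  · simp at key
    rw [rectIntegral]
    simpa [sub_eq_add_neg] using key
  · have h2 := hz.2
    simp at h2
    rw [uIcc_of_le (by linarith)] at h2
    exact abs_le.2 h2

theorem rectIntegral_add {a b R : ℝ} {F G : ℂ → ℂ}
    (h1 : Continuous fun x : ℝ => F (x - b * Complex.I)) (h1' : Continuous fun x : ℝ => G (x - b * Complex.I))
    (h2 : Continuous fun x : ℝ => F (x + b * Complex.I)) (h2' : Continuous fun x : ℝ => G (x + b * Complex.I))
    (h3 : ContinuousOn (fun y : ℝ => F (R + y * Complex.I)) (uIcc (-b) b)) (h3' : Continuous fun y : ℝ => G (R + y * Complex.I))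
    (h4 : ContinuousOn (fun y : ℝ => F (-a + y * Complex.I)) (uIcc (-b) b)) (h4' : Continuous fun y : ℝ => G (-a + y * Complex.I)) :
    rectIntegral a b R (fun z => F z + G z) = rectIntegral a b R F + rectIntegral a b R G := by
  simp only [rectIntegral]
  rw [intervalIntegral.integral_add (h1.intervalIntegrable _ _) (h1'.intervalIntegrable _ _),
    intervalIntegral.integral_add (h2.intervalIntegrable _ _) (h2'.intervalIntegrable _ _),
    intervalIntegral.integral_add h3.intervalIntegrable (h3'.intervalIntegrable _ _),
    intervalIntegral.integral_add h4.intervalIntegrable (h4'.intervalIntegrable _ _)]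
  ring

theorem norm_fermiDirac_le_one {w : ℂ} (hw : |w.im| ≤ 3 / 4) : ‖fermiDirac w‖ ≤ 1 := by
  have h1 := (one_add_exp_bounds hw).1
  rw [fermiDirac, norm_div, norm_one]
  exact div_le_one_of_le₀ h1 (by linarith)

/-- Minus the derivative of the Fermi-Dirac function `s ↦ f_FD(β(s - μ))`. -/
def fdSlope (β μ s : ℝ) : ℝ := β * (Real.exp (β * (s - μ)) / (1 + Real.exp (β * (s - μ))) ^ 2)

theorem hasDerivAt_fermiDirac (β μ s : ℝ) :
    HasDerivAt (fun z : ℂ => fermiDirac (β * (z - μ))) (-(fdSlope β μ s) : ℂ) (s : ℂ) := by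
  have h1 : HasDerivAt (fun z : ℂ => 1 + Complex.exp (β * (z - μ)))
      (Complex.exp (β * (s - μ)) * (β * 1)) (s : ℂ) :=
    ((((hasDerivAt_id (s : ℂ)).sub_const (μ : ℂ)).const_mul (β : ℂ)).cexp).const_add 1
  have e : Complex.exp (β * (s - μ)) = (Real.exp (β * (s - μ)) : ℂ) := by push_cast; rfl
  have hne : 1 + Complex.exp (β * (s - μ)) ≠ 0 := by
    rw [e]
    have := Real.exp_pos (β * (s - μ))
    exact_mod_cast (by positivity : 1 + Real.exp (β * (s - μ)) ≠ 0)
  have h2 := (hasDerivAt_const (s : ℂ) (1 : ℂ)).div h1 hne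
  convert! h2 using 1
  rw [fdSlope]
  push_cast
  ring

theorem tendsto_rectIntegral {a b : ℝ} {F : ℂ → ℂ}
    (hF1 : IntegrableOn (fun t : ℝ => F (t + b * Complex.I)) (Ioi (-a)))
    (hF2 : IntegrableOn (fun t : ℝ => F (t - b * Complex.I)) (Ioi (-a)))
    (hr : Tendsto (fun R : ℝ => ∫ y in (-b)..b, F (R + y * Complex.I)) atTop (𝓝 0)) :
    Tendsto (fun R => rectIntegral a b R F) atTop
      (𝓝 (-(∫ t in Ioi (-a), F (t + b * Complex.I))
        - Complex.I • (∫ s in (-b)..b, F (-a + s * Complex.I))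
        + ∫ t in Ioi (-a), F (t - b * Complex.I))) := by
  have h1 := intervalIntegral_tendsto_integral_Ioi (-a) hF1 tendsto_id
  have h2 := intervalIntegral_tendsto_integral_Ioi (-a) hF2 tendsto_id
  have h3 := (((h2.sub h1).add (hr.const_mul Complex.I)).sub_const
    (Complex.I * ∫ y in (-b)..b, F (-a + y * Complex.I)))
  convert! h3 using 2
  rw [smul_eq_mul]
  ring

/-- Cauchy's formula: `(2πi)⁻¹ ∫_Γ f_FD(β(z - μ)) (z - l)⁻² dz` is the derivative of the Fermi-Dirac
function at `l ≥ 0`. -/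
theorem integral_contourWeight_mul_inv_sq {β a b : ℝ} (hβ : 0 < β) (ha : 0 < a) (hb : 0 < b)
    (hbβ : b ≤ 3 / 4 * β⁻¹) (μ : ℝ) {l : ℝ} (hl : 0 ≤ l) :
    ∫ t, contourWeight a b β μ t * (contourPath a b t - l)⁻¹ ^ 2 = -(fdSlope β μ l : ℂ) := by
  set f : ℂ → ℂ := fun z => fermiDirac (β * (z - μ)) with hf
  set F : ℂ → ℂ := fun z => f z * (z - l)⁻¹ ^ 2 with hF
  set A : ℂ := deriv f l with hA
  have hAe : A = -(fdSlope β μ l : ℂ) := (hasDerivAt_fermiDirac β μ l).deriv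
  set U : Set ℂ := {z | 1 + Complex.exp (β * (z - μ)) ≠ 0} with hUdef
  have hUo : IsOpen U := isOpen_ne_fun (by fun_prop) continuous_const
  have him : ∀ z : ℂ, |z.im| ≤ b → |(β * (z - μ) : ℂ).im| ≤ 3 / 4 := fun z hz => by
    have e : (β * (z - μ) : ℂ).im = β * z.im := by simp
    rw [e, abs_mul, abs_of_pos hβ]
    calc β * |z.im| ≤ β * (3 / 4 * β⁻¹) := by gcongr; linarith
      _ = 3 / 4 := by field_simp
  have hU : ∀ z : ℂ, |z.im| ≤ b → z ∈ U := fun z hz => by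
    have := (one_add_exp_bounds (him z hz)).1
    exact norm_pos_iff.1 (by linarith)
  have hlU : (l : ℂ) ∈ U := hU l (by simpa using hb.le)
  have hfd : DifferentiableOn ℂ f U := fun z hz => by
    have : DifferentiableAt ℂ f z := by
      simp only [hf]
      unfold fermiDirac
      exact (differentiableAt_const _).div (by fun_prop) hz
    exact this.differentiableWithinAt
  -- The second divided difference of f at l is holomorphic across l, so F is h plus the principal
  -- part f'(l)/(z - l) + f(l)/(z - l)². Cauchy's theorem removes h.
  set h : ℂ → ℂ := dslope (dslope f l) l with hh
  have hhd : DifferentiableOn ℂ h U := by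
    rw [hh, Complex.differentiableOn_dslope (hUo.mem_nhds hlU),
      Complex.differentiableOn_dslope (hUo.mem_nhds hlU)]
    exact hfd
  have hdec : ∀ z : ℂ, z - l ≠ 0 → F z = h z + (A * (z - l)⁻¹ + f l * (z - l)⁻¹ ^ 2) := fun z hz => by
    have hzl : z ≠ l := sub_ne_zero.1 hz
    simp only [hF, hh]
    rw [dslope_of_ne _ hzl, slope_def_field, dslope_of_ne _ hzl, slope_def_field, dslope_same, ← hA]
    field_simp
    ring
  have hcomp : ∀ {w : ℝ → ℂ}, Continuous w → (∀ x, |(w x).im| ≤ b) → Continuous fun x => h (w x) :=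
    fun hw hwb => hhd.continuousOn.comp_continuous hw fun x => hU _ (hwb x)
  have hcomp' : ∀ {w : ℝ → ℂ}, Continuous w → (∀ x, w x - l ≠ 0) →
      Continuous fun x => A * (w x - l)⁻¹ + f l * (w x - l)⁻¹ ^ 2 := fun {w} hw hne => by
    have : Continuous fun x => (w x - l)⁻¹ := (hw.sub continuous_const).inv₀ hne
    fun_prop
  have hFi : Integrable fun t => F (contourPath a b t) := by
    have hne : ∀ t, contourPath a b t - l ≠ 0 := fun t => (resolventBound_contourPath ha hb t).ne hl
    have hc := continuous_contourPath a b
    have hfc : Continuous fun t => f (contourPath a b t) :=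
      continuous_fermiDirac_comp (by fun_prop) (im_contourPath_le hβ hb hbβ μ)
    refine ((integrable_contourWeight hβ hb hbβ μ (a := a) (contourConst a b)).const_mul
      ‖(2 * Real.pi * Complex.I : ℂ)‖).mono' (hfc.mul (((hc.sub continuous_const).inv₀ hne).pow 2)).aestronglyMeasurable
      (.of_forall fun t => ?_)
    have h1 : ‖(contourPath a b t - l)⁻¹‖ ≤ contourConst a b * (1 + |t|) := by
      refine ((resolventBound_contourPath ha hb t).norm_inv_le hl).trans ?_
      exact mul_le_of_le_one_right (resolventBound_contourPath ha hb t).1.le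
        (inv_le_one_of_one_le₀ (by linarith))
    have h2 : ‖(2 * Real.pi * Complex.I : ℂ)‖ * ‖contourWeight a b β μ t‖ = ‖f (contourPath a b t)‖ := by
      rw [contourWeight, ← norm_mul, ← mul_assoc, mul_one_div_cancel (by simp [Real.pi_ne_zero]),
        one_mul, norm_mul, norm_contourSpeed, one_mul]
    rw [← mul_assoc, h2, hF, norm_mul, norm_pow]
    gcongr
  have hrect : ∀ R : ℝ, l < R → rectIntegral a b R F = 2 * Real.pi * Complex.I * A := fun R hR => by
    have n1 : ∀ x : ℝ, (x - b * Complex.I - l : ℂ) ≠ 0 := fun x h0 => by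
      have := congrArg Complex.im h0; simp at this; linarith
    have n2 : ∀ x : ℝ, (x + b * Complex.I - l : ℂ) ≠ 0 := fun x h0 => by
      have := congrArg Complex.im h0; simp at this; linarith
    have n3 : ∀ y : ℝ, (R + y * Complex.I - l : ℂ) ≠ 0 := fun x h0 => by
      have := congrArg Complex.re h0; simp at this; linarith
    have n4 : ∀ y : ℝ, (-a + y * Complex.I - l : ℂ) ≠ 0 := fun x h0 => by
      have := congrArg Complex.re h0; simp at this; linarith
    have e : rectIntegral a b R F =
        rectIntegral a b R (fun z => h z + (A * (z - l)⁻¹ + f l * (z - l)⁻¹ ^ 2)) := by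
      simp only [rectIntegral]
      simp only [hdec _ (n1 _), hdec _ (n2 _), hdec _ (n3 _), hdec _ (n4 _)]
    have e2 : rectIntegral a b R (fun z => h z + (A * (z - l)⁻¹ + f l * (z - l)⁻¹ ^ 2)) =
        rectIntegral a b R h + rectIntegral a b R (fun z => A * (z - l)⁻¹ + f l * (z - l)⁻¹ ^ 2) := by
      refine rectIntegral_add (hcomp (by fun_prop) fun x => ?_) (hcomp' (by fun_prop) n1)
        (hcomp (by fun_prop) fun x => ?_) (hcomp' (by fun_prop) n2) ?_
        (hcomp' (by fun_prop) n3) ?_ (hcomp' (by fun_prop) n4)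
      · simp [abs_of_pos hb]
      · simp [abs_of_pos hb]
      · refine hhd.continuousOn.comp (by fun_prop) fun y hy => hU _ ?_
        rw [uIcc_of_le (by linarith)] at hy
        simpa using abs_le.2 hy
      · refine hhd.continuousOn.comp (by fun_prop) fun y hy => hU _ ?_
        rw [uIcc_of_le (by linarith)] at hy
        simpa using abs_le.2 hy
    rw [e, e2, rectIntegral_eq_zero hb hU hhd,
      rectIntegral_principal_part hb (by linarith) hR, zero_add]
  -- On the far side |f| ≤ 1 in the strip, so (R - l)⁻² alone makes the contribution vanish as R →
  -- ∞.
  have hright : Tendsto (fun R : ℝ => ∫ y in (-b)..b, F (R + y * Complex.I)) atTop (𝓝 0) := by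
    have hz : Tendsto (fun R : ℝ => ((R - l) ^ 2)⁻¹ * |b - -b|) atTop (𝓝 (0 * |b - -b|)) := by
      refine Tendsto.mul_const _ (tendsto_inv_atTop_zero.comp ?_)
      exact (tendsto_pow_atTop two_ne_zero).comp (tendsto_atTop_add_const_right _ (-l) tendsto_id)
    rw [zero_mul] at hz
    refine squeeze_zero_norm' ?_ hz
    filter_upwards [eventually_gt_atTop l] with R hR
    refine intervalIntegral.norm_integral_le_of_norm_le_const fun y hy => ?_
    rw [uIoc_of_le (by linarith)] at hy
    have hyb : |(R + y * Complex.I : ℂ).im| ≤ b := by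
      simpa using abs_le.2 ⟨hy.1.le, hy.2⟩
    have h1 := norm_fermiDirac_le_one (him _ hyb)
    have h2 : R - l ≤ ‖(R + y * Complex.I - l : ℂ)‖ := by
      refine le_trans ?_ (Complex.re_le_norm _)
      simp
    simp only [hF, hf]
    rw [norm_mul, norm_pow, norm_inv, inv_pow]
    have h3 : 0 < R - l := by linarith
    calc _ ≤ 1 * (‖(R + y * Complex.I - l : ℂ)‖ ^ 2)⁻¹ := by gcongr
      _ ≤ ((R - l) ^ 2)⁻¹ := by rw [one_mul]; gcongr
  have hlim := tendsto_rectIntegral ((integrableOn_upper_iff hb).2 hFi.integrableOn)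
    ((integrableOn_lower_iff hb).2 hFi.integrableOn) hright
  rw [integral_contour_eq hb hFi] at hlim
  have hconst : Tendsto (fun R => rectIntegral a b R F) atTop (𝓝 (2 * Real.pi * Complex.I * A)) := by
    refine tendsto_const_nhds.congr' ?_
    filter_upwards [eventually_gt_atTop l] with R hR
    rw [hrect R hR]
  have hfin := tendsto_nhds_unique hlim hconst
  have e : ∀ t, contourWeight a b β μ t * (contourPath a b t - l)⁻¹ ^ 2 =
      (1 / (2 * Real.pi * Complex.I) : ℂ) * (contourSpeed b t • F (contourPath a b t)) := fun t => by
    rw [contourWeight, smul_eq_mul]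
    ring
  simp_rw [e]
  rw [integral_const_mul, hfin, hAe, ← mul_assoc, one_div_mul_cancel (by simp [Real.pi_ne_zero]),
    one_mul]


/-! ### The symbol of the density response -/

/-- The energy `4π²|ξ|² + 4π²|θ(1-θ)||k|²`. -/
def segmentEnergy (k : Space) (p : ℝ × Space) : ℝ :=
  4 * Real.pi ^ 2 * ‖p.2‖ ^ 2 + 4 * Real.pi ^ 2 * (|p.1 * (1 - p.1)| * ‖k‖ ^ 2)

theorem segmentEnergy_nonneg (k : Space) (p : ℝ × Space) : 0 ≤ segmentEnergy k p := by
  unfold segmentEnergy; positivity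

theorem continuous_segmentEnergy : Continuous fun q : Space × (ℝ × Space) => segmentEnergy q.1 q.2 := by
  unfold segmentEnergy
  fun_prop

theorem continuous_segmentEnergy_right (k : Space) : Continuous (segmentEnergy k) := by
  unfold segmentEnergy
  fun_prop

theorem inv_one_add_segmentEnergy_le (k : Space) (p : ℝ × Space) :
    (1 + segmentEnergy k p)⁻¹ ≤ decay p.2 := by
  unfold decay segmentEnergy
  gcongr
  linarith [show 0 ≤ 4 * Real.pi ^ 2 * (|p.1 * (1 - p.1)| * ‖k‖ ^ 2) by positivity]

/-- Completing the square: (1-θ)|ξ|² + θ|ξ+k|² = |ξ+θk|² + θ(1-θ)|k|². The absolute value in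
`segmentEnergy` is inactive for these θ; it keeps the energy nonnegative for every real θ. -/
theorem segmentEnergy_add_smul (k ξ : Space) {θ : ℝ} (hθ : θ ∈ Ioc (0 : ℝ) 1) :
    segmentEnergy k (θ, ξ + θ • k) =
      4 * Real.pi ^ 2 * ‖ξ‖ ^ 2 +
        θ * (4 * Real.pi ^ 2 * ‖ξ + k‖ ^ 2 - 4 * Real.pi ^ 2 * ‖ξ‖ ^ 2) := by
  have h : 0 ≤ θ * (1 - θ) := mul_nonneg hθ.1.le (by linarith [hθ.2])
  rw [segmentEnergy, abs_of_nonneg h, norm_add_sq_real, norm_add_sq_real, norm_smul,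
    inner_smul_right, mul_pow, Real.norm_eq_abs, sq_abs]
  ring

/-- Feynman's parametrization. The antiderivative θ (z - A)⁻¹ (z - A - θ(B - A))⁻¹ contains no
division by B - A, so A = B needs no separate treatment. -/
theorem ResolventBound.inv_mul_inv_eq_integral {C : ℝ} {z : ℂ} (h : ResolventBound C z) {A B : ℝ}
    (hA : 0 ≤ A) (hB : 0 ≤ B) :
    (z - A)⁻¹ * (z - B)⁻¹ = ∫ θ in Ioc (0 : ℝ) 1, (z - (A + θ * (B - A) : ℝ))⁻¹ ^ 2 := by
  have hne : ∀ θ ∈ uIcc (0 : ℝ) 1, (z - (A + θ * (B - A) : ℝ)) ≠ 0 := fun θ hθ => by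
    rw [uIcc_of_le zero_le_one] at hθ
    exact h.ne (by nlinarith [hθ.1, hθ.2, mul_nonneg hθ.1 hB, mul_nonneg (sub_nonneg.2 hθ.2) hA])
  have h0 : z - A ≠ 0 := h.ne hA
  have hd : ∀ θ ∈ uIcc (0 : ℝ) 1,
      HasDerivAt (fun θ : ℝ => (z - A)⁻¹ * ((θ : ℂ) * (z - (A + θ * (B - A) : ℝ))⁻¹))
        ((z - (A + θ * (B - A) : ℝ))⁻¹ ^ 2) θ := by
    intro θ hθ
    have h1 := hne θ hθ
    have h2 : HasDerivAt (fun θ : ℝ => (z - (A + θ * (B - A) : ℝ))) (-((1 * (B - A) : ℝ) : ℂ)) θ :=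
      (((hasDerivAt_id θ).mul_const (B - A)).const_add A).ofReal_comp.const_sub z
    have h3 := ((hasDerivAt_id θ).ofReal_comp.mul (h2.inv h1)).const_mul (z - A)⁻¹
    convert! h3 using 1
    simp only [id, Pi.inv_apply]
    push_cast at h1 ⊢
    field_simp
    ring
  have hc : ContinuousOn (fun θ : ℝ => (z - (A + θ * (B - A) : ℝ))⁻¹ ^ 2) (uIcc (0 : ℝ) 1) :=
    (ContinuousOn.inv₀ (by fun_prop) hne).pow 2
  have := intervalIntegral.integral_eq_sub_of_hasDerivAt hd hc.intervalIntegrable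
  rw [← intervalIntegral.integral_of_le zero_le_one, this]
  simp

theorem ResolventBound.norm_inv_segmentEnergy_le {C : ℝ} {z : ℂ} (h : ResolventBound C z) (k : Space)
    (p : ℝ × Space) : ‖(z - segmentEnergy k p)⁻¹ ^ 2‖ ≤ C ^ 2 * decay p.2 ^ 2 := by
  rw [norm_pow, ← mul_pow]
  gcongr
  exact (h.norm_inv_le (segmentEnergy_nonneg k p)).trans
    (mul_le_mul_of_nonneg_left (inv_one_add_segmentEnergy_le k p) h.1.le)

theorem ResolventBound.continuous_inv_segmentEnergy {C : ℝ} {z : ℂ} (h : ResolventBound C z)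
    (k : Space) : Continuous fun p => (z - segmentEnergy k p : ℂ)⁻¹ ^ 2 :=
  ((continuous_const.sub (Complex.continuous_ofReal.comp (continuous_segmentEnergy_right k))).inv₀
    fun p => h.ne (segmentEnergy_nonneg k p)).pow 2

/-- The measure over which resolvents are averaged. -/
abbrev segmentMeasure : Measure (ℝ × Space) :=
  ((volume : Measure ℝ).restrict (Ioc 0 1)).prod volume

theorem integrable_decay_sq_snd : Integrable (fun p : ℝ × Space => decay p.2 ^ 2) segmentMeasure :=
  integrable_decay_sq.comp_snd _

/-- Feynman's formula replaces two resolvents at different energies by the square of one; for fixed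
θ, translating ξ by θk removes the cross term. Each integrand is now of the form to which Cauchy's
formula for the derivative applies. -/
theorem ResolventBound.symbolCorr_eq {C : ℝ} {z : ℂ} (h : ResolventBound C z) (k : Space) :
    symbolCorr z k = ∫ p, (z - segmentEnergy k p : ℂ)⁻¹ ^ 2 ∂segmentMeasure := by
  have hc := h.continuous_inv_segmentEnergy k
  have h1 : ∀ ξ, resSymbol z ξ * resSymbol z (ξ + k) =
      ∫ θ in Ioc (0 : ℝ) 1, (z - segmentEnergy k (θ, ξ + θ • k) : ℂ)⁻¹ ^ 2 := fun ξ => by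
    rw [resSymbol, resSymbol, h.inv_mul_inv_eq_integral (by positivity) (by positivity)]
    refine setIntegral_congr_fun measurableSet_Ioc fun θ hθ => ?_
    rw [segmentEnergy_add_smul k ξ hθ]
  have hsh : Continuous fun q : Space × ℝ => (z - segmentEnergy k (q.2, q.1 + q.2 • k) : ℂ)⁻¹ ^ 2 :=
    hc.comp (by fun_prop : Continuous fun q : Space × ℝ => (q.2, q.1 + q.2 • k))
  have hint : Integrable (Function.uncurry fun (ξ : Space) (θ : ℝ) =>
      (z - segmentEnergy k (θ, ξ + θ • k) : ℂ)⁻¹ ^ 2)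
      ((volume : Measure Space).prod ((volume : Measure ℝ).restrict (Ioc 0 1))) := by
    have hsm : AEStronglyMeasurable (Function.uncurry fun (ξ : Space) (θ : ℝ) =>
      (z - segmentEnergy k (θ, ξ + θ • k) : ℂ)⁻¹ ^ 2)
      ((volume : Measure Space).prod ((volume : Measure ℝ).restrict (Ioc 0 1))) :=
      hsh.aestronglyMeasurable
    have hb : ∀ θ : ℝ, Integrable fun ξ : Space => C ^ 2 * decay (ξ + θ • k) ^ 2 := fun θ =>
      (integrable_decay_sq.comp_add_right (θ • k)).const_mul _
    have hi : ∀ θ : ℝ, Integrable fun ξ : Space =>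
        (z - segmentEnergy k (θ, ξ + θ • k) : ℂ)⁻¹ ^ 2 := fun θ =>
      (hb θ).mono' (hsh.comp (by fun_prop : Continuous fun ξ : Space => (ξ, θ))).aestronglyMeasurable
        (.of_forall fun ξ => h.norm_inv_segmentEnergy_le k _)
    rw [integrable_prod_iff' hsm]
    refine ⟨.of_forall hi, ?_⟩
    refine (integrable_const (C ^ 2 * ∫ ξ, decay ξ ^ 2)).mono'
      hsm.norm.prod_swap.integral_prod_right' (.of_forall fun θ => ?_)
    rw [Real.norm_of_nonneg (integral_nonneg fun ξ => norm_nonneg _)]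
    refine (integral_mono (hi θ).norm (hb θ) fun ξ => h.norm_inv_segmentEnergy_le k _).trans_eq ?_
    rw [integral_const_mul, integral_add_right_eq_self (fun ξ => decay ξ ^ 2)]
  rw [symbolCorr, integral_prod]
  · simp_rw [h1]
    rw [integral_integral_swap hint]
    refine integral_congr_ae (.of_forall fun θ => ?_)
    exact integral_add_right_eq_self (fun ξ => (z - segmentEnergy k (θ, ξ) : ℂ)⁻¹ ^ 2) (θ • k)
  · exact (integrable_decay_sq_snd.const_mul (C ^ 2)).mono' hc.aestronglyMeasurable
      (.of_forall fun p => h.norm_inv_segmentEnergy_le k p)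

/-- The symbol of the density response. -/
def responseSymbol (β μ : ℝ) (k : Space) : ℝ :=
  ∫ p, fdSlope β μ (segmentEnergy k p) ∂segmentMeasure

/-- Fubini's theorem brings the contour integral inside, where Cauchy's formula is applied at each
energy. The sign agrees with the minus sign in the definition of M. -/
theorem integral_contourWeight_mul_symbolCorr {β a b : ℝ} (hβ : 0 < β) (ha : 0 < a) (hb : 0 < b)
    (hbβ : b ≤ 3 / 4 * β⁻¹) (μ : ℝ) (k : Space) :
    ∫ t, contourWeight a b β μ t * symbolCorr (contourPath a b t) k =
      -(responseSymbol β μ k : ℂ) := by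
  have hR := resolventBound_contourPath ha hb
  have h1 : ∀ t, contourWeight a b β μ t * symbolCorr (contourPath a b t) k =
      ∫ p, contourWeight a b β μ t * (contourPath a b t - segmentEnergy k p : ℂ)⁻¹ ^ 2
        ∂segmentMeasure := fun t => by
    rw [(hR t).symbolCorr_eq, integral_const_mul]
  simp_rw [h1]
  rw [integral_integral_swap]
  · simp_rw [integral_contourWeight_mul_inv_sq hβ ha hb hbβ μ (segmentEnergy_nonneg k _)]
    rw [integral_neg, responseSymbol, integral_complex_ofReal]
  · have hS : Integrable (fun q : ℝ × (ℝ × Space) => (‖contourWeight a b β μ q.1‖ *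
        (contourConst a b * (1 + |q.1|)) ^ 2) * decay q.2.2 ^ 2)
        ((volume : Measure ℝ).prod segmentMeasure) :=
      Integrable.mul_prod (f := fun t => ‖contourWeight a b β μ t‖ *
        (contourConst a b * (1 + |t|)) ^ 2) (g := fun p : ℝ × Space => decay p.2 ^ 2)
        (integrable_contourWeight hβ hb hbβ μ (contourConst a b)) integrable_decay_sq_snd
    have hm : Measurable fun q : ℝ × (ℝ × Space) => contourWeight a b β μ q.1 :=
      (measurable_contourWeight hβ hb hbβ μ).comp measurable_fst
    have hcont : Continuous fun q : ℝ × (ℝ × Space) =>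
        (contourPath a b q.1 - segmentEnergy k q.2 : ℂ)⁻¹ ^ 2 := by
      have h2 : Continuous fun q : ℝ × (ℝ × Space) => (contourPath a b q.1 - segmentEnergy k q.2 : ℂ) :=
        ((continuous_contourPath a b).comp continuous_fst).sub
          (Complex.continuous_ofReal.comp ((continuous_segmentEnergy_right k).comp continuous_snd))
      have h3 : ∀ q : ℝ × (ℝ × Space), (contourPath a b q.1 - segmentEnergy k q.2 : ℂ) ≠ 0 :=
        fun q => (hR q.1).ne (segmentEnergy_nonneg k q.2)
      exact (h2.inv₀ h3).pow 2
    have hn : ∀ q : ℝ × (ℝ × Space), ‖contourWeight a b β μ q.1 *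
        (contourPath a b q.1 - segmentEnergy k q.2 : ℂ)⁻¹ ^ 2‖ ≤ (‖contourWeight a b β μ q.1‖ *
        (contourConst a b * (1 + |q.1|)) ^ 2) * decay q.2.2 ^ 2 := fun q => by
      rw [norm_mul, mul_assoc]
      exact mul_le_mul_of_nonneg_left ((hR q.1).norm_inv_segmentEnergy_le k q.2) (norm_nonneg _)
    exact hS.mono' (hm.aestronglyMeasurable.mul hcont.aestronglyMeasurable) (.of_forall hn)

/-! ### Bounds for the symbol of the density response -/

theorem fdSlope_nonneg {β : ℝ} (hβ : 0 < β) (μ s : ℝ) : 0 ≤ fdSlope β μ s := by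
  unfold fdSlope; positivity

theorem continuous_fdSlope (β μ : ℝ) : Continuous (fdSlope β μ) := by
  unfold fdSlope
  refine continuous_const.mul (Continuous.div (by fun_prop) (by fun_prop) fun s => ?_)
  positivity

/-- The slope is at most β exp(-β(s - μ)), and the second-order term of the exponential series turns
this into quadratic decay. Only integrability is needed here, so the constant may depend on β and μ.
-/
theorem fdSlope_le {β : ℝ} (hβ : 0 < β) (μ : ℝ) {s : ℝ} (hs : 0 ≤ s) :
    fdSlope β μ s ≤ 2 / β * Real.exp (β * (1 + μ)) * ((1 + s)⁻¹) ^ 2 := by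
  have h1 : fdSlope β μ s ≤ β * Real.exp (-(β * (s - μ))) := by
    unfold fdSlope
    gcongr
    have he := Real.exp_pos (β * (s - μ))
    rw [Real.exp_neg, div_le_iff₀ (by positivity)]
    set E := Real.exp (β * (s - μ))
    calc E = E⁻¹ * E ^ 2 := by field_simp
      _ ≤ E⁻¹ * (1 + E) ^ 2 := by gcongr; linarith
  have h2 := Real.pow_div_factorial_le_exp (β * (1 + s)) (by positivity) 2
  have h3 : Real.exp (-(β * (s - μ))) * Real.exp (β * (1 + s)) = Real.exp (β * (1 + μ)) := by
    rw [← Real.exp_add]; ring_nf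
  refine h1.trans ?_
  rw [inv_pow, ← div_eq_mul_inv, le_div_iff₀ (by positivity)]
  calc β * Real.exp (-(β * (s - μ))) * (1 + s) ^ 2
      = 2 / β * Real.exp (-(β * (s - μ))) * ((β * (1 + s)) ^ 2 / (Nat.factorial 2 : ℕ)) := by
        simp only [Nat.factorial]; push_cast; field_simp
    _ ≤ 2 / β * Real.exp (-(β * (s - μ))) * Real.exp (β * (1 + s)) := by gcongr
    _ = _ := by rw [mul_assoc, h3]

theorem fdSlope_segmentEnergy_le {β : ℝ} (hβ : 0 < β) (μ : ℝ) (k : Space) (p : ℝ × Space) :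
    fdSlope β μ (segmentEnergy k p) ≤ 2 / β * Real.exp (β * (1 + μ)) * decay p.2 ^ 2 := by
  refine (fdSlope_le hβ μ (segmentEnergy_nonneg k p)).trans ?_
  have h0 := segmentEnergy_nonneg k p
  gcongr
  exact inv_one_add_segmentEnergy_le k p

theorem integrable_fdSlope_segmentEnergy {β : ℝ} (hβ : 0 < β) (μ : ℝ) (k : Space) :
    Integrable (fun p => fdSlope β μ (segmentEnergy k p)) segmentMeasure := by
  refine (integrable_decay_sq_snd.const_mul (2 / β * Real.exp (β * (1 + μ)))).mono'
    ((continuous_fdSlope β μ).comp (continuous_segmentEnergy_right k)).aestronglyMeasurable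
    (.of_forall fun p => ?_)
  rw [Real.norm_of_nonneg (fdSlope_nonneg hβ _ _)]
  exact fdSlope_segmentEnergy_le hβ μ k p

theorem responseSymbol_nonneg {β : ℝ} (hβ : 0 < β) (μ : ℝ) (k : Space) : 0 ≤ responseSymbol β μ k :=
  integral_nonneg fun _ => fdSlope_nonneg hβ _ _

theorem memLp_responseSymbol {β : ℝ} (hβ : 0 < β) (μ : ℝ) :
    MemLp (fun k => (responseSymbol β μ k : ℂ)) ∞ (volume : Measure Space) := by
  have hm : StronglyMeasurable (responseSymbol β μ) :=
    ((continuous_fdSlope β μ).comp continuous_segmentEnergy).stronglyMeasurable.integral_prod_right'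
      (ν := segmentMeasure)
  refine memLp_top_of_bound (Complex.continuous_ofReal.comp_aestronglyMeasurable hm.aestronglyMeasurable)
    (∫ p, 2 / β * Real.exp (β * (1 + μ)) * decay p.2 ^ 2 ∂segmentMeasure) (.of_forall fun k => ?_)
  rw [Complex.norm_real, Real.norm_of_nonneg (responseSymbol_nonneg hβ μ k)]
  exact integral_mono (integrable_fdSlope_segmentEnergy hβ μ k) (integrable_decay_sq_snd.const_mul _)
    fun p => fdSlope_segmentEnergy_le hβ μ k p


/-! ### The lower bound for the symbol of the density response -/

/-- The energy has y-derivative 8π²y, so one power of y makes the slope an exact derivative. This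
evaluates radial integrals in closed form. -/
theorem hasDerivAt_fermi_energy (β μ τ y : ℝ) :
    HasDerivAt (fun y : ℝ => -(8 * Real.pi ^ 2)⁻¹ *
        (1 + Real.exp (β * (4 * Real.pi ^ 2 * y ^ 2 + τ - μ)))⁻¹)
      (y * fdSlope β μ (4 * Real.pi ^ 2 * y ^ 2 + τ)) y := by
  have h1 : HasDerivAt (fun y : ℝ => β * (4 * Real.pi ^ 2 * y ^ 2 + τ - μ))
      (β * (4 * Real.pi ^ 2 * (2 * y))) y := by
    simpa using (((hasDerivAt_pow 2 y).const_mul (4 * Real.pi ^ 2)).add_const τ).sub_const μ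
      |>.const_mul β
  have h2 := ((h1.exp.const_add 1).inv (by positivity)).const_mul (-(8 * Real.pi ^ 2)⁻¹)
  convert! h2 using 1
  unfold fdSlope
  have := Real.exp_pos (β * (4 * Real.pi ^ 2 * y ^ 2 + τ - μ))
  field_simp
  ring

theorem tendsto_fermi_energy {β : ℝ} (hβ : 0 < β) (μ τ : ℝ) :
    Tendsto (fun y : ℝ => -(8 * Real.pi ^ 2)⁻¹ *
        (1 + Real.exp (β * (4 * Real.pi ^ 2 * y ^ 2 + τ - μ)))⁻¹) atTop (𝓝 0) := by
  have h1 : Tendsto (fun y : ℝ => β * (4 * Real.pi ^ 2 * y ^ 2 + τ - μ)) atTop atTop :=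
    (tendsto_atTop_add_const_right _ (-μ) (tendsto_atTop_add_const_right _ τ
      ((tendsto_pow_atTop two_ne_zero).const_mul_atTop (by positivity)))).const_mul_atTop hβ
  have h2 := tendsto_inv_atTop_zero.comp
    (tendsto_atTop_add_const_left _ (1 : ℝ) (Real.tendsto_exp_atTop.comp h1))
  have h3 := h2.const_mul (-(8 * Real.pi ^ 2)⁻¹)
  rw [mul_zero] at h3
  exact h3

theorem integrable_fdSlope_energy {β : ℝ} (hβ : 0 < β) (μ : ℝ) {τ : ℝ} (hτ : 0 ≤ τ) :
    Integrable fun ξ : Space => fdSlope β μ (4 * Real.pi ^ 2 * ‖ξ‖ ^ 2 + τ) := by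
  refine (integrable_decay_sq.const_mul (2 / β * Real.exp (β * (1 + μ)))).mono'
    ((continuous_fdSlope β μ).comp (by fun_prop)).aestronglyMeasurable (.of_forall fun ξ => ?_)
  rw [Real.norm_of_nonneg (fdSlope_nonneg hβ _ _)]
  refine (fdSlope_le hβ μ (by positivity)).trans ?_
  unfold decay
  gcongr
  linarith

/-- The universal constant in the lower bound for the density response. -/
def responseConst : ℝ :=
  3 * (volume.real (Metric.ball (0 : Space) 1) * (64 * Real.pi ^ 3)⁻¹)

theorem responseConst_pos : 0 < responseConst := by
  have h : 0 < volume.real (Metric.ball (0 : Space) 1) :=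
    ENNReal.toReal_pos (Metric.measure_ball_pos _ _ one_pos).ne' measure_ball_lt_top.ne
  unfold responseConst
  positivity

/-- In polar coordinates the radial weight is y². Outside the radius r where the energy equals μ, it
is at least r y, and the integral of y times the slope over (r, ∞) is (8π²)⁻¹ · 1/2 whatever β is,
since the Fermi-Dirac function is 1/2 at r. With r ≥ √μ/(4π) this gives √μ/(64π³); the factor 3
times the volume of the unit ball is the area of the sphere. -/
theorem le_integral_fdSlope_energy {β μ τ : ℝ} (hβ : 0 < β) (hμ : 0 < μ) (hτ : 0 ≤ τ)
    (hτμ : τ ≤ μ / 4) :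
    responseConst * Real.sqrt μ ≤
      ∫ ξ : Space, fdSlope β μ (4 * Real.pi ^ 2 * ‖ξ‖ ^ 2 + τ) := by
  have hπ := Real.pi_pos
  have hi := (integrable_fun_norm_addHaar (volume : Measure Space)
    (f := fun y => fdSlope β μ (4 * Real.pi ^ 2 * y ^ 2 + τ))).1 (integrable_fdSlope_energy hβ μ hτ)
  rw [integral_fun_norm_addHaar (volume : Measure Space)
    (fun y => fdSlope β μ (4 * Real.pi ^ 2 * y ^ 2 + τ))]
  simp only [finrank_euclideanSpace, Fintype.card_fin, Nat.add_one_sub_one, smul_eq_mul,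
    nsmul_eq_mul] at hi ⊢
  set r := Real.sqrt (μ - τ) / (2 * Real.pi) with hr
  have hr0 : 0 ≤ r := by positivity
  have hrsq : 4 * Real.pi ^ 2 * r ^ 2 + τ - μ = 0 := by
    rw [hr, div_pow, Real.sq_sqrt (by linarith)]
    field_simp
    ring
  -- The bound τ ≤ μ/4 leaves μ - τ ≥ 3μ/4, more than the μ/4 needed here.
  have hrμ : Real.sqrt μ / (4 * Real.pi) ≤ r := by
    have : Real.sqrt μ / 2 ≤ Real.sqrt (μ - τ) :=
      Real.le_sqrt_of_sq_le (by rw [div_pow, Real.sq_sqrt hμ.le]; linarith)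
    rw [hr, div_le_div_iff₀ (by positivity) (by positivity)]
    nlinarith
  have hd : ∀ y ∈ Ici r, HasDerivAt _ (y * fdSlope β μ (4 * Real.pi ^ 2 * y ^ 2 + τ)) y :=
    fun y _ => hasDerivAt_fermi_energy β μ τ y
  have hp : ∀ y ∈ Ioi r, 0 ≤ y * fdSlope β μ (4 * Real.pi ^ 2 * y ^ 2 + τ) := fun y hy =>
    mul_nonneg (hr0.trans (le_of_lt hy)) (fdSlope_nonneg hβ _ _)
  have hF := integral_Ioi_of_hasDerivAt_of_nonneg' hd hp (tendsto_fermi_energy hβ μ τ)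
  have hFi := integrableOn_Ioi_deriv_of_nonneg' hd hp (tendsto_fermi_energy hβ μ τ)
  simp only [hrsq, mul_zero, Real.exp_zero] at hF
  have hsub : Ioi r ⊆ Ioi (0 : ℝ) := Ioi_subset_Ioi hr0
  have key : (64 * Real.pi ^ 3)⁻¹ * Real.sqrt μ ≤
      ∫ y in Ioi (0 : ℝ), y ^ 2 * fdSlope β μ (4 * Real.pi ^ 2 * y ^ 2 + τ) := by
    calc (64 * Real.pi ^ 3)⁻¹ * Real.sqrt μ
        = Real.sqrt μ / (4 * Real.pi) * (16 * Real.pi ^ 2)⁻¹ := by field_simp; norm_num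
      _ ≤ r * (16 * Real.pi ^ 2)⁻¹ := by gcongr
      _ = r * ∫ y in Ioi r, y * fdSlope β μ (4 * Real.pi ^ 2 * y ^ 2 + τ) := by
          rw [hF]; field_simp; ring
      _ = ∫ y in Ioi r, r * (y * fdSlope β μ (4 * Real.pi ^ 2 * y ^ 2 + τ)) :=
          (integral_const_mul _ _).symm
      _ ≤ ∫ y in Ioi r, y ^ 2 * fdSlope β μ (4 * Real.pi ^ 2 * y ^ 2 + τ) := by
          refine setIntegral_mono_on (hFi.const_mul r) (hi.mono_set hsub) measurableSet_Ioi
            fun y hy => ?_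
          exact (mul_le_mul_of_nonneg_right (le_of_lt hy) (hp y hy)).trans_eq (by ring)
      _ ≤ _ := setIntegral_mono_set hi
          (.of_forall fun y => mul_nonneg (sq_nonneg y) (fdSlope_nonneg hβ _ _))
          hsub.eventuallyLE
  rw [responseConst, mul_assoc, mul_assoc]
  push_cast
  gcongr

/-- Since θ(1-θ) ≤ 1/4, the energy shift is at most μ/4 for every θ in (0, 1], and the lower bound
at fixed θ is averaged over an interval of length one. -/
theorem le_responseSymbol {β μ : ℝ} (hβ : 0 < β) (hμ : 0 < μ) {k : Space}
    (hk : 4 * Real.pi ^ 2 * ‖k‖ ^ 2 ≤ μ) :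
    responseConst * Real.sqrt μ ≤ responseSymbol β μ k := by
  have hi := integrable_fdSlope_segmentEnergy hβ μ k
  rw [responseSymbol, integral_prod _ hi]
  have hc : responseConst * Real.sqrt μ =
      ∫ _ in Ioc (0 : ℝ) 1, responseConst * Real.sqrt μ := by simp
  rw [hc]
  refine setIntegral_mono_on (integrable_const _) hi.integral_prod_left measurableSet_Ioc
    fun θ hθ => ?_
  refine le_integral_fdSlope_energy (τ := 4 * Real.pi ^ 2 * (|θ * (1 - θ)| * ‖k‖ ^ 2)) hβ hμ
    (by positivity) ?_
  have h1 : |θ * (1 - θ)| ≤ 1 / 4 := by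
    rw [abs_of_nonneg (mul_nonneg hθ.1.le (by linarith [hθ.2]))]
    nlinarith [sq_nonneg (θ - 1 / 2)]
  calc 4 * Real.pi ^ 2 * (|θ * (1 - θ)| * ‖k‖ ^ 2) = |θ * (1 - θ)| * (4 * Real.pi ^ 2 * ‖k‖ ^ 2) := by
        ring
    _ ≤ 1 / 4 * μ := by gcongr
    _ = μ / 4 := by ring


/-! ### The density response as a Fourier multiplier -/

theorem integrable_responseIntegrand {β a b : ℝ} (hβ : 0 < β) (ha : 0 < a) (hb : 0 < b)
    (hbβ : b ≤ 3 / 4 * β⁻¹) (μ : ℝ) (φ g : LTwo) :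
    Integrable fun t => responseIntegrand β μ φ g (contourPath a b t) := by
  have hR := resolventBound_contourPath ha hb
  have hc : Continuous fun t => fermiDirac (β * (contourPath a b t - μ)) :=
    continuous_fermiDirac_comp (by have := continuous_contourPath a b; fun_prop)
      (im_contourPath_le hβ hb hbβ μ)
  have hn : ∀ t, ‖fermiDirac (β * (contourPath a b t - μ))‖ =
      2 * Real.pi * ‖contourWeight a b β μ t‖ := fun t => by
    rw [contourWeight, norm_mul, norm_mul, norm_contourSpeed, norm_div, norm_mul, norm_mul]
    have := Real.pi_pos
    simp [abs_of_pos this]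
    field_simp
  have hi : Integrable fun t => ‖fermiDirac (β * (contourPath a b t - μ))‖ *
      (contourConst a b * (1 + |t|)) ^ 2 := by
    simp_rw [hn, mul_assoc (2 * Real.pi)]
    exact (integrable_contourWeight hβ hb hbβ μ _).const_mul _
  refine (integrable_smul_sandwich (continuous_contourPath a b) hc.aestronglyMeasurable hR hi φ g).congr
    (.of_forall fun t => ((hR t).responseIntegrand_eq β μ φ g).symm)

theorem responseContourOp_eq {β a b : ℝ} (hβ : 0 < β) (ha : 0 < a) (hb : 0 < b)
    (hbβ : b ≤ 3 / 4 * β⁻¹) (μ : ℝ) (φ g : LTwo) : responseContourOp a b β μ φ g =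
    ∫ t, contourWeight a b β μ t • sandwich φ g (contourPath a b t) := by
  have hR := resolventBound_contourPath ha hb
  have h : contourIntegral a b (responseIntegrand β μ φ g) = _ :=
    integral_contour_eq hb (integrable_responseIntegrand hβ ha hb hbβ μ φ g)
  rw [responseContourOp, h, ← integral_smul]
  refine integral_congr_ae (.of_forall fun t => ?_)
  simp only [(hR t).responseIntegrand_eq, smul_smul, contourWeight, mul_assoc]

theorem isDensityResponse_fourierMul {β a b : ℝ} (hβ : 0 < β) (ha : 0 < a) (hb : 0 < b)
    (hbβ : b ≤ 3 / 4 * β⁻¹) (μ : ℝ) :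
    IsDensityResponse a b β μ (fourierMul fun k => (responseSymbol β μ k : ℂ)) := by
  intro φ
  refine ⟨fun g => contourIntegrable_of_integrable hb
    (integrable_responseIntegrand hβ ha hb hbβ μ φ g), (locallyIntegrable_coeFn _).neg,
    fun χ hχ hc ι e => ?_⟩
  -- A smooth compactly supported χ is a Schwartz function, hence the Fourier transform of one, the
  -- form in which the trace formula takes its test functions.
  set ψ : 𝓢(Space, ℂ) := 𝓕⁻ (hc.toSchwartzMap hχ) with hψ
  have hψχ : ((𝓕 ψ : 𝓢(Space, ℂ)) : Space → ℂ) = χ := by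
    rw [hψ, fourier_fourierInv_eq]; rfl
  obtain ⟨K, hK⟩ := hc.exists_bound_of_continuous hχ.continuous
  have hχm : MemLp χ ∞ (volume : Measure Space) := memLp_top_of_continuous hχ.continuous hK
  have := hasSum_trace_path (continuous_contourPath a b)
    (measurable_contourWeight hβ hb hbβ μ).aestronglyMeasurable (resolventBound_contourPath ha hb)
    (integrable_contourWeight hβ hb hbβ μ _) (memLp_responseSymbol hβ μ)
    (integral_contourWeight_mul_symbolCorr hβ ha hb hbβ μ) ψ φ e
  rw [hψχ] at this
  simpa only [mulOp_eq_mulLp hχm, responseContourOp_eq hβ ha hb hbβ μ] using this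

theorem isDensityResponse_densityResponse {β a b : ℝ} (hβ : 0 < β) (ha : 0 < a) (hb : 0 < b)
    (hbβ : b ≤ 3 / 4 * β⁻¹) (μ : ℝ) :
    IsDensityResponse a b β μ (densityResponse a b β μ) := by
  have h : ∃ M, IsDensityResponse a b β μ M := ⟨_, isDensityResponse_fourierMul hβ ha hb hbβ μ⟩
  rw [densityResponse, dif_pos h]
  exact h.choose_spec

theorem densityResponse_eq_fourierMul {β a b : ℝ} (hβ : 0 < β) (ha : 0 < a) (hb : 0 < b)
    (hbβ : b ≤ 3 / 4 * β⁻¹) (μ : ℝ) :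
    densityResponse a b β μ = fourierMul fun k => (responseSymbol β μ k : ℂ) :=
  (isDensityResponse_densityResponse hβ ha hb hbβ μ).unique
    (isDensityResponse_fourierMul hβ ha hb hbβ μ)

/-! ### The quadratic form of the linearized operator -/

theorem linearizedOp_apply (a b β μ : ℝ) (u : sobolevTwo) : linearizedOp a b β μ u =
    (1 / (4 * Real.pi) : ℂ) • negLaplacian u + densityResponse a b β μ (u : LTwo) := rfl

/-- A form with real symbol `m` is the integral of `m` against `|𝓕 u|²`. -/
theorem inner_eq_ofReal_integral {u v : LTwo} {m : Space → ℝ}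
    (h : (𝓕 v : LTwo) =ᵐ[volume] fun ξ => (m ξ : ℂ) * (𝓕 u : LTwo) ξ) :
    Integrable (fun ξ => m ξ * ‖(𝓕 u : LTwo) ξ‖ ^ 2) ∧
      ⟪u, v⟫_ℂ = ((∫ ξ, m ξ * ‖(𝓕 u : LTwo) ξ‖ ^ 2 : ℝ) : ℂ) := by
  have hp : (fun ξ => ⟪(𝓕 u : LTwo) ξ, (𝓕 v : LTwo) ξ⟫_ℂ) =ᵐ[volume]
      fun ξ => ((m ξ * ‖(𝓕 u : LTwo) ξ‖ ^ 2 : ℝ) : ℂ) := by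
    filter_upwards [h] with ξ hξ
    rw [hξ, RCLike.inner_apply, mul_assoc, Complex.mul_conj, Complex.normSq_eq_norm_sq]
    push_cast; rfl
  constructor
  · have hi := (L2.integrable_inner (𝕜 := ℂ) (𝓕 u : LTwo) (𝓕 v : LTwo)).congr hp
    exact hi.re
  · rw [← Lp.inner_fourier_eq, L2.inner_def, integral_congr_ae hp, integral_complex_ofReal]

/-- The coefficient 1/(4π) is split into two halves 1/(8π). One half is kept for the kinetic energy
e. If e ≥ m_*, the other half dominates m_*; if e ≤ m_* ≤ μ, the response symbol is at least a
constant times √μ ≥ m_*. -/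
theorem symbol_lower_bound {β μ : ℝ} (hβ : 0 < β) (hμ : 0 < μ) (k : Space) :
    min (8 * Real.pi)⁻¹ responseConst * (4 * Real.pi ^ 2 * ‖k‖ ^ 2 + min μ (Real.sqrt μ)) ≤
      (4 * Real.pi)⁻¹ * (4 * Real.pi ^ 2 * ‖k‖ ^ 2) + responseSymbol β μ k := by
  have hπ := Real.pi_pos
  have hr := responseConst_pos
  have hs := Real.sqrt_nonneg μ
  set e := 4 * Real.pi ^ 2 * ‖k‖ ^ 2 with he
  have he0 : 0 ≤ e := by positivity
  have hm0 : 0 ≤ min μ (Real.sqrt μ) := le_min hμ.le hs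
  have h8 : (4 * Real.pi)⁻¹ = (8 * Real.pi)⁻¹ + (8 * Real.pi)⁻¹ := by field_simp; norm_num
  have hp8 : 0 ≤ (8 * Real.pi)⁻¹ := by positivity
  have hM := responseSymbol_nonneg hβ μ k
  have hc1 := min_le_left (8 * Real.pi)⁻¹ responseConst
  have hc2 := min_le_right (8 * Real.pi)⁻¹ responseConst
  rw [mul_add, h8, add_mul]
  have h1 := mul_le_mul_of_nonneg_right hc1 he0
  rcases le_total (min μ (Real.sqrt μ)) e with h | h
  · have h2 := mul_le_mul hc1 h hm0 hp8
    linarith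
  · have h2 := mul_le_mul hc2 (min_le_right μ (Real.sqrt μ)) hm0 hr.le
    have h3 := le_responseSymbol hβ hμ (k := k) (h.trans (min_le_left _ _))
    have h4 := mul_nonneg hp8 he0
    linarith

theorem inner_linearizedOp_ge {β μ a b : ℝ} (hβ : 0 < β) (hμ : 0 < μ) (ha : 0 < a) (hb : 0 < b)
    (hbβ : b ≤ 3 / 4 * β⁻¹) (u : sobolevTwo) :
    ∃ r s : ℝ, ⟪(u : LTwo), negLaplacian u + ((min μ (Real.sqrt μ) : ℝ) : ℂ) • (u : LTwo)⟫_ℂ = r ∧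
      ⟪(u : LTwo), linearizedOp a b β μ u⟫_ℂ = s ∧ min (8 * Real.pi)⁻¹ responseConst * r ≤ s := by
  have hL := fourier_negLaplacian u
  rw [linearizedOp_apply, densityResponse_eq_fourierMul hβ ha hb hbβ μ]
  generalize (negLaplacian u : LTwo) = w at hL ⊢
  generalize (u : LTwo) = v at hL ⊢
  have h1 : (𝓕 (w + ((min μ (Real.sqrt μ) : ℝ) : ℂ) • v) : LTwo) =ᵐ[volume] fun ξ =>
      ((4 * Real.pi ^ 2 * ‖ξ‖ ^ 2 + min μ (Real.sqrt μ) : ℝ) : ℂ) * (𝓕 v : LTwo) ξ := by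
    rw [FourierAdd.fourier_add, FourierSMul.fourier_smul]
    filter_upwards [hL, Lp.coeFn_add (𝓕 w : LTwo) (((min μ (Real.sqrt μ) : ℝ) : ℂ) • (𝓕 v : LTwo)),
      Lp.coeFn_smul ((min μ (Real.sqrt μ) : ℝ) : ℂ) (𝓕 v : LTwo)] with ξ e1 e2 e3
    rw [e2, Pi.add_apply, e1, e3, Pi.smul_apply, smul_eq_mul, Complex.ofReal_add, add_mul]
  have h2 : (𝓕 ((1 / (4 * Real.pi) : ℂ) • w + fourierMul (fun k => (responseSymbol β μ k : ℂ)) v) :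
      LTwo) =ᵐ[volume] fun ξ => (((4 * Real.pi)⁻¹ * (4 * Real.pi ^ 2 * ‖ξ‖ ^ 2) +
        responseSymbol β μ ξ : ℝ) : ℂ) * (𝓕 v : LTwo) ξ := by
    rw [FourierAdd.fourier_add, FourierSMul.fourier_smul, fourier_fourierMul]
    filter_upwards [hL, Lp.coeFn_add ((1 / (4 * Real.pi) : ℂ) • (𝓕 w : LTwo))
      (mulLp (fun k => (responseSymbol β μ k : ℂ)) (𝓕 v : LTwo)),
      Lp.coeFn_smul (1 / (4 * Real.pi) : ℂ) (𝓕 w : LTwo),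
      coeFn_mulLp (memLp_responseSymbol hβ μ) (𝓕 v : LTwo)] with ξ e1 e2 e3 e4
    rw [e2, Pi.add_apply, e3, Pi.smul_apply, e1, e4, smul_eq_mul]
    push_cast
    ring
  obtain ⟨i1, q1⟩ := inner_eq_ofReal_integral h1
  obtain ⟨i2, q2⟩ := inner_eq_ofReal_integral h2
  refine ⟨_, _, q1, q2, ?_⟩
  rw [← integral_const_mul]
  refine integral_mono (i1.const_mul _) i2 fun ξ => ?_
  exact (mul_assoc _ _ _).symm.trans_le
    (mul_le_mul_of_nonneg_right (symbol_lower_bound hβ hμ ξ) (sq_nonneg _))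

end REHF

end

open scoped ComplexOrder in
theorem mainTheorem5 :
    ∃ c₀ : ℝ, 0 < c₀ ∧ ∀ β μ a b : ℝ, 0 < β → 0 < μ → 0 < a → 0 < b → b ≤ 3 / 4 * β⁻¹ →
      REHF.IsDensityResponse a b β μ (REHF.densityResponse a b β μ) ∧
      ∀ u : REHF.sobolevTwo,
        (c₀ : ℂ) * ⟪(u : REHF.LTwo),
            REHF.negLaplacian u + ((min μ (Real.sqrt μ) : ℝ) : ℂ) • (u : REHF.LTwo)⟫_ℂ
          ≤ ⟪(u : REHF.LTwo), REHF.linearizedOp a b β μ u⟫_ℂ := by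
  refine ⟨min (8 * Real.pi)⁻¹ REHF.responseConst,
    lt_min (inv_pos.2 (mul_pos (by norm_num) Real.pi_pos)) REHF.responseConst_pos,
    fun β μ a b hβ hμ ha hb hbβ => ⟨REHF.isDensityResponse_densityResponse hβ ha hb hbβ μ,
      fun u => ?_⟩⟩
  obtain ⟨r, s, hr, hs, h⟩ := REHF.inner_linearizedOp_ge hβ hμ ha hb hbβ u
  -- The order on ℂ compares only numbers with equal imaginary parts, so the inequality also encodes
  -- that ⟨u, Lu⟩ is real; both forms are therefore first written as real numbers.
  rw [hr, hs, ← Complex.ofReal_mul, Complex.real_le_real]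
  exact h
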